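/- Let $\sigma$ be $\infty$ or a prime number $p$, let $\mathbb{Q}_\infty=\mathbb{R}$, and let $|\cdot|$ be the usual absolute value on $\mathbb{Q}_\sigma$ (the $p$-adic one if $\sigma=p$). Let $\mathbf{G}\le \mathrm{GL}_n$ be a Zariski connected linear algebraic group defined over $\mathbb{Q}_\sigma$ whose radical (the largest closed connected normal solvable subgroup) equals its unipotent radical (the largest closed connected normal unipotent subgroup). Let $a\in\mathbf{G}(\mathbb{Q}_\sigma)$ be an element of class-$\mathcal{A}'$, that is, $a\neq e$, $a$ is diagonalizable over $\mathbb{Q}_\sigma$, and its eigenvalues are positive real numbers if $\sigma=\infty$, respectively are all integral powers of one fixed $\lambda\in\mathbb{Q}_p^\times$ with $|\lambda|\neq 1$ if $\sigma=p$. If $a$ acts on a finite dimensional $\mathbb{Q}_\sigma$-vector space $V$ by a linear operator $T$, let $V_a^0$ be the eigenspace of $T$ for the eigenvalue $1$, and let $V_a^-$ (resp. $V_a^+$) be the sum of the eigenspaces of $T$ for eigenvalues of absolute value $<1$ (resp. $>1$). In particular this defines $\mathfrak{g}_a^-$, $\mathfrak{g}_a^0$, $\mathfrak{g}_a^+$ for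 the operator $\mathrm{Ad}_a$ on the Lie algebra $\mathfrak{g}$ of $\mathbf{G}(\mathbb{Q}_\sigma)$. Let $G_a^-=\exp(\mathfrak{g}_a^-)\le\mathbf{G}(\mathbb{Q}_\sigma)$ be the stable horospherical subgroup. Let $\rho:\mathbf{G}\to\mathrm{Aut}(V)$ be an algebraic representation, defined over $\mathbb{Q}_\sigma$, on a finite dimensional $\mathbb{Q}_\sigma$-vector space $V$, and let $a$ act on $V$ by $\rho(a)$. Then for every nonzero $w\in V_a^+$ there is an element $u\in G_a^-$ such that $\rho(u)w\notin V_a^+ + V_a^0$. In particular, for every nonzero $w\in\mathfrak{g}_a^+$ there is some $u\in G_a^-$ with $\mathrm{Ad}_u(w)\notin\mathfrak{g}_a^+ + \mathfrak{g}_a^0$. -/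

import Mathlib

open scoped TensorProduct

noncomputable section

/-! ## The fields `ℚ_σ` -/

/-- A place of `ℚ`: the real place or a prime number. -/
inductive Place : Type
  | infinite : Place
  | finite (p : ℕ) [Fact p.Prime] : Place

/-- The completion `ℚ_σ`: the real numbers, or the `p`-adic numbers. -/
def Place.Completion : Place → Type
  | .infinite => ℝ
  | @Place.finite p _ => ℚ_[p]

/-- The field `ℚ_σ` with its usual absolute value, respectively the `p`-adic one. -/
instance Place.instNontriviallyNormedField :
    (σ : Place) → NontriviallyNormedField σ.Completion
  | .infinite => inferInstanceAs (NontriviallyNormedField ℝ)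
  | @Place.finite p _ => inferInstanceAs (NontriviallyNormedField ℚ_[p])

instance Place.instCharZero : (σ : Place) → CharZero σ.Completion
  | .infinite => inferInstanceAs (CharZero ℝ)
  | @Place.finite p _ => inferInstanceAs (CharZero ℚ_[p])

/-! ## The Zariski topology and linear algebraic groups -/

/-- The matrix entries of `g`, as a point of affine `n²`-space. -/
def Matrix.GeneralLinearGroup.entries {n : ℕ} {F : Type*} [Field F] (g : GL (Fin n) F) :
    Fin n × Fin n → F :=
  fun ij => (g : Matrix (Fin n) (Fin n) F) ij.1 ij.2

/-- The Zariski topology on `GL_n(F)`, induced from affine `n²`-space. -/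
@[reducible] def zariskiTopology (n : ℕ) (F : Type*) [Field F] :
    TopologicalSpace (GL (Fin n) F) :=
  TopologicalSpace.induced
    (fun g => (MvPolynomial.pointToPoint g.entries :
      PrimeSpectrum (MvPolynomial (Fin n × Fin n) F)))
    inferInstance

/-- The Zariski closed subsets of `GL_n(F)` are the common zero sets of polynomials in the
matrix entries. -/
theorem isClosed_zariskiTopology_iff {n : ℕ} {F : Type*} [Field F] (Z : Set (GL (Fin n) F)) :
    @IsClosed _ (zariskiTopology n F) Z ↔
      ∃ S : Set (MvPolynomial (Fin n × Fin n) F),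
        Z = {g | ∀ f ∈ S, MvPolynomial.eval g.entries f = 0} := by
  have key : ∀ (S : Set (MvPolynomial (Fin n × Fin n) F)) (g : GL (Fin n) F),
      (MvPolynomial.pointToPoint g.entries : PrimeSpectrum (MvPolynomial (Fin n × Fin n) F)) ∈
        PrimeSpectrum.zeroLocus S ↔ ∀ f ∈ S, MvPolynomial.eval g.entries f = 0 := by
    intro S g
    rw [PrimeSpectrum.mem_zeroLocus]
    refine forall₂_congr fun f _ => ?_
    exact (MvPolynomial.mem_vanishingIdeal_singleton_iff _ f).trans
      (by rw [MvPolynomial.aeval_eq_eval])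
  rw [isClosed_induced_iff]
  constructor
  · rintro ⟨t, ht, rfl⟩
    obtain ⟨S, rfl⟩ := (PrimeSpectrum.isClosed_iff_zeroLocus t).1 ht
    exact ⟨S, Set.ext fun g => key S g⟩
  · rintro ⟨S, rfl⟩
    exact ⟨_, PrimeSpectrum.isClosed_zeroLocus S, Set.ext fun g => key S g⟩

/-- A linear algebraic group `𝐆 ≤ GL_n` defined over `K`, given by its group of points over an
algebraic closure, which has to be the zero set in `GL_n` of polynomials with coefficients
in `K`. (Over a field of characteristic zero, being the zero set of polynomials over `K` is the
same as being defined over `K`.) -/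
structure LinearAlgebraicGroup (K : Type*) [Field K] (n : ℕ) where
  /-- the points over the algebraic closure -/
  geomPoints : Subgroup (GL (Fin n) (AlgebraicClosure K))
  definedOver : ∃ S : Set (MvPolynomial (Fin n × Fin n) K),
    ∀ g : GL (Fin n) (AlgebraicClosure K),
      g ∈ geomPoints ↔ ∀ f ∈ S, MvPolynomial.aeval g.entries f = 0

namespace LinearAlgebraicGroup

section Basic

variable {K : Type*} [Field K] {n : ℕ} (G : LinearAlgebraicGroup K n)

/-- `𝐆` is connected in the Zariski topology. -/
def IsZariskiConnected : Prop :=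
  @IsConnected _ (zariskiTopology n (AlgebraicClosure K)) (G.geomPoints : Set _)

/-- `H` is a Zariski closed, Zariski connected, normal subgroup of `𝐆`. -/
structure IsClosedConnectedNormal (H : Subgroup (GL (Fin n) (AlgebraicClosure K))) : Prop where
  le : H ≤ G.geomPoints
  normal : (H.subgroupOf G.geomPoints).Normal
  closed : @IsClosed _ (zariskiTopology n (AlgebraicClosure K)) (H : Set _)
  connected : @IsConnected _ (zariskiTopology n (AlgebraicClosure K)) (H : Set _)

/-- The radical of `𝐆`: the largest closed connected normal solvable subgroup, i.e. the one
generated by all closed connected normal solvable subgroups. -/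
def radical : Subgroup (GL (Fin n) (AlgebraicClosure K)) :=
  sSup {H | G.IsClosedConnectedNormal H ∧ Group.IsSolvable H}

/-- The unipotent radical of `𝐆`: the largest closed connected normal unipotent subgroup, i.e.
the one generated by all closed connected normal unipotent subgroups. A subgroup is unipotent if
`g - 1` is nilpotent for all its elements `g`. -/
def unipotentRadical : Subgroup (GL (Fin n) (AlgebraicClosure K)) :=
  sSup {H | G.IsClosedConnectedNormal H ∧
    ∀ g ∈ H, IsNilpotent ((g : Matrix (Fin n) (Fin n) (AlgebraicClosure K)) - 1)}

/-- The group `G = 𝐆(K)` of `K`-rational points. -/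
def points : Subgroup (GL (Fin n) K) :=
  G.geomPoints.comap (Matrix.GeneralLinearGroup.map (algebraMap K (AlgebraicClosure K)))

/-- The inclusion of the `K`-points of `𝐆` into its points over the algebraic closure. -/
def toGeom : G.points →* G.geomPoints :=
  (Matrix.GeneralLinearGroup.map (algebraMap K (AlgebraicClosure K))).subgroupComap G.geomPoints

end Basic

/-! ## The Lie algebra and the adjoint representation -/

section LieAlgebra

variable {K : Type*} [Field K] {n : ℕ} (G : LinearAlgebraicGroup K n)

/-- The derivative at the matrix `M` of the polynomial function `f` in the direction `X`. -/
def dirDeriv (f : MvPolynomial (Fin n × Fin n) K) (M X : Matrix (Fin n) (Fin n) K) : K :=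
  ∑ ij : Fin n × Fin n,
    MvPolynomial.eval (fun kl => M kl.1 kl.2) (MvPolynomial.pderiv ij f) * X ij.1 ij.2

/-- The Lie algebra `𝔤` of `𝐆` over `K`, that is, the tangent space at the identity: all
matrices `X` such that each polynomial over `K` that vanishes on `𝐆` has derivative zero at the
identity in the direction `X`. -/
def lieAlgebra : Submodule K (Matrix (Fin n) (Fin n) K) where
  carrier := {X | ∀ f : MvPolynomial (Fin n × Fin n) K,
    (∀ g ∈ G.geomPoints, MvPolynomial.aeval g.entries f = 0) → dirDeriv f 1 X = 0}
  zero_mem' := by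
    intro f _
    simp [dirDeriv]
  add_mem' := by
    intro X Y hX hY f hf
    have h1 := hX f hf
    have h2 := hY f hf
    simp only [dirDeriv] at h1 h2 ⊢
    simp [mul_add, Finset.sum_add_distrib, h1, h2]
  smul_mem' := by
    intro c X hX f hf
    have h1 := hX f hf
    simp only [dirDeriv] at h1 ⊢
    simp only [Matrix.smul_apply, smul_eq_mul, mul_left_comm _ c, ← Finset.mul_sum, h1, mul_zero]

/-- The substitution `f ↦ f (A * x * B)` on polynomials in the entries of a matrix `x`. -/
def twoSided (A B : Matrix (Fin n) (Fin n) K) :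
    MvPolynomial (Fin n × Fin n) K →ₐ[K] MvPolynomial (Fin n × Fin n) K :=
  MvPolynomial.aeval fun ij =>
    ∑ k, ∑ l, MvPolynomial.C (A ij.1 k * B l ij.2) * MvPolynomial.X (k, l)

theorem aeval_twoSided {L : Type*} [Field L] [Algebra K L] (A B : Matrix (Fin n) (Fin n) K)
    (M : Matrix (Fin n) (Fin n) L) (f : MvPolynomial (Fin n × Fin n) K) :
    MvPolynomial.aeval (fun ij => M ij.1 ij.2) (twoSided A B f) =
      MvPolynomial.aeval (fun ij =>
        (A.map (algebraMap K L) * M * B.map (algebraMap K L)) ij.1 ij.2) f := by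
  have : (MvPolynomial.aeval (fun ij : Fin n × Fin n => M ij.1 ij.2)).comp (twoSided A B) =
      MvPolynomial.aeval (fun ij =>
        (A.map (algebraMap K L) * M * B.map (algebraMap K L)) ij.1 ij.2) := by
    apply MvPolynomial.algHom_ext
    rintro ⟨i, j⟩
    simp only [twoSided, AlgHom.comp_apply, MvPolynomial.aeval_X, map_sum, map_mul,
      MvPolynomial.algHom_C, Matrix.mul_apply, Matrix.map_apply, Finset.sum_mul]
    rw [Finset.sum_comm]
    refine Finset.sum_congr rfl fun l _ => Finset.sum_congr rfl fun k _ => ?_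
    ring
  exact DFunLike.congr_fun this f

theorem dirDeriv_twoSided (A B M X : Matrix (Fin n) (Fin n) K)
    (f : MvPolynomial (Fin n × Fin n) K) :
    dirDeriv (twoSided A B f) M X = dirDeriv f (A * M * B) (A * X * B) := by
  have hev : ∀ f : MvPolynomial (Fin n × Fin n) K,
      MvPolynomial.eval (fun ij => M ij.1 ij.2) (twoSided A B f) =
        MvPolynomial.eval (fun ij => (A * M * B) ij.1 ij.2) f := by
    intro f
    have := aeval_twoSided A B M f
    simpa [MvPolynomial.aeval_eq_eval, Matrix.map_id] using this
  induction f using MvPolynomial.induction_on with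
  | C c => simp [dirDeriv, twoSided]
  | add p q hp hq =>
    simp only [dirDeriv, map_add, add_mul, Finset.sum_add_distrib] at hp hq ⊢
    rw [hp, hq]
  | mul_X p ij hp =>
    have prod : ∀ (u v : MvPolynomial (Fin n × Fin n) K) (N Y : Matrix (Fin n) (Fin n) K),
        dirDeriv (u * v) N Y =
          MvPolynomial.eval (fun ij => N ij.1 ij.2) u * dirDeriv v N Y +
            MvPolynomial.eval (fun ij => N ij.1 ij.2) v * dirDeriv u N Y := by
      intro u v N Y
      simp only [dirDeriv, Derivation.leibniz, smul_eq_mul, map_add, map_mul, Finset.mul_sum,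
        ← Finset.sum_add_distrib]
      refine Finset.sum_congr rfl fun _ _ => ?_
      ring
    have dX : ∀ (ij : Fin n × Fin n) (N Y : Matrix (Fin n) (Fin n) K),
        dirDeriv (MvPolynomial.X ij) N Y = Y ij.1 ij.2 := by
      intro ij N Y
      simp only [dirDeriv]
      rw [Finset.sum_eq_single ij]
      · simp
      · intro b _ hb
        simp [MvPolynomial.pderiv_X_of_ne hb.symm]
      · simp
    have hX : dirDeriv (twoSided A B (MvPolynomial.X ij)) M X = (A * X * B) ij.1 ij.2 := by
      have hsum : ∀ (s : Finset (Fin n)) (F : Fin n → MvPolynomial (Fin n × Fin n) K),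
          dirDeriv (∑ k ∈ s, F k) M X = ∑ k ∈ s, dirDeriv (F k) M X := by
        intro s F
        simp only [dirDeriv, map_sum, Finset.sum_mul]
        rw [Finset.sum_comm]
      have hC : ∀ c : K, dirDeriv (MvPolynomial.C c) M X = 0 := by
        intro c
        simp [dirDeriv]
      simp only [twoSided, MvPolynomial.aeval_X, hsum, prod, dX, hC, MvPolynomial.eval_C,
        mul_zero, add_zero, Matrix.mul_apply, Finset.sum_mul]
      rw [Finset.sum_comm]
      refine Finset.sum_congr rfl fun l _ => Finset.sum_congr rfl fun k _ => ?_
      ring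
    rw [map_mul, prod, prod, hp, hX, dX, hev, hev]

/-- Conjugation by a `K`-point of `𝐆` preserves the Lie algebra. -/
theorem conj_mem_lieAlgebra (g : G.points) {X : Matrix (Fin n) (Fin n) K}
    (hX : X ∈ G.lieAlgebra) :
    ((g : GL (Fin n) K) : Matrix (Fin n) (Fin n) K) * X *
      ((g⁻¹ : G.points) : GL (Fin n) K) ∈ G.lieAlgebra := by
  intro f hf
  have h := hX (twoSided ((g : GL (Fin n) K) : Matrix (Fin n) (Fin n) K)
    (((g⁻¹ : G.points) : GL (Fin n) K) : Matrix (Fin n) (Fin n) K) f) ?_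
  · rw [dirDeriv_twoSided] at h
    rw [← h]
    congr 1
    rw [mul_one, ← Units.val_mul, ← Subgroup.coe_mul, mul_inv_cancel]
    rfl
  · intro x hx
    have h1 := hf ((G.toGeom g : GL (Fin n) (AlgebraicClosure K)) * x *
      (G.toGeom g⁻¹ : GL (Fin n) (AlgebraicClosure K)))
      (mul_mem (mul_mem (G.toGeom g).2 hx) (G.toGeom g⁻¹).2)
    exact (aeval_twoSided _ _ (x : Matrix (Fin n) (Fin n) (AlgebraicClosure K)) f).trans h1

/-- The adjoint representation of `G = 𝐆(K)` on the Lie algebra: `Ad_g X = g X g⁻¹`. -/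
def Ad : Representation K G.points G.lieAlgebra where
  toFun g :=
    { toFun := fun X => ⟨_, G.conj_mem_lieAlgebra g X.2⟩
      map_add' := fun X Y => Subtype.ext (by simp [mul_add, add_mul])
      map_smul' := fun c X => Subtype.ext (by simp) }
  map_one' := by
    ext X : 2
    simp
  map_mul' g h := by
    ext X : 2
    simp [mul_assoc]

end LieAlgebra

end LinearAlgebraicGroup

/-! ## Algebraic representations -/

/-- A `K`-linear operator of a finite dimensional space can be recovered from its base change:
an operator whose matrix coefficients with respect to `K`-rational vectors and functionals lie
in `K` is defined over `K`. -/
theorem exists_baseChange_eq {K L V : Type*} [Field K] [Field L] [Algebra K L]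
    [AddCommGroup V] [Module K V] [FiniteDimensional K V] (T : Module.End L (L ⊗[K] V))
    (hT : ∀ (v : V) (φ : Module.Dual K V), ∃ c : K,
      Module.Dual.baseChange L φ (T (1 ⊗ₜ v)) = algebraMap K L c) :
    ∃ T₀ : Module.End K V, T₀.baseChange L = T := by
  choose c hc using hT
  let b := Module.finBasis K V
  refine ⟨b.constr K fun j => ∑ i, c (b j) (b.coord i) • b i, ?_⟩
  apply (b.baseChange L).ext
  intro j
  apply (b.baseChange L).ext_elem
  intro i
  have h0 : ∀ x : L ⊗[K] V, (b.baseChange L).repr x i = Module.Dual.baseChange L (b.coord i) x := by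
    intro x
    induction x using TensorProduct.induction_on with
    | zero => simp
    | tmul l v => simp [Algebra.smul_def, mul_comm]
    | add x y hx hy => simp [hx, hy]
  rw [h0, h0, Module.Basis.baseChange_apply, hc, LinearMap.baseChange_tmul,
    Module.Basis.constr_basis, Module.Dual.baseChange_apply_tmul, map_sum,
    Finset.sum_eq_single i]
  · simp [Algebra.smul_def]
  · intro k _ hk
    simp [hk]
  · simp

theorem baseChange_injective {K L V : Type*} [Field K] [Field L] [Algebra K L]
    [AddCommGroup V] [Module K V] {S T : Module.End K V}
    (h : S.baseChange L = T.baseChange L) : S = T := by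
  ext v
  have h1 := LinearMap.congr_fun h (1 ⊗ₜ v)
  rw [LinearMap.baseChange_tmul, LinearMap.baseChange_tmul] at h1
  exact Module.FaithfullyFlat.tensorProduct_mk_injective (A := K) (B := L) V h1

namespace LinearAlgebraicGroup

section Representations

variable {K : Type*} [Field K] {n : ℕ}

/-- An algebraic representation `ρ : 𝐆 → Aut(V)`, defined over `K`, on a finite dimensional
`K`-vector space `V`: a representation of the group `𝐆` on `V` extended to the algebraic closure,
such that all matrix coefficients with respect to `K`-rational vectors and functionals are
regular functions on `𝐆` defined over `K`, that is, polynomials over `K` in the matrix entries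
divided by a power of the determinant. -/
structure AlgRep (G : LinearAlgebraicGroup K n) (V : Type*) [AddCommGroup V] [Module K V]
    [FiniteDimensional K V] where
  /-- the action of the points over the algebraic closure -/
  geom : Representation (AlgebraicClosure K) G.geomPoints (AlgebraicClosure K ⊗[K] V)
  regular : ∀ (v : V) (φ : Module.Dual K V),
    ∃ (P : MvPolynomial (Fin n × Fin n) K) (k : ℕ), ∀ g : G.geomPoints,
      Module.Dual.baseChange (AlgebraicClosure K) φ (geom g (1 ⊗ₜ v)) =
        MvPolynomial.aeval (g : GL (Fin n) (AlgebraicClosure K)).entries P /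
          ((g : GL (Fin n) (AlgebraicClosure K)) : Matrix (Fin n) (Fin n) (AlgebraicClosure K)).det ^ k

namespace AlgRep

variable {G : LinearAlgebraicGroup K n} {V : Type*} [AddCommGroup V] [Module K V]
  [FiniteDimensional K V] (ρ : G.AlgRep V)

theorem exists_onPoints (g : G.points) :
    ∃ T : Module.End K V, T.baseChange (AlgebraicClosure K) = ρ.geom (G.toGeom g) := by
  apply exists_baseChange_eq
  intro v φ
  obtain ⟨P, k, h⟩ := ρ.regular v φ
  refine ⟨MvPolynomial.aeval (g : GL (Fin n) K).entries P /
    ((g : GL (Fin n) K) : Matrix (Fin n) (Fin n) K).det ^ k, ?_⟩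
  rw [h, map_div₀, map_pow]
  congr 1
  · rw [← MvPolynomial.aeval_algebraMap_apply]
    rfl
  · rw [RingHom.map_det]
    rfl

/-- The action of `G = 𝐆(K)` on `V`; by definition `ρ(g)` on `V` is the operator whose extension
to the algebraic closure is the action of `g`. -/
def onPoints : Representation K G.points V where
  toFun g := (ρ.exists_onPoints g).choose
  map_one' := by
    apply baseChange_injective (L := AlgebraicClosure K)
    rw [(ρ.exists_onPoints 1).choose_spec, map_one, map_one, LinearMap.baseChange_one]
  map_mul' g h := by
    apply baseChange_injective (L := AlgebraicClosure K)
    rw [(ρ.exists_onPoints (g * h)).choose_spec, map_mul, map_mul, LinearMap.baseChange_mul,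
      (ρ.exists_onPoints g).choose_spec, (ρ.exists_onPoints h).choose_spec]

theorem baseChange_onPoints (g : G.points) :
    (ρ.onPoints g).baseChange (AlgebraicClosure K) = ρ.geom (G.toGeom g) :=
  (ρ.exists_onPoints g).choose_spec

end AlgRep

end Representations

end LinearAlgebraicGroup

/-! ## Expanding, neutral and contracting subspaces -/

section Subspaces

variable {K : Type*} [NontriviallyNormedField K] {V : Type*} [AddCommGroup V] [Module K V]

/-- `V⁺`: the sum of the eigenspaces of `T` for eigenvalues of absolute value `> 1`. -/
def expandingSubspace (T : Module.End K V) : Submodule K V :=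
  ⨆ μ : {μ : K // 1 < ‖μ‖}, Module.End.eigenspace T μ

/-- `V⁻`: the sum of the eigenspaces of `T` for eigenvalues of absolute value `< 1`. -/
def contractingSubspace (T : Module.End K V) : Submodule K V :=
  ⨆ μ : {μ : K // ‖μ‖ < 1}, Module.End.eigenspace T μ

/-- `V⁰`: the eigenspace of `T` for the eigenvalue `1`. -/
def neutralSubspace (T : Module.End K V) : Submodule K V :=
  Module.End.eigenspace T 1

end Subspaces

/-- The stable horospherical subgroup `G_a⁻ = exp 𝔤_a⁻`, as a set of `K`-points, where `𝔤_a⁻` is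
the sum of the eigenspaces of `Ad_a` on `𝔤` for eigenvalues of absolute value `< 1`. The elements
of `𝔤_a⁻` are nilpotent matrices, so the exponential is a finite sum. -/
def LinearAlgebraicGroup.stableHorospherical {K : Type*} [NontriviallyNormedField K] [CharZero K]
    {n : ℕ} (G : LinearAlgebraicGroup K n) (a : G.points) : Set G.points :=
  {u | ∃ X ∈ contractingSubspace (G.Ad a),
    ((u : GL (Fin n) K) : Matrix (Fin n) (Fin n) K) =
      IsNilpotent.exp (X : Matrix (Fin n) (Fin n) K)}

/-! ## Elements of class `𝒜'` -/

/-- The condition on a set `E` of eigenvalues: for the real place, all are positive; for a finite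
place, all are integral powers of one fixed nonzero `l` with `|l| ≠ 1`. -/
def Place.EigenvalueCondition : (σ : Place) → Set σ.Completion → Prop
  | .infinite, E => ∀ x ∈ E, (0 : ℝ) < x
  | @Place.finite p _, E => ∃ l : ℚ_[p], l ≠ 0 ∧ ‖l‖ ≠ 1 ∧ ∀ x ∈ E, ∃ k : ℤ, x = l ^ k

/-- A subgroup `A` of `GL_n(ℚ_σ)` is of class `𝒜'` if it can be simultaneously diagonalized and
the eigenvalues of its elements satisfy the condition above. -/
def Place.IsClassA' (σ : Place) {n : ℕ} (A : Subgroup (GL (Fin n) σ.Completion)) : Prop :=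
  (∃ P : GL (Fin n) σ.Completion, ∀ a ∈ A,
    ((P * a * P⁻¹ : GL (Fin n) σ.Completion) :
      Matrix (Fin n) (Fin n) σ.Completion).IsDiag) ∧
  σ.EigenvalueCondition
    {x | ∃ a ∈ A, Module.End.HasEigenvalue
      (Matrix.toLin' (a : Matrix (Fin n) (Fin n) σ.Completion)) x}

/-- An element `a` of `G = 𝐆(ℚ_σ)` is of class `𝒜'` if it is not the identity and the group it
generates is of class `𝒜'`. -/
def LinearAlgebraicGroup.IsClassA' {σ : Place} {n : ℕ} (G : LinearAlgebraicGroup σ.Completion n)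
    (a : G.points) : Prop :=
  a ≠ 1 ∧ σ.IsClassA' (Subgroup.zpowers (a : GL (Fin n) σ.Completion))

end

/-! Suppose that `ρ(u)w` stays in `p = V⁺ + V⁰` for all `u` in `G_a⁻`. Take `u = exp(sX)` with `X`
in `𝔤⁻`. A polynomial in `s` with values in `p` has its coefficients in `p`, so all `Xᵏw` lie in `p`
(`lieAction_pow_mem`), and by polarization so does every word in `𝔤⁻` applied to `w`
(`wordSpan_le_of_pow_mem`). Since `p` is stable under `𝔤⁰` and `𝔤⁺`, and `𝔤 = 𝔤⁻ + 𝔤⁰ + 𝔤⁺`, an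
argument in the style of Poincaré–Birkhoff–Witt produces a `𝔤`-stable `W` with `w ∈ W ⊆ p`
(`exists_stable_submodule`). By connectedness in characteristic zero `W` is stable under `𝐆`, and
`𝐆` acts on it with determinant one. The eigenvalues of `a` on `W` are `1` or of absolute value `>
1`, and their product is `1`, so all of them are `1`. This contradicts `0 ≠ w ∈ V⁺`
(`exists_mulVec_notMem`).

Two facts about algebraic groups carry this; both are proved over the algebraic closure. The first
is that stability under the Lie algebra implies stability under the group (`IsPolyRep.mulVec_mem`).
The ideal of a connected group is prime. Every derivation of its function field is a combination of
left invariant ones, and in characteristic zero a function killed by all derivations is constant.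
Hence a solution of a linear differential system is a constant multiple of an invertible one
(`mem_groupIdeal_of_linear_system`).

The second is that every polynomial character `χ` is trivial (`IsPolyRep.character_eq_one`); this is
where the hypothesis on the radicals enters. The radical of the trace form on the Lie algebra
consists of nilpotent matrices, as in Cartan's criterion, so `dχ` kills it and `dχ = tr(z ·)` for
some `z` in the Lie algebra. Since `dχ` also kills brackets, `z` is central modulo the radical `J`
of the trace form on the matrix algebra spanned by the group. If `z` were not nilpotent, its
semisimple part would give a nontrivial one-parameter torus in the identity component of the
subgroup of elements central modulo `J`. That component is closed, connected, normal and solvable,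
so by hypothesis it lies in the unipotent radical and hence in `1 + J`, which consists of unipotent
matrices. So `z` is nilpotent, `dχ = 0` and `χ = 1`.

Triviality of characters is used for the determinant of `W`, and also for the determinant of the
matrices themselves: it makes the inverse equal to the adjugate, so that all representations in
question are given by polynomials. Galois descent (`mem_lieAlgebra_iff`, `tangentSpace_le_span`)
compares the rational Lie algebra with the tangent space over the closure. -/

noncomputable section

open MvPolynomial

/-! ## Polynomials on matrices and left invariant derivations -/

section MatrixPolynomials

variable {F : Type*} [Field F] {n : ℕ}

/-- Evaluation of polynomials in the entries of a matrix at a matrix over an algebra. -/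
def evalAt {R : Type*} [CommRing R] [Algebra F R] (M : Matrix (Fin n) (Fin n) R) :
    MvPolynomial (Fin n × Fin n) F →ₐ[F] R :=
  aeval fun ij => M ij.1 ij.2

theorem evalAt_X {R : Type*} [CommRing R] [Algebra F R] (M : Matrix (Fin n) (Fin n) R)
    (ij : Fin n × Fin n) : evalAt (F := F) M (X ij) = M ij.1 ij.2 :=
  aeval_X _ _

theorem evalAt_C {R : Type*} [CommRing R] [Algebra F R] (M : Matrix (Fin n) (Fin n) R) (c : F) :
    evalAt M (C c) = algebraMap F R c :=
  aeval_C _ _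

theorem evalAt_mvPolynomialX {R : Type*} [CommRing R] [Algebra F R]
    (M : Matrix (Fin n) (Fin n) R) :
    (Matrix.mvPolynomialX (Fin n) (Fin n) F).map (evalAt M) = M := by
  ext i j
  simp [evalAt_X]

theorem eval_eq_evalAt (M : Matrix (Fin n) (Fin n) F) (f : MvPolynomial (Fin n × Fin n) F) :
    eval (fun ij => M ij.1 ij.2) f = evalAt M f := by
  rw [evalAt, aeval_eq_eval]

theorem algHom_evalAt {R S : Type*} [CommRing R] [Algebra F R] [CommRing S] [Algebra F S]
    (φ : R →ₐ[F] S) (M : Matrix (Fin n) (Fin n) R) (f : MvPolynomial (Fin n × Fin n) F) :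
    φ (evalAt M f) = evalAt (M.map φ) f := by
  have : φ.comp (evalAt M) = evalAt (M.map φ) := by
    apply MvPolynomial.algHom_ext
    intro ij
    simp [evalAt_X]
  exact DFunLike.congr_fun this f

theorem evalAt_twoSided (A B M : Matrix (Fin n) (Fin n) F) (f : MvPolynomial (Fin n × Fin n) F) :
    evalAt M (LinearAlgebraicGroup.twoSided A B f) = evalAt (A * M * B) f := by
  have := LinearAlgebraicGroup.aeval_twoSided (L := F) A B M f
  simpa [evalAt, Matrix.map_id] using this

open LinearAlgebraicGroup

/-- The derivative at a point in a fixed direction, as a linear map. -/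
def dirDerivₗ (M X : Matrix (Fin n) (Fin n) F) : MvPolynomial (Fin n × Fin n) F →ₗ[F] F where
  toFun f := dirDeriv f M X
  map_add' f g := by simp [dirDeriv, add_mul, Finset.sum_add_distrib]
  map_smul' c f := by simp [dirDeriv, Finset.mul_sum, mul_assoc, smul_eq_C_mul]

@[simp]
theorem dirDerivₗ_apply (M X : Matrix (Fin n) (Fin n) F) (f : MvPolynomial (Fin n × Fin n) F) :
    dirDerivₗ M X f = dirDeriv f M X := rfl

/-- The derivative at a point of a fixed polynomial, as a linear function of the direction. -/
def differential (f : MvPolynomial (Fin n × Fin n) F) (M : Matrix (Fin n) (Fin n) F) :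
    Matrix (Fin n) (Fin n) F →ₗ[F] F where
  toFun X := dirDeriv f M X
  map_add' X Y := by simp [dirDeriv, mul_add, Finset.sum_add_distrib]
  map_smul' c X := by simp [dirDeriv, Finset.mul_sum, mul_left_comm]

@[simp]
theorem differential_apply (M X : Matrix (Fin n) (Fin n) F)
    (f : MvPolynomial (Fin n × Fin n) F) : differential f M X = dirDeriv f M X := rfl

theorem dirDeriv_C (M X : Matrix (Fin n) (Fin n) F) (c : F) : dirDeriv (C c) M X = 0 := by
  simp [dirDeriv]

theorem dirDeriv_X (M X : Matrix (Fin n) (Fin n) F) (ij : Fin n × Fin n) :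
    dirDeriv (MvPolynomial.X ij) M X = X ij.1 ij.2 := by
  simp only [dirDeriv]
  rw [Finset.sum_eq_single ij]
  · simp
  · intro b _ hb
    simp [MvPolynomial.pderiv_X_of_ne hb.symm]
  · simp

theorem dirDeriv_mul (f g : MvPolynomial (Fin n × Fin n) F) (M X : Matrix (Fin n) (Fin n) F) :
    dirDeriv (f * g) M X = evalAt M f * dirDeriv g M X + evalAt M g * dirDeriv f M X := by
  simp only [dirDeriv, Derivation.leibniz, smul_eq_mul, map_add, map_mul, Finset.mul_sum,
    ← Finset.sum_add_distrib, ← eval_eq_evalAt]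
  refine Finset.sum_congr rfl fun _ _ => ?_
  ring

/-- The left invariant derivation with value `X` at the identity. -/
def leftInvDer (X : Matrix (Fin n) (Fin n) F) :
    Derivation F (MvPolynomial (Fin n × Fin n) F) (MvPolynomial (Fin n × Fin n) F) :=
  mkDerivation F fun ij =>
    (Matrix.mvPolynomialX (Fin n) (Fin n) F * X.map (C (σ := Fin n × Fin n))) ij.1 ij.2

theorem leftInvDer_X (X : Matrix (Fin n) (Fin n) F) (ij : Fin n × Fin n) :
    leftInvDer X (MvPolynomial.X ij) =
      (Matrix.mvPolynomialX (Fin n) (Fin n) F * X.map (C (σ := Fin n × Fin n))) ij.1 ij.2 :=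
  mkDerivation_X _ _ _

/-- Both sides are derivations along evaluation at `M`, so it is enough to compare them on
coordinates, where the generic matrix specializes to `M`. -/
theorem evalAt_leftInvDer (M X : Matrix (Fin n) (Fin n) F)
    (f : MvPolynomial (Fin n × Fin n) F) :
    evalAt M (leftInvDer X f) = dirDeriv f M (M * X) := by
  induction f using MvPolynomial.induction_on with
  | C c => simp [dirDeriv_C]
  | add p q hp hq =>
    rw [map_add, map_add, hp, hq, ← dirDerivₗ_apply, ← dirDerivₗ_apply, ← dirDerivₗ_apply, map_add]
  | mul_X p ij hp =>
    rw [dirDeriv_mul, Derivation.leibniz, map_add, smul_eq_mul, smul_eq_mul, map_mul, map_mul, hp,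
      leftInvDer_X, dirDeriv_X]
    congr 2
    simp [Matrix.mul_apply, evalAt]

theorem evalAt_leftInvDer_eq_dirDeriv_twoSided (g X : Matrix (Fin n) (Fin n) F)
    (f : MvPolynomial (Fin n × Fin n) F) :
    evalAt g (leftInvDer X f) = dirDeriv (twoSided g 1 f) 1 X := by
  rw [evalAt_leftInvDer, dirDeriv_twoSided, mul_one, mul_one, mul_one]

theorem leftInvDer_add (X Y : Matrix (Fin n) (Fin n) F) :
    leftInvDer (X + Y) = leftInvDer X + leftInvDer Y := by
  apply MvPolynomial.derivation_ext
  intro ij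
  simp only [leftInvDer_X, Derivation.add_apply, Matrix.map_add C (map_add C), mul_add]
  rfl

/-- The commutator is a derivation, so coordinates suffice. On them each `leftInvDer` is right
multiplication of the generic matrix, and two in succession amount to multiplication by the product.
-/
theorem leftInvDer_lie (X Y : Matrix (Fin n) (Fin n) F) :
    leftInvDer (X * Y - Y * X) = ⁅leftInvDer X, leftInvDer Y⁆ := by
  have key : ∀ (X Y : Matrix (Fin n) (Fin n) F) (ij : Fin n × Fin n),
      leftInvDer X (leftInvDer Y (MvPolynomial.X ij)) =
        leftInvDer (X * Y) (MvPolynomial.X ij) := by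
    intro X Y ij
    simp only [leftInvDer_X, Matrix.map_mul, ← Matrix.mul_assoc]
    rw [Matrix.mul_apply, map_sum, Matrix.mul_apply]
    refine Finset.sum_congr rfl fun k _ => ?_
    rw [Derivation.leibniz, Matrix.mvPolynomialX_apply, leftInvDer_X]
    simp [mul_comm]
  apply MvPolynomial.derivation_ext
  intro ij
  rw [Derivation.commutator_apply, key, key]
  have h := leftInvDer_add (X * Y - Y * X) (Y * X)
  rw [sub_add_cancel] at h
  rw [h, Derivation.add_apply, add_sub_cancel_right]

end MatrixPolynomials

/-! ## The vanishing ideal, the tangent space at the identity, and polynomial representations -/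

section VanishingIdeal

open LinearAlgebraicGroup

variable {F : Type*} [Field F] {n : ℕ} (Γ : Subgroup (GL (Fin n) F))

/-- The ideal of polynomials in the matrix entries vanishing on `Γ`. -/
def groupIdeal : Ideal (MvPolynomial (Fin n × Fin n) F) where
  carrier := {f | ∀ g ∈ Γ, evalAt (g : Matrix (Fin n) (Fin n) F) f = 0}
  zero_mem' := by simp
  add_mem' := by
    intro f g hf hg x hx
    simp [hf x hx, hg x hx]
  smul_mem' := by
    intro c f hf x hx
    simp [hf x hx]

variable {Γ} in
theorem mem_groupIdeal {f : MvPolynomial (Fin n × Fin n) F} :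
    f ∈ groupIdeal Γ ↔ ∀ g ∈ Γ, evalAt (g : Matrix (Fin n) (Fin n) F) f = 0 := Iff.rfl

/-- The tangent space of `Γ` at the identity. -/
def tangentSpace : Submodule F (Matrix (Fin n) (Fin n) F) where
  carrier := {X | ∀ f ∈ groupIdeal Γ, dirDeriv f 1 X = 0}
  zero_mem' := by
    intro f _
    rw [← differential_apply, map_zero]
  add_mem' := by
    intro X Y hX hY f hf
    rw [← differential_apply, map_add, differential_apply, differential_apply, hX f hf, hY f hf,
      add_zero]
  smul_mem' := by
    intro c X hX f hf
    rw [← differential_apply, map_smul, differential_apply, hX f hf, smul_zero]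

variable {Γ}

theorem twoSided_mem_groupIdeal {g h : GL (Fin n) F} (hg : g ∈ Γ) (hh : h ∈ Γ)
    {f : MvPolynomial (Fin n × Fin n) F} (hf : f ∈ groupIdeal Γ) :
    twoSided (g : Matrix (Fin n) (Fin n) F) (h : Matrix (Fin n) (Fin n) F) f ∈ groupIdeal Γ := by
  intro x hx
  rw [evalAt_twoSided]
  exact hf (g * x * h) (mul_mem (mul_mem hg hx) hh)

/-- The value at `g` is the derivative at the identity of the left translate of `f` by `g`, and the
ideal is stable under translations. -/
theorem leftInvDer_mem_groupIdeal {X : Matrix (Fin n) (Fin n) F} (hX : X ∈ tangentSpace Γ)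
    {f : MvPolynomial (Fin n × Fin n) F} (hf : f ∈ groupIdeal Γ) :
    leftInvDer X f ∈ groupIdeal Γ := by
  intro g hg
  rw [evalAt_leftInvDer_eq_dirDeriv_twoSided]
  exact hX _ (twoSided_mem_groupIdeal hg (one_mem Γ) hf)

theorem evalAt_one_leftInvDer (X : Matrix (Fin n) (Fin n) F)
    (f : MvPolynomial (Fin n × Fin n) F) :
    evalAt (1 : Matrix (Fin n) (Fin n) F) (leftInvDer X f) = dirDeriv f 1 X := by
  rw [evalAt_leftInvDer, one_mul]

theorem evalAt_one_of_mem {f : MvPolynomial (Fin n × Fin n) F} (hf : f ∈ groupIdeal Γ) :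
    evalAt (1 : Matrix (Fin n) (Fin n) F) f = 0 := by
  simpa using hf 1 (one_mem Γ)

theorem lie_mem_tangentSpace {X Y : Matrix (Fin n) (Fin n) F} (hX : X ∈ tangentSpace Γ)
    (hY : Y ∈ tangentSpace Γ) : X * Y - Y * X ∈ tangentSpace Γ := by
  intro f hf
  rw [← evalAt_one_leftInvDer, leftInvDer_lie, Derivation.commutator_apply, map_sub]
  rw [evalAt_one_of_mem (leftInvDer_mem_groupIdeal hX (leftInvDer_mem_groupIdeal hY hf)),
    evalAt_one_of_mem (leftInvDer_mem_groupIdeal hY (leftInvDer_mem_groupIdeal hX hf)), sub_zero]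

theorem conj_mem_tangentSpace {g : GL (Fin n) F} (hg : g ∈ Γ) {X : Matrix (Fin n) (Fin n) F}
    (hX : X ∈ tangentSpace Γ) :
    (g : Matrix (Fin n) (Fin n) F) * X * ((g⁻¹ : GL (Fin n) F) : Matrix (Fin n) (Fin n) F) ∈
      tangentSpace Γ := by
  intro f hf
  have h := hX _ (twoSided_mem_groupIdeal hg (inv_mem hg) hf)
  rwa [dirDeriv_twoSided, mul_one, ← Units.val_mul, mul_inv_cancel, Units.val_one] at h

/-- A matrix of polynomials that is multiplicative on `Γ`. -/
structure IsPolyRep (Γ : Subgroup (GL (Fin n) F)) {m : Type*} [Fintype m] [DecidableEq m]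
    (P : Matrix m m (MvPolynomial (Fin n × Fin n) F)) : Prop where
  map_one : P.map (evalAt (1 : Matrix (Fin n) (Fin n) F)) = 1
  map_mul : ∀ g ∈ Γ, ∀ h ∈ Γ,
    P.map (evalAt ((g : Matrix (Fin n) (Fin n) F) * (h : Matrix (Fin n) (Fin n) F))) =
      P.map (evalAt (g : Matrix (Fin n) (Fin n) F)) * P.map (evalAt (h : Matrix (Fin n) (Fin n) F))

/-- The differential at the identity of a matrix of polynomials. -/
def diffOne {m : Type*} (P : Matrix m m (MvPolynomial (Fin n × Fin n) F)) :
    Matrix (Fin n) (Fin n) F →ₗ[F] Matrix m m F where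
  toFun X := P.map fun f => dirDeriv f 1 X
  map_add' X Y := by
    ext i j
    simp [← differential_apply]
  map_smul' c X := by
    ext i j
    simp [← differential_apply]

theorem diffOne_apply {m : Type*} (P : Matrix m m (MvPolynomial (Fin n × Fin n) F))
    (X : Matrix (Fin n) (Fin n) F) (i j : m) : diffOne P X i j = dirDeriv (P i j) 1 X := rfl

namespace IsPolyRep

variable {m : Type*} [Fintype m] [DecidableEq m]
  {P : Matrix m m (MvPolynomial (Fin n × Fin n) F)} (hP : IsPolyRep Γ P)
include hP

/-- Differentiate `P(gh) = P(g)P(h)` in `h` at the identity. The identity holds only on `Γ`, but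
tangent vectors do not see the ideal. -/
theorem evalAt_leftInvDer {X : Matrix (Fin n) (Fin n) F} (hX : X ∈ tangentSpace Γ)
    {g : GL (Fin n) F} (hg : g ∈ Γ) :
    P.map (fun f => evalAt (g : Matrix (Fin n) (Fin n) F) (leftInvDer X f)) =
      P.map (evalAt (g : Matrix (Fin n) (Fin n) F)) * diffOne P X := by
  ext i j
  rw [Matrix.map_apply, evalAt_leftInvDer_eq_dirDeriv_twoSided]
  have hmem : twoSided (g : Matrix (Fin n) (Fin n) F) 1 (P i j) -
      ∑ k, evalAt (g : Matrix (Fin n) (Fin n) F) (P i k) • P k j ∈ groupIdeal Γ := by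
    intro h hh
    have := congrFun (congrFun (hP.map_mul g hg h hh) i) j
    rw [map_sub, evalAt_twoSided, mul_one, map_sum]
    simp only [map_smul, smul_eq_mul]
    rw [sub_eq_zero]
    simpa [Matrix.mul_apply] using this
  have h0 := hX _ hmem
  rw [← dirDerivₗ_apply, map_sub, map_sum, sub_eq_zero, dirDerivₗ_apply] at h0
  rw [h0]
  simp [Matrix.mul_apply, diffOne_apply]

theorem leftInvDer_sub_mem {X : Matrix (Fin n) (Fin n) F} (hX : X ∈ tangentSpace Γ) (i j : m) :
    leftInvDer X (P i j) - (P * (diffOne P X).map (C (σ := Fin n × Fin n))) i j ∈ groupIdeal Γ := by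
  intro g hg
  have := congrFun (congrFun (hP.evalAt_leftInvDer hX hg) i) j
  rw [map_sub, sub_eq_zero]
  simpa [Matrix.mul_apply, evalAt] using this

/-- Modulo the ideal, `P` solves the system `X · P = P dP(X)`. Applying two left invariant
derivations and evaluating at the identity gives the product of the two differentials. -/
theorem diffOne_lie {X Y : Matrix (Fin n) (Fin n) F} (hX : X ∈ tangentSpace Γ)
    (hY : Y ∈ tangentSpace Γ) :
    diffOne P (X * Y - Y * X) = diffOne P X * diffOne P Y - diffOne P Y * diffOne P X := by
  have key : ∀ {X Y : Matrix (Fin n) (Fin n) F}, X ∈ tangentSpace Γ → Y ∈ tangentSpace Γ →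
      ∀ i j, evalAt (1 : Matrix (Fin n) (Fin n) F) (leftInvDer X (leftInvDer Y (P i j))) =
        (diffOne P X * diffOne P Y) i j := by
    intro X Y hX hY i j
    have h1 := evalAt_one_of_mem (leftInvDer_mem_groupIdeal hX (hP.leftInvDer_sub_mem hY i j))
    rw [map_sub, map_sub, sub_eq_zero] at h1
    rw [h1, Matrix.mul_apply, map_sum, map_sum, Matrix.mul_apply]
    refine Finset.sum_congr rfl fun k _ => ?_
    rw [Derivation.leibniz, Matrix.map_apply, derivation_C, smul_zero, zero_add, smul_eq_mul,
      _root_.map_mul, evalAt_one_leftInvDer, evalAt_C, mul_comm]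
    rfl
  ext i j
  rw [Matrix.sub_apply, ← key hX hY, ← key hY hX, diffOne_apply, ← evalAt_one_leftInvDer,
    leftInvDer_lie, Derivation.commutator_apply, map_sub]

theorem diffOne_conj {X : Matrix (Fin n) (Fin n) F} (hX : X ∈ tangentSpace Γ)
    {g : GL (Fin n) F} (hg : g ∈ Γ) :
    diffOne P ((g : Matrix (Fin n) (Fin n) F) * X *
        ((g⁻¹ : GL (Fin n) F) : Matrix (Fin n) (Fin n) F)) =
      P.map (evalAt (g : Matrix (Fin n) (Fin n) F)) * diffOne P X *
        P.map (evalAt ((g⁻¹ : GL (Fin n) F) : Matrix (Fin n) (Fin n) F)) := by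
  ext i j
  have hmem : twoSided (g : Matrix (Fin n) (Fin n) F)
      ((g⁻¹ : GL (Fin n) F) : Matrix (Fin n) (Fin n) F) (P i j) -
      ∑ l, ∑ k, (evalAt (g : Matrix (Fin n) (Fin n) F) (P i k) *
        evalAt ((g⁻¹ : GL (Fin n) F) : Matrix (Fin n) (Fin n) F) (P l j)) • P k l ∈
          groupIdeal Γ := by
    intro h hh
    have h1 := hP.map_mul (g * h) (mul_mem hg hh) g⁻¹ (inv_mem hg)
    rw [Units.val_mul, hP.map_mul g hg h hh] at h1
    have h2 := congrFun (congrFun h1 i) j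
    rw [map_sub, evalAt_twoSided, map_sum, sub_eq_zero]
    simp only [map_sum, map_smul, smul_eq_mul]
    simp only [Matrix.mul_apply, Matrix.map_apply, Finset.sum_mul] at h2
    rw [h2]
    refine Finset.sum_congr rfl fun l _ => Finset.sum_congr rfl fun k _ => ?_
    ring
  have h0 := hX _ hmem
  rw [← dirDerivₗ_apply, map_sub, map_sum, sub_eq_zero, dirDerivₗ_apply, dirDeriv_twoSided,
    mul_one, ← Units.val_mul, mul_inv_cancel, Units.val_one] at h0
  rw [diffOne_apply, h0]
  simp only [map_sum, map_smul, smul_eq_mul, dirDerivₗ_apply, Matrix.mul_apply, Matrix.map_apply,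
    Finset.sum_mul, diffOne_apply]
  refine Finset.sum_congr rfl fun l _ => Finset.sum_congr rfl fun k _ => ?_
  ring

end IsPolyRep

end VanishingIdeal

/-! ## Connected groups are irreducible -/

section Irreducible

/-- Some nonempty open `U` lies in a single irreducible component `Z`. A homeomorphism moves `U` to
a neighbourhood of any given point of `Z`; this irreducible open set meets `Z` in a dense subset, so
by maximality of `Z` it lies in `Z`. Thus `Z` is clopen. -/
theorem irreducibleSpace_of_homogeneous {X : Type*} [TopologicalSpace X]
    [TopologicalSpace.NoetherianSpace X] [ConnectedSpace X]
    (hom : ∀ x y : X, ∃ h : X ≃ₜ X, h x = y) : IrreducibleSpace X := by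
  obtain ⟨x₀⟩ := (inferInstance : Nonempty X)
  set Z := irreducibleComponent x₀
  have hZ : Z ∈ irreducibleComponents X := irreducibleComponent_mem_irreducibleComponents x₀
  obtain ⟨U, hUo, hUne, hUZ⟩ :=
    TopologicalSpace.NoetherianSpace.exists_isOpen_nonempty_subset_irreducibleComponent Z hZ
  obtain ⟨u, hu⟩ := hUne
  have hUirr : IsPreirreducible U :=
    (isIrreducible_irreducibleComponent (x := x₀)).isPreirreducible.open_subset hUo hUZ
  have hopen : IsOpen Z := by
    rw [isOpen_iff_forall_mem_open]
    intro x hx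
    obtain ⟨h, hxu⟩ := hom u x
    have hirr : IsPreirreducible (h '' U) := hUirr.image h h.continuous.continuousOn
    have hmem : x ∈ h '' U := ⟨u, hu, hxu⟩
    have hopenU : IsOpen (h '' U) := h.isOpenMap U hUo
    refine ⟨h '' U, ?_, hopenU, hmem⟩
    have h1 : Z ⊆ closure (Z ∩ h '' U) :=
      subset_closure_inter_of_isPreirreducible_of_isOpen
        isIrreducible_irreducibleComponent.isPreirreducible hopenU ⟨x, hx, hmem⟩
    have h2 : Z ⊆ closure (h '' U) := h1.trans (closure_mono Set.inter_subset_right)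
    have h3 : IsIrreducible (closure (h '' U)) := IsIrreducible.closure ⟨⟨x, hmem⟩, hirr⟩
    exact subset_closure.trans (hZ.2 h3 h2)
  have huniv : Z = Set.univ :=
    IsClopen.eq_univ ⟨isClosed_irreducibleComponent, hopen⟩ ⟨x₀, mem_irreducibleComponent⟩
  have hpre : PreirreducibleSpace X := ⟨huniv ▸ isIrreducible_irreducibleComponent.isPreirreducible⟩
  exact ⟨⟨x₀⟩⟩

variable {F : Type*} [Field F] {n : ℕ}

theorem isClosed_zariski_setOf (f : MvPolynomial (Fin n × Fin n) F) :
    @IsClosed _ (zariskiTopology n F)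
      {g | evalAt (g : Matrix (Fin n) (Fin n) F) f = 0} := by
  rw [isClosed_zariskiTopology_iff]
  refine ⟨{f}, ?_⟩
  ext g
  simp only [← eval_eq_evalAt, Set.mem_singleton_iff, forall_eq]
  rfl

theorem continuous_zariski_mul_mul (g h : GL (Fin n) F) :
    @Continuous _ _ (zariskiTopology n F) (zariskiTopology n F) fun x => g * x * h := by
  let _ := zariskiTopology n F
  rw [continuous_iff_isClosed]
  intro Z hZ
  rw [isClosed_zariskiTopology_iff] at hZ ⊢
  obtain ⟨S, rfl⟩ := hZ
  refine ⟨LinearAlgebraicGroup.twoSided (g : Matrix (Fin n) (Fin n) F)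
    (h : Matrix (Fin n) (Fin n) F) '' S, ?_⟩
  ext x
  simp only [Set.mem_preimage, Set.mem_ofPred_eq, Set.forall_mem_image]
  refine forall₂_congr fun f _ => ?_
  have h1 := evalAt_twoSided (g : Matrix (Fin n) (Fin n) F) (h : Matrix (Fin n) (Fin n) F)
    (x : Matrix (Fin n) (Fin n) F) f
  rw [← eval_eq_evalAt, ← eval_eq_evalAt] at h1
  exact (Eq.congr_left h1).symm

theorem isIrreducible_of_isConnected (Γ : Subgroup (GL (Fin n) F))
    (hΓ : @IsConnected _ (zariskiTopology n F) (Γ : Set (GL (Fin n) F))) :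
    @IsIrreducible _ (zariskiTopology n F) (Γ : Set (GL (Fin n) F)) := by
  let _ := zariskiTopology n F
  have hN : TopologicalSpace.NoetherianSpace (GL (Fin n) F) :=
    Topology.IsInducing.noetherianSpace (α := PrimeSpectrum (MvPolynomial (Fin n × Fin n) F))
      ⟨rfl⟩
  have hN' : TopologicalSpace.NoetherianSpace Γ :=
    TopologicalSpace.NoetherianSpace.set (Γ : Set (GL (Fin n) F))
  have hc : ConnectedSpace Γ := isConnected_iff_connectedSpace.1 hΓ
  have hcont : ∀ g : Γ, Continuous fun x : Γ => g * x := by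
    intro g
    rw [Topology.IsInducing.subtypeVal.continuous_iff]
    have := continuous_zariski_mul_mul (g : GL (Fin n) F) 1
    simp only [mul_one] at this
    exact this.comp continuous_subtype_val
  have hhom : ∀ x y : Γ, ∃ h : Γ ≃ₜ Γ, h x = y := by
    intro x y
    refine ⟨⟨Equiv.mulLeft (y * x⁻¹), hcont _, ?_⟩, ?_⟩
    · exact hcont (y * x⁻¹)⁻¹
    · change y * x⁻¹ * x = y
      simp
  have hirr : IrreducibleSpace Γ := irreducibleSpace_of_homogeneous hhom
  have h1 : IsIrreducible (Set.univ : Set Γ) := IrreducibleSpace.isIrreducible_univ Γ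
  have h2 := h1.image Subtype.val continuous_subtype_val.continuousOn
  rwa [Set.image_univ, Subtype.range_coe] at h2

theorem groupIdeal_isPrime (Γ : Subgroup (GL (Fin n) F))
    (hΓ : @IsConnected _ (zariskiTopology n F) (Γ : Set (GL (Fin n) F))) :
    (groupIdeal Γ).IsPrime := by
  let _ := zariskiTopology n F
  have hirr := (isIrreducible_of_isConnected Γ hΓ).isPreirreducible
  rw [isPreirreducible_iff_isClosed_union_isClosed] at hirr
  refine ⟨?_, ?_⟩
  · rw [Ideal.ne_top_iff_one]
    intro h
    simpa using h 1 (one_mem Γ)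
  · intro p q hpq
    have := hirr _ _ (isClosed_zariski_setOf p) (isClosed_zariski_setOf q) (by
      intro g hg
      have h := hpq g hg
      rwa [map_mul, mul_eq_zero] at h)
    exact this.imp (fun h g hg => h hg) fun h g hg => h hg

end Irreducible

/-! ## Derivations of function fields -/

section Derivations

/-- In characteristic zero a finitely generated field extension is formally smooth, so the identity
of `L` lifts through the nilpotent thickening `π`. -/
theorem exists_ringHom_lift {E L B : Type*} [Field E] [Field L] [CommRing B] [Algebra E L]
    [CharZero E] [Algebra.EssFiniteType E L] (φ : E →+* B) (π : B →+* L)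
    (hπ : Function.Surjective π) (hker : IsNilpotent (RingHom.ker π))
    (hcomp : π.comp φ = algebraMap E L) :
    ∃ ψ : L →+* B, π.comp ψ = RingHom.id L ∧ ψ.comp (algebraMap E L) = φ := by
  let _ : Algebra E B := φ.toAlgebra
  let πa : B →ₐ[E] L := { π with commutes' := fun e => RingHom.congr_fun hcomp e }
  let ψ : L →ₐ[E] B := Algebra.FormallySmooth.liftOfSurjective (AlgHom.id E L) πa hπ hker
  refine ⟨ψ, ?_, ?_⟩
  · ext x
    exact Algebra.FormallySmooth.liftOfSurjective_apply (AlgHom.id E L) πa hπ hker x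
  · ext x
    exact ψ.commutes x

/-- On `F(q)` the substitution `q ↦ q + ε` is a ring homomorphism into the dual numbers over `L`. It
extends to `L` by formal smoothness, and its `ε`-component is a derivation with value `1` at `q`. -/
theorem exists_derivation_ne_zero {F L : Type*} [Field F] [Field L] [Algebra F L] [CharZero F]
    [Algebra.EssFiniteType F L] {q : L} (hq : Transcendental F q) :
    ∃ δ : Derivation F L L, δ q ≠ 0 := by
  have hinj : Function.Injective (Polynomial.aeval (R := F) q) :=
    transcendental_iff_injective.1 hq
  let E := FractionRing (Polynomial F)
  let φ₀ : E →+* L := IsFractionRing.lift (A := Polynomial F) (K := E)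
    (g := (Polynomial.aeval (R := F) q : Polynomial F →+* L)) hinj
  let _ : Algebra E L := φ₀.toAlgebra
  have hφ₀ : ∀ p : Polynomial F, algebraMap E L (algebraMap (Polynomial F) E p) =
      Polynomial.aeval q p := fun p => IsFractionRing.lift_algebraMap _ p
  have hT : ∀ c : F, algebraMap E L (algebraMap F E c) = algebraMap F L c := by
    intro c
    rw [IsScalarTower.algebraMap_apply F (Polynomial F) E, hφ₀]
    simp
  have : IsScalarTower F E L := IsScalarTower.of_algebraMap_eq fun c => (hT c).symm
  have : Algebra.EssFiniteType E L := Algebra.EssFiniteType.of_comp F E L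
  have : CharZero E := charZero_of_injective_algebraMap (algebraMap F E).injective
  let η : Polynomial F →+* TrivSqZeroExt L L :=
    (Polynomial.aeval (R := F) (TrivSqZeroExt.inl q + TrivSqZeroExt.inr 1 : TrivSqZeroExt L L) :
      Polynomial F →ₐ[F] TrivSqZeroExt L L)
  have hfst : ∀ p, (η p).fst = Polynomial.aeval q p := by
    intro p
    have : (TrivSqZeroExt.fstHom F L L).comp
        (Polynomial.aeval (R := F) (TrivSqZeroExt.inl q + TrivSqZeroExt.inr 1)) =
        Polynomial.aeval q := by
      apply Polynomial.algHom_ext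
      simp
    exact DFunLike.congr_fun this p
  have hunit : ∀ y : nonZeroDivisors (Polynomial F), IsUnit (η y) := by
    intro y
    rw [TrivSqZeroExt.isUnit_iff_isUnit_fst, hfst, isUnit_iff_ne_zero]
    intro h
    exact nonZeroDivisors.ne_zero y.2 (hinj (by rw [h, map_zero]))
  let φ : E →+* TrivSqZeroExt L L := IsLocalization.lift (M := nonZeroDivisors (Polynomial F)) hunit
  have hφ : ∀ p : Polynomial F, φ (algebraMap (Polynomial F) E p) = η p :=
    fun p => IsLocalization.lift_eq hunit p
  let π : TrivSqZeroExt L L →+* L := (TrivSqZeroExt.fstHom F L L : TrivSqZeroExt L L →ₐ[F] L)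
  have hcomp : π.comp φ = algebraMap E L := by
    apply IsLocalization.ringHom_ext (nonZeroDivisors (Polynomial F))
    refine RingHom.ext fun p => ?_
    rw [RingHom.comp_apply, RingHom.comp_apply, RingHom.comp_apply, hφ, hφ₀, ← hfst]
    rfl
  obtain ⟨ψ, hψ1, hψ2⟩ := exists_ringHom_lift φ π
    (fun x => ⟨TrivSqZeroExt.inl x, rfl⟩) ⟨2, by
      rw [Ideal.zero_eq_bot, pow_two, eq_bot_iff, Ideal.mul_le]
      intro a ha b hb
      rw [RingHom.mem_ker] at ha hb
      change a.fst = 0 at ha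
      change b.fst = 0 at hb
      rw [Ideal.mem_bot]
      ext <;> simp [ha, hb]⟩ hcomp
  have h1 : ∀ x, (ψ x).fst = x := fun x => RingHom.congr_fun hψ1 x
  have hF : ∀ c : F, ψ (algebraMap F L c) = TrivSqZeroExt.inl (algebraMap F L c) := by
    intro c
    have := RingHom.congr_fun hψ2 (algebraMap F E c)
    rw [RingHom.comp_apply, hT] at this
    rw [this, IsScalarTower.algebraMap_apply F (Polynomial F) E, hφ]
    simp [η]
    rfl
  have hsm : ∀ (c : F) (x : L), (ψ (c • x)).snd = c • (ψ x).snd := by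
    intro c x
    rw [Algebra.smul_def, map_mul, hF, TrivSqZeroExt.snd_mul]
    simp [Algebra.smul_def]
  refine ⟨Derivation.mk' ⟨⟨fun x => (ψ x).snd, by simp⟩, hsm⟩ ?_, ?_⟩
  · intro a b
    change (ψ (a * b)).snd = a • (ψ b).snd + b • (ψ a).snd
    rw [map_mul, TrivSqZeroExt.snd_mul, h1, h1]
    simp [mul_comm]
  · change (ψ q).snd ≠ 0
    have h2 := RingHom.congr_fun hψ2 (algebraMap (Polynomial F) E Polynomial.X)
    rw [RingHom.comp_apply, hφ₀, hφ, Polynomial.aeval_X] at h2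
    rw [h2]
    simp [η]

/-- A transcendental element is moved by some derivation, and an algebraic one lies in the
algebraically closed field `F`. -/
theorem mem_range_algebraMap_of_derivation {F L : Type*} [Field F] [Field L] [Algebra F L]
    [CharZero F] [IsAlgClosed F] [Algebra.EssFiniteType F L] {q : L}
    (hq : ∀ δ : Derivation F L L, δ q = 0) : ∃ c : F, algebraMap F L c = q := by
  by_cases h : IsAlgebraic F q
  · exact minpoly.mem_range_of_degree_eq_one F q
      (IsAlgClosed.degree_eq_one_of_irreducible F (minpoly.irreducible h.isIntegral))
  · obtain ⟨δ, hδ⟩ := exists_derivation_ne_zero h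
    exact absurd (hq δ) hδ

end Derivations

/-! ## Functions killed by the Lie algebra -/

section FunctionField

open LinearAlgebraicGroup

variable {F : Type*} [Field F] {n : ℕ}

theorem derivation_apply_eq_sum {M : Type*} [AddCommGroup M]
    [Module (MvPolynomial (Fin n × Fin n) F) M] [Module F M]
    (D : Derivation F (MvPolynomial (Fin n × Fin n) F) M) (f : MvPolynomial (Fin n × Fin n) F) :
    D f = ∑ k, pderiv k f • D (X k) := by
  induction f using MvPolynomial.induction_on with
  | C c =>
    have : D (C c) = 0 := derivation_C D c
    simp [this]
  | add p q hp hq => simp only [map_add, hp, hq, add_smul, Finset.sum_add_distrib]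
  | mul_X p i hp =>
    have h1 : ∑ k, (p • pderiv k (X i : MvPolynomial (Fin n × Fin n) F)) • D (X k) =
        p • D (X i) := by
      rw [Finset.sum_eq_single i]
      · simp
      · intro b _ hb
        simp [pderiv_X_of_ne hb.symm]
      · simp
    simp only [Derivation.leibniz, add_smul, Finset.sum_add_distrib]
    rw [h1, hp, Finset.smul_sum]
    simp only [smul_smul, smul_eq_mul]

variable (Γ : Subgroup (GL (Fin n) F)) [(groupIdeal Γ).IsPrime]

/-- The field of rational functions on an irreducible group. -/
abbrev RationalFunctions : Type _ := FractionRing (MvPolynomial (Fin n × Fin n) F ⧸ groupIdeal Γ)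

variable {Γ}

theorem algebraMap_rationalFunctions_eq_zero {f : MvPolynomial (Fin n × Fin n) F} :
    algebraMap _ (RationalFunctions Γ) f = 0 ↔ f ∈ groupIdeal Γ := by
  rw [IsScalarTower.algebraMap_apply _ (MvPolynomial (Fin n × Fin n) F ⧸ groupIdeal Γ)
    (RationalFunctions Γ), FaithfulSMul.algebraMap_eq_zero_iff, Ideal.Quotient.algebraMap_eq,
    Ideal.Quotient.eq_zero_iff_mem]

omit [(groupIdeal Γ).IsPrime] in
theorem derivation_rationalFunctions_eq_sum
    (δ : Derivation F (RationalFunctions Γ) (RationalFunctions Γ))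
    (f : MvPolynomial (Fin n × Fin n) F) :
    δ (algebraMap (MvPolynomial (Fin n × Fin n) F) (RationalFunctions Γ) f) =
      ∑ k, algebraMap (MvPolynomial (Fin n × Fin n) F) (RationalFunctions Γ) (pderiv k f) *
        δ (algebraMap (MvPolynomial (Fin n × Fin n) F) (RationalFunctions Γ) (X k)) := by
  have := derivation_apply_eq_sum (δ.compAlgebraMap (MvPolynomial (Fin n × Fin n) F)) f
  simp only [Algebra.smul_def] at this
  exact this

theorem exists_denominator {ι : Type*} [Finite ι] (x : ι → RationalFunctions Γ) :
    ∃ s : MvPolynomial (Fin n × Fin n) F, s ∉ groupIdeal Γ ∧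
      ∃ N : ι → MvPolynomial (Fin n × Fin n) F,
        ∀ i, algebraMap _ (RationalFunctions Γ) (N i) = algebraMap _ _ s * x i := by
  obtain ⟨b, hb⟩ := IsLocalization.exist_integer_multiples_of_finite
    (nonZeroDivisors (MvPolynomial (Fin n × Fin n) F ⧸ groupIdeal Γ)) x
  choose N hN using hb
  obtain ⟨s, hs⟩ := Ideal.Quotient.mk_surjective (b : MvPolynomial (Fin n × Fin n) F ⧸ groupIdeal Γ)
  choose N' hN' using fun i => Ideal.Quotient.mk_surjective (N i)
  refine ⟨s, ?_, N', ?_⟩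
  · rw [← Ideal.Quotient.eq_zero_iff_mem, hs]
    exact nonZeroDivisors.ne_zero b.2
  · intro i
    rw [IsScalarTower.algebraMap_apply _ (MvPolynomial (Fin n × Fin n) F ⧸ groupIdeal Γ)
      (RationalFunctions Γ), IsScalarTower.algebraMap_apply _
      (MvPolynomial (Fin n × Fin n) F ⧸ groupIdeal Γ) (RationalFunctions Γ) s,
      Ideal.Quotient.algebraMap_eq, hN', hs, hN, Algebra.smul_def]

theorem mvPolynomialX_det_notMem (Γ : Subgroup (GL (Fin n) F)) :
    (Matrix.mvPolynomialX (Fin n) (Fin n) F).det ∉ groupIdeal Γ := by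
  intro h
  have h1 := evalAt_one_of_mem h
  rw [AlgHom.map_det] at h1
  have : (evalAt (1 : Matrix (Fin n) (Fin n) F)).mapMatrix (Matrix.mvPolynomialX (Fin n) (Fin n) F)
      = 1 := evalAt_mvPolynomialX _
  rw [this, Matrix.det_one] at h1
  exact one_ne_zero h1

/-- Every derivation of the function field is a combination of left invariant derivations. -/
theorem exists_leftInvDer_combination (δ : Derivation F (RationalFunctions Γ) (RationalFunctions Γ)) :
    ∃ (c : Fin n × Fin n → RationalFunctions Γ) (B : Fin n × Fin n → Matrix (Fin n) (Fin n) F),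
      (∀ k, B k ∈ tangentSpace Γ) ∧ ∀ f : MvPolynomial (Fin n × Fin n) F,
        δ (algebraMap _ _ f) = ∑ k, c k * algebraMap _ _ (leftInvDer (B k) f) := by
  set ι : MvPolynomial (Fin n × Fin n) F →+* RationalFunctions Γ := algebraMap _ _ with hι
  set η : Matrix (Fin n) (Fin n) (RationalFunctions Γ) :=
    (Matrix.mvPolynomialX (Fin n) (Fin n) F).map ι with hη
  have hdet : IsUnit η.det := by
    rw [isUnit_iff_ne_zero]
    have : η.det = ι (Matrix.mvPolynomialX (Fin n) (Fin n) F).det := by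
      rw [RingHom.map_det]
      rfl
    rw [this, Ne, algebraMap_rationalFunctions_eq_zero]
    exact mvPolynomialX_det_notMem Γ
  set Y : Matrix (Fin n) (Fin n) (RationalFunctions Γ) :=
    Matrix.of fun i j => δ (ι (X (i, j))) with hY
  -- The logarithmic derivative of the generic point: `δ` is the left invariant field with variable
  -- direction `Z`. It remains to see that `Z` takes values in the tangent space.
  set Z := η⁻¹ * Y with hZ
  have hηZ : η * Z = Y := Matrix.mul_nonsing_inv_cancel_left _ _ hdet
  obtain ⟨s, hs, N, hN⟩ := exists_denominator (Γ := Γ) fun k : Fin n × Fin n => Z k.1 k.2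
  have hs0 : ι s ≠ 0 := by rwa [Ne, algebraMap_rationalFunctions_eq_zero]
  set N' : Matrix (Fin n) (Fin n) (MvPolynomial (Fin n × Fin n) F) :=
    Matrix.of fun i j => N (i, j) with hN'
  have hN'ι : N'.map ι = ι s • Z := by
    ext i j
    exact hN (i, j)
  -- Apply `δ` to the translate `x ↦ f(g⁻¹x)`, which is zero in the function field, and evaluate at
  -- `g`. Since `Z` has been multiplied by `s`, points with `s(g) = 0` cause no trouble.
  have hmem : ∀ g ∈ Γ, N'.map (evalAt (g : Matrix (Fin n) (Fin n) F)) ∈ tangentSpace Γ := by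
    intro g hg f hf
    set fg := twoSided ((g⁻¹ : GL (Fin n) F) : Matrix (Fin n) (Fin n) F) 1 f with hfg
    have hfgI : fg ∈ groupIdeal Γ := twoSided_mem_groupIdeal (inv_mem hg) (one_mem Γ) hf
    have h1 : δ (ι fg) = 0 := by rw [algebraMap_rationalFunctions_eq_zero.2 hfgI, map_zero]
    rw [derivation_rationalFunctions_eq_sum] at h1
    set R : Matrix (Fin n) (Fin n) (MvPolynomial (Fin n × Fin n) F) :=
      Matrix.mvPolynomialX (Fin n) (Fin n) F * N' with hR
    have hRι : R.map ι = ι s • Y := by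
      rw [hR, Matrix.map_mul, hN'ι, Matrix.mul_smul, hηZ]
    have h2 : (∑ k, pderiv k fg * R k.1 k.2) ∈ groupIdeal Γ := by
      rw [← algebraMap_rationalFunctions_eq_zero, map_sum]
      rw [← mul_zero (ι s), ← h1, Finset.mul_sum]
      refine Finset.sum_congr rfl fun k _ => ?_
      have := congrFun (congrFun hRι k.1) k.2
      simp only [Matrix.map_apply, Matrix.smul_apply, hY, Matrix.of_apply, smul_eq_mul] at this
      rw [map_mul]
      change ι _ * ι _ = _
      rw [this]
      ring
    have h3 := h2 g hg
    have hRg : R.map (evalAt (g : Matrix (Fin n) (Fin n) F)) =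
        g * N'.map (evalAt (g : Matrix (Fin n) (Fin n) F)) := by
      rw [hR, Matrix.map_mul, evalAt_mvPolynomialX]
    have h4 : dirDeriv fg g (g * N'.map (evalAt (g : Matrix (Fin n) (Fin n) F))) = 0 := by
      rw [← h3, map_sum, dirDeriv]
      refine Finset.sum_congr rfl fun k _ => ?_
      rw [map_mul, eval_eq_evalAt, ← hRg]
      rfl
    rw [hfg, dirDeriv_twoSided, mul_one, mul_one, ← mul_assoc, ← Units.val_mul, inv_mul_cancel,
      Units.val_one, one_mul] at h4
    exact h4
  -- With the projections `B k` of the matrix units to the tangent space, `A = ∑ A_k B_k` for every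
  -- tangent vector `A`. This linear identity passes from the values of `N'` to `Z`.
  obtain ⟨π, hπ⟩ := LinearMap.exists_leftInverse_of_injective (tangentSpace Γ).subtype
    (Submodule.ker_subtype _)
  have hπ' : ∀ A ∈ tangentSpace Γ, ((π A : tangentSpace Γ) : Matrix (Fin n) (Fin n) F) = A := by
    intro A hA
    have := LinearMap.congr_fun hπ ⟨A, hA⟩
    exact congrArg Subtype.val this
  set B : Fin n × Fin n → Matrix (Fin n) (Fin n) F :=
    fun k => π (Matrix.single k.1 k.2 1) with hB
  have hπsum : ∀ A : Matrix (Fin n) (Fin n) F,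
      ((π A : tangentSpace Γ) : Matrix (Fin n) (Fin n) F) = ∑ k : Fin n × Fin n, A k.1 k.2 • B k := by
    intro A
    conv_lhs => rw [Matrix.matrix_eq_sum_single A]
    rw [map_sum, Fintype.sum_prod_type, AddSubmonoidClass.coe_finsetSum]
    refine Finset.sum_congr rfl fun i _ => ?_
    rw [map_sum, AddSubmonoidClass.coe_finsetSum]
    refine Finset.sum_congr rfl fun j _ => ?_
    rw [hB]
    change _ = A i j • ((π (Matrix.single i j 1) : tangentSpace Γ) : Matrix (Fin n) (Fin n) F)
    rw [← Submodule.coe_smul, ← map_smul, Matrix.smul_single, smul_eq_mul, mul_one]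
  have hZB : ∀ i j, Z i j = ∑ k : Fin n × Fin n, Z k.1 k.2 * ι (C (B k i j)) := by
    intro i j
    have h1 : N' i j - ∑ k : Fin n × Fin n, N' k.1 k.2 * C (B k i j) ∈ groupIdeal Γ := by
      intro g hg
      have h2 := hπ' _ (hmem g hg)
      rw [hπsum] at h2
      have h3 := congrFun (congrFun h2 i) j
      rw [Matrix.sum_apply] at h3
      rw [map_sub, map_sum, sub_eq_zero, ← Matrix.map_apply (f := evalAt _), ← h3]
      refine Finset.sum_congr rfl fun k _ => ?_
      rw [map_mul, evalAt_C]
      rfl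
    rw [← algebraMap_rationalFunctions_eq_zero, map_sub, sub_eq_zero, map_sum] at h1
    have h4 : ∀ i j, algebraMap _ (RationalFunctions Γ) (N' i j) = ι s * Z i j := fun i j =>
      hN (i, j)
    rw [h4] at h1
    apply mul_left_cancel₀ hs0
    rw [h1, Finset.mul_sum]
    refine Finset.sum_congr rfl fun k _ => ?_
    rw [map_mul, h4, mul_assoc]
  refine ⟨fun k => Z k.1 k.2, B, fun k => (π _).2, fun f => ?_⟩
  have hYk : ∀ k : Fin n × Fin n, δ (ι (X k)) =
      ∑ l : Fin n × Fin n, Z l.1 l.2 * ι (leftInvDer (B l) (X k)) := by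
    intro k
    have h1 : δ (ι (X k)) = (η * Z) k.1 k.2 := by rw [hηZ]; rfl
    rw [h1, Matrix.mul_apply]
    simp only [leftInvDer_X, Matrix.mul_apply, map_sum, Finset.mul_sum]
    rw [Finset.sum_comm]
    refine Finset.sum_congr rfl fun i _ => ?_
    rw [hZB, Finset.mul_sum]
    refine Finset.sum_congr rfl fun l _ => ?_
    rw [map_mul, hη]
    simp only [Matrix.map_apply]
    ring
  rw [derivation_rationalFunctions_eq_sum]
  change ∑ k, ι _ * δ (ι _) = ∑ k, _ * ι _
  simp only [hYk, derivation_apply_eq_sum (leftInvDer _) f, map_sum, Finset.mul_sum, smul_eq_mul,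
    map_mul]
  rw [Finset.sum_comm]
  refine Finset.sum_congr rfl fun l _ => Finset.sum_congr rfl fun k _ => ?_
  ring

variable [CharZero F] [IsAlgClosed F]

/-- A row of polynomials solving the same linear differential system as an invertible matrix of
polynomials vanishes on the group if it vanishes at the identity. -/
theorem mem_groupIdeal_of_linear_system {r : Type*} [Fintype r] [DecidableEq r]
    (α : Matrix r r (MvPolynomial (Fin n × Fin n) F)) (γ : r → MvPolynomial (Fin n × Fin n) F)
    (x : Matrix (Fin n) (Fin n) F → Matrix r r F)
    (hα1 : α.map (evalAt (1 : Matrix (Fin n) (Fin n) F)) = 1)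
    (hγ1 : ∀ j, evalAt (1 : Matrix (Fin n) (Fin n) F) (γ j) = 0)
    (hα : ∀ A ∈ tangentSpace Γ, ∀ i j,
      leftInvDer A (α i j) - ∑ k, α i k * C (x A k j) ∈ groupIdeal Γ)
    (hγ : ∀ A ∈ tangentSpace Γ, ∀ j,
      leftInvDer A (γ j) - ∑ k, γ k * C (x A k j) ∈ groupIdeal Γ) (j : r) :
    γ j ∈ groupIdeal Γ := by
  set ι : MvPolynomial (Fin n × Fin n) F →+* RationalFunctions Γ := algebraMap _ _ with hι
  set a : Matrix r r (RationalFunctions Γ) := α.map ι with ha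
  set c : r → RationalFunctions Γ := fun j => ι (γ j) with hc
  -- The determinant is `1` at the identity, so it is not the zero function.
  have hdet : IsUnit a.det := by
    rw [isUnit_iff_ne_zero]
    have : a.det = ι α.det := by
      rw [RingHom.map_det]
      rfl
    rw [this, Ne, algebraMap_rationalFunctions_eq_zero]
    intro h
    have h1 := evalAt_one_of_mem h
    rw [AlgHom.map_det] at h1
    have h2 : (evalAt (1 : Matrix (Fin n) (Fin n) F)).mapMatrix α = 1 := hα1
    rw [h2, Matrix.det_one] at h1
    exact one_ne_zero h1
  -- The quotient of two solutions of the same system is killed by all derivations, so its entries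
  -- are constants. These are read off at the identity, where the invertible solution is `1` and the
  -- row is `0`.
  set q : r → RationalFunctions Γ := Matrix.vecMul c a⁻¹ with hq
  have hqa : Matrix.vecMul q a = c := by
    rw [hq, Matrix.vecMul_vecMul, Matrix.nonsing_inv_mul _ hdet, Matrix.vecMul_one]
  have hqj : ∀ j, c j = ∑ i, q i * a i j := fun j => (congrFun hqa j).symm
  have hδ : ∀ (δ : Derivation F (RationalFunctions Γ) (RationalFunctions Γ)) (i : r), δ (q i) = 0 := by
    intro δ
    obtain ⟨e, B, hB, hδ⟩ := exists_leftInvDer_combination δ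
    have h1 : ∀ i j, δ (a i j) = ∑ l, a i l * ∑ k, e k * ι (C (x (B k) l j)) := by
      intro i j
      change δ (algebraMap _ _ (α i j)) = _
      rw [hδ]
      simp only [Finset.mul_sum]
      rw [Finset.sum_comm]
      refine Finset.sum_congr rfl fun k _ => ?_
      have := hα _ (hB k) i j
      rw [← algebraMap_rationalFunctions_eq_zero, map_sub, sub_eq_zero] at this
      rw [this, map_sum, Finset.mul_sum]
      refine Finset.sum_congr rfl fun l _ => ?_
      rw [map_mul, ha, Matrix.map_apply]
      ring
    have h2 : ∀ j, δ (c j) = ∑ l, c l * ∑ k, e k * ι (C (x (B k) l j)) := by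
      intro j
      change δ (algebraMap _ _ (γ j)) = _
      rw [hδ]
      simp only [Finset.mul_sum]
      rw [Finset.sum_comm]
      refine Finset.sum_congr rfl fun k _ => ?_
      have := hγ _ (hB k) j
      rw [← algebraMap_rationalFunctions_eq_zero, map_sub, sub_eq_zero] at this
      rw [this, map_sum, Finset.mul_sum]
      refine Finset.sum_congr rfl fun l _ => ?_
      rw [map_mul]
      ring
    have h3 : Matrix.vecMul (fun i => δ (q i)) a = 0 := by
      ext j
      have h4 := h2 j
      rw [hqj j, map_sum] at h4
      simp only [Derivation.leibniz, smul_eq_mul, Finset.sum_add_distrib] at h4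
      have h5 : ∑ i, q i * δ (a i j) = ∑ l, c l * ∑ k, e k * ι (C (x (B k) l j)) := by
        simp only [h1, hqj, Finset.mul_sum, Finset.sum_mul]
        rw [Finset.sum_comm]
        refine Finset.sum_congr rfl fun l _ => ?_
        rw [Finset.sum_comm]
        refine Finset.sum_congr rfl fun k _ => Finset.sum_congr rfl fun i _ => ?_
        ring
      rw [h5] at h4
      have h6 : ∑ i, a i j * δ (q i) = 0 := by simpa using h4
      rw [Pi.zero_apply, ← h6, Matrix.vecMul, dotProduct]
      exact Finset.sum_congr rfl fun i _ => mul_comm _ _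
    have h7 := congrArg (fun v => Matrix.vecMul v a⁻¹) h3
    simp only [Matrix.vecMul_vecMul, Matrix.mul_nonsing_inv _ hdet, Matrix.vecMul_one,
      Matrix.zero_vecMul] at h7
    exact fun i => congrFun h7 i
  choose d hd using fun i => mem_range_algebraMap_of_derivation fun δ => hδ δ i
  have hmem : ∀ j, γ j - ∑ i, C (d i) * α i j ∈ groupIdeal Γ := by
    intro j
    rw [← algebraMap_rationalFunctions_eq_zero, map_sub, sub_eq_zero, map_sum]
    change c j = _
    rw [hqj]
    refine Finset.sum_congr rfl fun i _ => ?_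
    rw [map_mul, ← hd, IsScalarTower.algebraMap_apply F (MvPolynomial (Fin n × Fin n) F)]
    rfl
  have hd0 : ∀ j, d j = 0 := by
    intro j
    have h1 := evalAt_one_of_mem (hmem j)
    rw [map_sub, hγ1, zero_sub, neg_eq_zero, map_sum] at h1
    have h2 : ∀ i j, evalAt (1 : Matrix (Fin n) (Fin n) F) (α i j) = (1 : Matrix r r F) i j :=
      fun i j => congrFun (congrFun hα1 i) j
    simp only [map_mul, h2, evalAt_C, Matrix.one_apply, mul_ite, mul_one, mul_zero,
      Finset.sum_ite_eq', Finset.mem_univ, if_true, Algebra.algebraMap_self, RingHom.id_apply] at h1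
    exact h1
  have h := hmem j
  simpa [hd0] using h

/-- A polynomial killed by the Lie algebra is constant on the group. -/
theorem evalAt_eq_one_of_leftInvDer {χ : MvPolynomial (Fin n × Fin n) F}
    (h1 : evalAt (1 : Matrix (Fin n) (Fin n) F) χ = 1)
    (hχ : ∀ A ∈ tangentSpace Γ, leftInvDer A χ ∈ groupIdeal Γ) {g : GL (Fin n) F} (hg : g ∈ Γ) :
    evalAt (g : Matrix (Fin n) (Fin n) F) χ = 1 := by
  have h := mem_groupIdeal_of_linear_system (Γ := Γ) (r := Unit) 1 (fun _ => χ - 1) (fun _ => 0)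
    (by simp) (by simp [h1]) (by
      intro A hA i j
      have : (1 : Matrix Unit Unit (MvPolynomial (Fin n × Fin n) F)) i j = 1 := by
        rw [Subsingleton.elim i j, Matrix.one_apply_eq]
      rw [this]
      simp) (by
      intro A hA j
      simpa using hχ A hA) ()
  have := h g hg
  rwa [map_sub, map_one, sub_eq_zero] at this

/-- The product `U * P * V` of a matrix of polynomials with constant matrices. -/
def sandwich {s m t : Type*} [Fintype m] (U : Matrix s m F)
    (P : Matrix m m (MvPolynomial (Fin n × Fin n) F)) (V : Matrix m t F) :
    Matrix s t (MvPolynomial (Fin n × Fin n) F) :=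
  Matrix.of fun i j => ∑ l, ∑ k, (U i k * V l j) • P k l

omit [CharZero F] [IsAlgClosed F] in
theorem map_sandwich {s m t : Type*} [Fintype m] (U : Matrix s m F)
    (P : Matrix m m (MvPolynomial (Fin n × Fin n) F)) (V : Matrix m t F)
    (L : MvPolynomial (Fin n × Fin n) F →ₗ[F] F) (i : s) (j : t) :
    L (sandwich U P V i j) = (U * P.map L * V) i j := by
  simp only [sandwich, Matrix.of_apply, map_sum, map_smul, Matrix.mul_apply, Finset.sum_mul,
    Matrix.map_apply, smul_eq_mul]
  refine Finset.sum_congr rfl fun l _ => Finset.sum_congr rfl fun k _ => ?_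
  ring

omit [CharZero F] [IsAlgClosed F] in
theorem evalAt_sandwich {s m t : Type*} [Fintype m] (U : Matrix s m F)
    (P : Matrix m m (MvPolynomial (Fin n × Fin n) F)) (V : Matrix m t F)
    (M : Matrix (Fin n) (Fin n) F) :
    (sandwich U P V).map (evalAt M) = U * P.map (evalAt M) * V := by
  ext i k
  exact map_sandwich U P V (evalAt M).toLinearMap i k

omit [CharZero F] [IsAlgClosed F] [(groupIdeal Γ).IsPrime] in
-- From `A · P = P dP(A)` and `dP(A) V = V x`, the matrix `U P V` satisfies a system with
-- coefficients `x`, whatever `U` is. So different choices of `U` give solutions of one system.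
theorem IsPolyRep.leftInvDer_sandwich_mem {m : Type*} [Fintype m] [DecidableEq m]
    {P : Matrix m m (MvPolynomial (Fin n × Fin n) F)} (hP : IsPolyRep Γ P) {s t : Type*} [Fintype t]
    (U : Matrix s m F) (V : Matrix m t F) {A : Matrix (Fin n) (Fin n) F} (hA : A ∈ tangentSpace Γ)
    (x : Matrix t t F) (hx : V * x = diffOne P A * V) (i : s) (j : t) :
    leftInvDer A (sandwich U P V i j) - ∑ k, sandwich U P V i k * C (x k j) ∈ groupIdeal Γ := by
  intro h hh
  have h1 := map_sandwich U P V
    ((evalAt (h : Matrix (Fin n) (Fin n) F)).toLinearMap ∘ₗ (leftInvDer A).toLinearMap) i j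
  have h2 : ∀ k, evalAt (h : Matrix (Fin n) (Fin n) F) (sandwich U P V i k) =
    (U * P.map (evalAt (h : Matrix (Fin n) (Fin n) F)) * V) i k := fun k =>
    map_sandwich U P V (evalAt (h : Matrix (Fin n) (Fin n) F)).toLinearMap i k
  have h3 : P.map ((evalAt (h : Matrix (Fin n) (Fin n) F)).toLinearMap ∘ₗ
      (leftInvDer A).toLinearMap) =
      P.map (evalAt (h : Matrix (Fin n) (Fin n) F)) * diffOne P A := hP.evalAt_leftInvDer hA hh
  rw [h3, Matrix.mul_assoc, Matrix.mul_assoc, ← hx] at h1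
  rw [map_sub, sub_eq_zero, map_sum]
  refine h1.trans ?_
  rw [← Matrix.mul_assoc, ← Matrix.mul_assoc, Matrix.mul_apply]
  refine Finset.sum_congr rfl fun k _ => ?_
  rw [_root_.map_mul, h2, evalAt_C]
  rfl

/-- A subspace stable under the Lie algebra is stable under the group. -/
theorem IsPolyRep.mulVec_mem {m : Type*} [Fintype m] [DecidableEq m]
    {P : Matrix m m (MvPolynomial (Fin n × Fin n) F)} (hP : IsPolyRep Γ P)
    (W : Submodule F (m → F))
    (hW : ∀ A ∈ tangentSpace Γ, ∀ w ∈ W, Matrix.mulVec (diffOne P A) w ∈ W)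
    {g : GL (Fin n) F} (hg : g ∈ Γ) {w : m → F} (hw : w ∈ W) :
    Matrix.mulVec (P.map (evalAt (g : Matrix (Fin n) (Fin n) F))) w ∈ W := by
  obtain ⟨π, hπ⟩ := LinearMap.exists_leftInverse_of_injective W.subtype (Submodule.ker_subtype _)
  have hπ' : ∀ v : W, π v = v := fun v => LinearMap.congr_fun hπ v
  let b := Module.finBasis F W
  -- `B` is the inclusion of `W` in coordinates and `D` a retraction, so `D * B = 1` and `B * D` is
  -- a projection onto `W`.
  set B : Matrix m (Fin (Module.finrank F W)) F := LinearMap.toMatrix' (W.subtype ∘ₗ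
    (b.equivFun.symm : (Fin (Module.finrank F W) → F) →ₗ[F] W)) with hB
  set D : Matrix (Fin (Module.finrank F W)) m F := LinearMap.toMatrix'
    ((b.equivFun : W →ₗ[F] _) ∘ₗ π) with hD
  have hBv : ∀ c, Matrix.mulVec B c = b.equivFun.symm c := fun c => by
    rw [hB, LinearMap.toMatrix'_mulVec]
    rfl
  have hDv : ∀ v, Matrix.mulVec D v = b.equivFun (π v) := fun v => by
    rw [hD, LinearMap.toMatrix'_mulVec]
    rfl
  have hDB : D * B = 1 := by
    apply Matrix.ext_of_mulVec_single
    intro i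
    rw [← Matrix.mulVec_mulVec, hBv, hDv, hπ', LinearEquiv.apply_symm_apply, Matrix.one_mulVec]
  have hBDw : ∀ v ∈ W, Matrix.mulVec B (Matrix.mulVec D v) = v := by
    intro v hv
    rw [hDv, hBv, hπ' ⟨v, hv⟩, LinearEquiv.symm_apply_apply]
  have hstab : ∀ A ∈ tangentSpace Γ, B * (D * (diffOne P A * B)) = diffOne P A * B := by
    intro A hA
    apply Matrix.ext_of_mulVec_single
    intro i
    rw [← Matrix.mulVec_mulVec, ← Matrix.mulVec_mulVec]
    apply hBDw
    rw [← Matrix.mulVec_mulVec]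
    apply hW A hA
    rw [hBv]
    exact Subtype.prop _
  -- The component of `P(g)W` transverse to `W` solves the same system as the invertible solution `D
  -- P B`, and it vanishes at the identity.
  have hvan : ∀ i j, sandwich (1 - B * D) P B i j ∈ groupIdeal Γ := by
    intro i
    apply mem_groupIdeal_of_linear_system (sandwich D P B) (fun j => sandwich (1 - B * D) P B i j)
      (fun A => D * (diffOne P A * B))
    · rw [evalAt_sandwich, hP.map_one, Matrix.mul_one, hDB]
    · intro j
      have := congrFun (congrFun (evalAt_sandwich (1 - B * D) P B 1) i) j
      rw [hP.map_one, Matrix.mul_one, Matrix.sub_mul, Matrix.mul_assoc, hDB, Matrix.mul_one,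
        Matrix.one_mul, sub_self] at this
      exact this
    · exact fun A hA => hP.leftInvDer_sandwich_mem D B hA _ (hstab A hA)
    · exact fun A hA => hP.leftInvDer_sandwich_mem (1 - B * D) B hA _ (hstab A hA) i
  have h0 : (1 - B * D) * P.map (evalAt (g : Matrix (Fin n) (Fin n) F)) * B = 0 := by
    rw [← evalAt_sandwich]
    ext i j
    exact hvan i j g hg
  rw [Matrix.sub_mul, Matrix.sub_mul, Matrix.one_mul, sub_eq_zero] at h0
  rw [← hBDw w hw, Matrix.mulVec_mulVec, h0, Matrix.mul_assoc, Matrix.mul_assoc,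
    ← Matrix.mulVec_mulVec, hBv]
  exact Subtype.prop _

end FunctionField

/-! ## Exponentials and tori -/

section Curves

open LinearAlgebraicGroup

variable {F : Type*} [Field F] {n : ℕ}

/-- The chain rule for a curve `E` with `E' = E * X`. -/
theorem derivation_evalAt {B : Type*} [CommRing B] [Algebra F B] (D : Derivation F B B)
    {E : Matrix (Fin n) (Fin n) B} {X : Matrix (Fin n) (Fin n) F}
    (hE : ∀ i j, D (E i j) = (E * X.map (algebraMap F B)) i j)
    (f : MvPolynomial (Fin n × Fin n) F) : D (evalAt E f) = evalAt E (leftInvDer X f) := by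
  induction f using MvPolynomial.induction_on with
  | C c =>
    rw [evalAt_C, D.map_algebraMap, derivation_C, map_zero]
  | add p q hp hq => rw [map_add, map_add, map_add, map_add, hp, hq]
  | mul_X p ij hp =>
    rw [map_mul, Derivation.leibniz, Derivation.leibniz, map_add, smul_eq_mul, smul_eq_mul,
      smul_eq_mul, smul_eq_mul, map_mul, map_mul, hp, evalAt_X, hE, leftInvDer_X]
    congr 2
    simp [Matrix.mul_apply, evalAt_X]

/-- The truncated exponential `exp (s X)` as a matrix of polynomials in `s`. -/
def expCurve (X : Matrix (Fin n) (Fin n) F) (N : ℕ) :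
    Matrix (Fin n) (Fin n) (Polynomial F) :=
  Matrix.of fun i j => ∑ k ∈ Finset.range N,
    Polynomial.monomial k (((k.factorial : F)⁻¹) * (X ^ k) i j)

theorem coeff_expCurve {X : Matrix (Fin n) (Fin n) F} {N : ℕ} (hX : X ^ N = 0) (i j : Fin n)
    (k : ℕ) : (expCurve X N i j).coeff k = ((k.factorial : F)⁻¹) * (X ^ k) i j := by
  simp only [expCurve, Matrix.of_apply, Polynomial.finsetSum_coeff, Polynomial.coeff_monomial,
    Finset.sum_ite_eq', Finset.mem_range]
  split_ifs with h
  · rfl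
  · rw [pow_eq_zero_of_le (not_lt.1 h) hX]
    simp

variable [CharZero F]

theorem derivative_expCurve {X : Matrix (Fin n) (Fin n) F} {N : ℕ} (hX : X ^ N = 0)
    (i j : Fin n) : Polynomial.derivative (expCurve X N i j) =
      (expCurve X N * X.map (algebraMap F (Polynomial F))) i j := by
  ext k
  rw [Polynomial.coeff_derivative, coeff_expCurve hX, Matrix.mul_apply, Polynomial.finsetSum_coeff]
  simp only [Matrix.map_apply, Polynomial.algebraMap_eq, Polynomial.coeff_mul_C, coeff_expCurve hX]
  rw [pow_succ, Matrix.mul_apply, Finset.mul_sum, Finset.sum_mul]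
  refine Finset.sum_congr rfl fun l _ => ?_
  have h1 : (k.factorial : F) ≠ 0 := Nat.cast_ne_zero.2 k.factorial_ne_zero
  have h2 : ((k : F) + 1) ≠ 0 := Nat.cast_add_one_ne_zero k
  rw [Nat.factorial_succ]
  push_cast
  field_simp

theorem map_eval_expCurve {X : Matrix (Fin n) (Fin n) F} {N : ℕ} (hX : X ^ N = 0) :
    (expCurve X N).map (Polynomial.aeval (1 : F)) = IsNilpotent.exp X := by
  rw [IsNilpotent.exp_eq_sum hX]
  ext i j
  simp only [expCurve, Matrix.map_apply, Matrix.of_apply, map_sum, Polynomial.aeval_monomial,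
    one_pow, mul_one, Matrix.sum_apply, Matrix.smul_apply, Rat.smul_def]
  simp

omit [CharZero F] in
theorem map_eval_zero_expCurve {X : Matrix (Fin n) (Fin n) F} {N : ℕ} (hX : X ^ N = 0) :
    (expCurve X N).map (Polynomial.aeval (0 : F)) = 1 := by
  ext i j
  rw [Matrix.map_apply, ← Polynomial.coeff_zero_eq_aeval_zero, coeff_expCurve hX]
  simp

variable {Γ : Subgroup (GL (Fin n) F)}

/-- The derivative in `s` of `f(exp(sX))` is `leftInvDer X f` along the same curve, and this
polynomial is again in the ideal. By induction all coefficients vanish, since each is determined in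
characteristic zero by one of the derivative. -/
theorem evalAt_expCurve_eq_zero {X : Matrix (Fin n) (Fin n) F} {N : ℕ} (hX : X ^ N = 0)
    (hXΓ : X ∈ tangentSpace Γ) {f : MvPolynomial (Fin n × Fin n) F} (hf : f ∈ groupIdeal Γ) :
    evalAt (expCurve X N) f = 0 := by
  ext k
  rw [Polynomial.coeff_zero]
  induction k generalizing f with
  | zero =>
    rw [Polynomial.coeff_zero_eq_aeval_zero (R := F), algHom_evalAt, map_eval_zero_expCurve hX]
    exact evalAt_one_of_mem hf
  | succ k ih =>
    have h1 := derivation_evalAt (Polynomial.derivative' (R := F)) (E := expCurve X N) (X := X)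
      (derivative_expCurve hX) f
    have h2 := ih (leftInvDer_mem_groupIdeal hXΓ hf)
    rw [← h1] at h2
    change (Polynomial.derivative _).coeff k = 0 at h2
    rw [Polynomial.coeff_derivative, mul_eq_zero] at h2
    exact h2.resolve_right (Nat.cast_add_one_ne_zero k)

theorem evalAt_exp_eq_zero {X : Matrix (Fin n) (Fin n) F} (hX : IsNilpotent X)
    (hXΓ : X ∈ tangentSpace Γ) {f : MvPolynomial (Fin n × Fin n) F} (hf : f ∈ groupIdeal Γ) :
    evalAt (IsNilpotent.exp X) f = 0 := by
  obtain ⟨N, hN⟩ := hX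
  rw [← map_eval_expCurve hN, ← algHom_evalAt, evalAt_expCurve_eq_zero hN hXΓ hf, map_zero]

/-- `P(exp(sX))` satisfies `y' = y dP(X)` and `y(0) = 1`, which determines its coefficients as those
of `exp(s dP(X))`. -/
theorem IsPolyRep.coeff_expCurve {m : Type*} [Fintype m] [DecidableEq m]
    {P : Matrix m m (MvPolynomial (Fin n × Fin n) F)} (hP : IsPolyRep Γ P)
    {X : Matrix (Fin n) (Fin n) F} {N : ℕ} (hX : X ^ N = 0) (hXΓ : X ∈ tangentSpace Γ) (k : ℕ) :
    (Matrix.of fun i j => (evalAt (expCurve X N) (P i j)).coeff k) =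
      ((k.factorial : F)⁻¹) • (diffOne P X) ^ k := by
  induction k with
  | zero =>
    ext i j
    rw [Matrix.of_apply, Polynomial.coeff_zero_eq_aeval_zero (R := F), algHom_evalAt,
      map_eval_zero_expCurve hX]
    have := congrFun (congrFun hP.map_one i) j
    simpa using this
  | succ k ih =>
    ext i j
    have h1 := derivation_evalAt (Polynomial.derivative' (R := F)) (E := expCurve X N) (X := X)
      (derivative_expCurve hX) (P i j)
    change Polynomial.derivative _ = _ at h1
    have h2 := evalAt_expCurve_eq_zero hX hXΓ (hP.leftInvDer_sub_mem hXΓ i j)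
    rw [_root_.map_sub, sub_eq_zero, ← h1] at h2
    have h3 := congrArg (fun p => Polynomial.coeff p k) h2
    simp only [Polynomial.coeff_derivative, Matrix.mul_apply, _root_.map_sum, _root_.map_mul,
      Matrix.map_apply, evalAt_C, Polynomial.finsetSum_coeff, Polynomial.algebraMap_eq,
      Polynomial.coeff_mul_C] at h3
    have h4 : ∀ l, (evalAt (expCurve X N) (P i l)).coeff k =
      (((k.factorial : F)⁻¹) • (diffOne P X) ^ k) i l := fun l => congrFun (congrFun ih i) l
    simp only [h4] at h3
    rw [← Matrix.mul_apply (M := ((k.factorial : F)⁻¹) • (diffOne P X) ^ k), smul_mul_assoc,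
      ← pow_succ] at h3
    have h5 : ((k : F) + 1) ≠ 0 := Nat.cast_add_one_ne_zero k
    rw [Matrix.of_apply, ← mul_left_inj' h5, h3, Matrix.smul_apply, Matrix.smul_apply,
      Nat.factorial_succ]
    push_cast
    simp only [smul_eq_mul]
    have h6 : (k.factorial : F) ≠ 0 := Nat.cast_ne_zero.2 k.factorial_ne_zero
    field_simp

/-- `P(exp(sX))` is polynomial in `s`, so the coefficients `dP(X)ᵏ / k!` vanish for large `k`. -/
theorem IsPolyRep.isNilpotent_diffOne {m : Type*} [Fintype m] [DecidableEq m]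
    {P : Matrix m m (MvPolynomial (Fin n × Fin n) F)} (hP : IsPolyRep Γ P)
    {X : Matrix (Fin n) (Fin n) F} (hX : IsNilpotent X) (hXΓ : X ∈ tangentSpace Γ) :
    IsNilpotent (diffOne P X) := by
  obtain ⟨N, hN⟩ := hX
  obtain ⟨k, hk⟩ : ∃ k, ∀ ij : m × m, (evalAt (expCurve X N) (P ij.1 ij.2)).natDegree < k := by
    obtain ⟨k, hk⟩ := (Set.finite_range fun ij : m × m =>
      (evalAt (expCurve X N) (P ij.1 ij.2)).natDegree).bddAbove
    exact ⟨k + 1, fun ij => Nat.lt_succ_of_le (hk ⟨ij, rfl⟩)⟩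
  refine ⟨k, ?_⟩
  have h := hP.coeff_expCurve hN hXΓ k
  have h0 : (Matrix.of fun i j => (evalAt (expCurve X N) (P i j)).coeff k) = 0 := by
    ext i j
    exact Polynomial.coeff_eq_zero_of_natDegree_lt (hk (i, j))
  rw [h0] at h
  exact (smul_eq_zero.1 h.symm).resolve_left
    (inv_ne_zero (Nat.cast_ne_zero.2 k.factorial_ne_zero))

theorem IsPolyRep.map_exp {m : Type*} [Fintype m] [DecidableEq m]
    {P : Matrix m m (MvPolynomial (Fin n × Fin n) F)} (hP : IsPolyRep Γ P)
    {X : Matrix (Fin n) (Fin n) F} (hX : IsNilpotent X) (hXΓ : X ∈ tangentSpace Γ) :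
    P.map (evalAt (IsNilpotent.exp X)) = IsNilpotent.exp (diffOne P X) := by
  obtain ⟨K, hK⟩ := hP.isNilpotent_diffOne hX hXΓ
  obtain ⟨N, hN⟩ := hX
  rw [IsNilpotent.exp_eq_sum hK, ← map_eval_expCurve hN]
  ext i j
  have hcoeff : ∀ k, (evalAt (expCurve X N) (P i j)).coeff k =
    (((k.factorial : F)⁻¹) • (diffOne P X) ^ k) i j := fun k =>
      congrFun (congrFun (hP.coeff_expCurve hN hXΓ k) i) j
  have hdeg : (evalAt (expCurve X N) (P i j)) = ∑ k ∈ Finset.range K,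
      Polynomial.monomial k ((((k.factorial : F)⁻¹) • (diffOne P X) ^ k) i j) := by
    ext k
    simp only [Polynomial.finsetSum_coeff, Polynomial.coeff_monomial,
      Finset.sum_ite_eq', Finset.mem_range, hcoeff]
    split_ifs with h
    · rfl
    · rw [pow_eq_zero_of_le (not_lt.1 h) hK]
      simp
  rw [Matrix.map_apply, ← algHom_evalAt, hdeg]
  simp only [_root_.map_sum, Polynomial.aeval_monomial, one_pow, mul_one, Matrix.sum_apply,
    Matrix.smul_apply, Rat.smul_def, smul_eq_mul]
  simp

end Curves

section Tori

open LinearAlgebraicGroup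

variable {F : Type*} [Field F] {n : ℕ}

/-- By the Leibniz rule `(D - a - b)(uv) = ((D - a)u)v + u((D - b)v)`, so each step lowers one of
the two nilpotency exponents. -/
theorem Derivation.mul_mem_maxGenEigenspace {A : Type*} [CommRing A] [Algebra F A]
    (D : Derivation F A A) {a b : F} {u v : A}
    (hu : u ∈ Module.End.maxGenEigenspace (D : A →ₗ[F] A) a)
    (hv : v ∈ Module.End.maxGenEigenspace (D : A →ₗ[F] A) b) :
    u * v ∈ Module.End.maxGenEigenspace (D : A →ₗ[F] A) (a + b) := by
  rw [Module.End.mem_maxGenEigenspace] at hu hv ⊢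
  obtain ⟨k, hk⟩ := hu
  obtain ⟨l, hl⟩ := hv
  refine ⟨k + l, ?_⟩
  generalize hN : k + l = N
  induction N generalizing k l u v with
  | zero =>
    have hk0 : k = 0 := by omega
    subst hk0
    have : u = 0 := hk
    simp [this]
  | succ N ih =>
    rcases k with _ | k
    · have : u = 0 := hk
      simp [this]
    rcases l with _ | l
    · have : v = 0 := hl
      simp [this]
    rw [pow_succ, Module.End.mul_apply] at hk hl ⊢
    have hstep : ((D : A →ₗ[F] A) - (a + b) • (1 : Module.End F A)) (u * v) =
        (((D : A →ₗ[F] A) - a • (1 : Module.End F A)) u) * v +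
        u * (((D : A →ₗ[F] A) - b • (1 : Module.End F A)) v) := by
      simp only [LinearMap.sub_apply, Derivation.coeFn_coe, LinearMap.smul_apply,
        Module.End.one_apply, Derivation.leibniz, smul_eq_mul]
      simp only [Algebra.smul_def, map_add]
      ring
    rw [hstep, map_add, ih k hk (l + 1) (by rw [pow_succ, Module.End.mul_apply]; exact hl)
      (by omega), ih (k + 1) (by rw [pow_succ, Module.End.mul_apply]; exact hk) l hl (by omega),
      add_zero]

/-- In the quotient by `p` the images still lie in generalized eigenspaces for distinct eigenvalues.
Those are independent, so a vanishing sum has vanishing terms. -/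
theorem mem_of_sum_mem_of_maxGenEigenspace {V : Type*} [AddCommGroup V] [Module F V]
    (D : Module.End F V) (p : Submodule F V) (hp : ∀ v ∈ p, D v ∈ p) {M : Type*}
    {ι : M → F} (hι : Function.Injective ι) (s : Finset M) (u : M → V)
    (hu : ∀ m, u m ∈ Module.End.maxGenEigenspace D (ι m)) (hsum : ∑ m ∈ s, u m ∈ p) {m : M}
    (hm : m ∈ s) : u m ∈ p := by
  classical
  let D' : Module.End F (V ⧸ p) := p.mapQ p D hp
  have hD' : ∀ v, D' (p.mkQ v) = p.mkQ (D v) := fun v => Submodule.mapQ_apply _ _ _ _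
  have hpow : ∀ (c : F) (k : ℕ) (v : V), ((D' - c • (1 : Module.End F (V ⧸ p))) ^ k) (p.mkQ v) =
      p.mkQ (((D - c • (1 : Module.End F V)) ^ k) v) := by
    intro c k
    induction k with
    | zero => intro v; rfl
    | succ k ih =>
      intro v
      rw [pow_succ, Module.End.mul_apply, pow_succ, Module.End.mul_apply, ← ih]
      congr 1
  have hu' : ∀ m, p.mkQ (u m) ∈ Module.End.maxGenEigenspace D' (ι m) := by
    intro m
    obtain ⟨k, hk⟩ := (Module.End.mem_maxGenEigenspace _ _ _).1 (hu m)
    exact (Module.End.mem_maxGenEigenspace _ _ _).2 ⟨k, by rw [hpow, hk, map_zero]⟩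
  have hind : iSupIndep fun m => Module.End.maxGenEigenspace D' (ι m) :=
    D'.independent_maxGenEigenspace.comp hι
  rw [iSupIndep_iff_finsetSum_eq_zero_imp_eq_zero] at hind
  have h1 : p.mkQ (∑ m ∈ s, u m) = 0 := (Submodule.Quotient.mk_eq_zero p).2 hsum
  rw [map_sum] at h1
  exact (Submodule.Quotient.mk_eq_zero p).1 (hind s (fun m => p.mkQ (u m)) (fun m _ => hu' m) h1 m hm)

/-- The homomorphism recording the weights of the torus of all `Q * diagonal * Q'`. -/
def weightHom {M : Type*} [AddCommMonoid M] (Q Q' : Matrix (Fin n) (Fin n) F) (d : Fin n → M) :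
    MvPolynomial (Fin n × Fin n) F →ₐ[F] AddMonoidAlgebra (MvPolynomial (Fin n × Fin n) F) M :=
  aeval fun ij => ∑ l, AddMonoidAlgebra.single (d l)
    ((Matrix.mvPolynomialX (Fin n) (Fin n) F * Q.map (C (σ := Fin n × Fin n))) ij.1 l *
      C (Q' l ij.2))

theorem weightHom_X {M : Type*} [AddCommMonoid M] (Q Q' : Matrix (Fin n) (Fin n) F) (d : Fin n → M)
    (ij : Fin n × Fin n) : weightHom Q Q' d (X ij) = ∑ l, AddMonoidAlgebra.single (d l)
    ((Matrix.mvPolynomialX (Fin n) (Fin n) F * Q.map (C (σ := Fin n × Fin n))) ij.1 l *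
      C (Q' l ij.2)) :=
  aeval_X _ _

theorem leftInvDer_mvPolynomialX_mul (X V : Matrix (Fin n) (Fin n) F) (i j : Fin n) :
    leftInvDer X ((Matrix.mvPolynomialX (Fin n) (Fin n) F * V.map (C (σ := Fin n × Fin n))) i j) =
      (Matrix.mvPolynomialX (Fin n) (Fin n) F * (X * V).map (C (σ := Fin n × Fin n))) i j := by
  rw [Matrix.map_mul, ← Matrix.mul_assoc, Matrix.mul_apply, map_sum, Matrix.mul_apply]
  refine Finset.sum_congr rfl fun k _ => ?_
  rw [Derivation.leibniz, Matrix.map_apply, derivation_C, smul_zero, zero_add,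
    Matrix.mvPolynomialX_apply, leftInvDer_X, smul_eq_mul, mul_comm]

/-- For the generic matrix `ξ`, applying `D - ι(d l)` to column `l` of `ξ ν^k Q` gives column `l` of
`ξ ν^(k+1) Q`; hence the columns of `ξ Q` are generalized eigenvectors of weight `ι(d l)`. Weights
add under products. -/
theorem coeff_weightHom_mem {M : Type*} [AddCommMonoid M] (ι : M →+ F)
    {s ν Q Q' : Matrix (Fin n) (Fin n) F} {d : Fin n → M}
    (hsQ : s * Q = Q * Matrix.diagonal fun l => ι (d l)) (hcomm : s * ν = ν * s)
    (hν : IsNilpotent ν) (f : MvPolynomial (Fin n × Fin n) F) (m : M) :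
    (weightHom Q Q' d f).coeff m ∈
      Module.End.maxGenEigenspace (leftInvDer (s + ν) : Module.End F _) (ι m) := by
  classical
  induction f using MvPolynomial.induction_on generalizing m with
  | C c =>
    have h1 : weightHom Q Q' d (C c) = AddMonoidAlgebra.single 0 (C c) := by
      rw [← MvPolynomial.algebraMap_eq, AlgHom.commutes]
      rfl
    rw [h1, AddMonoidAlgebra.coeff_single, Finsupp.single_apply]
    split_ifs with h
    · subst h
      rw [map_zero, Module.End.mem_maxGenEigenspace]
      refine ⟨1, ?_⟩
      simp
    · exact zero_mem _
  | add p q hp hq =>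
    rw [map_add, AddMonoidAlgebra.coeff_add, Finsupp.add_apply]
    exact add_mem (hp m) (hq m)
  | mul_X p ij hp =>
    have hX : ∀ m, (weightHom Q Q' d (X ij)).coeff m ∈
        Module.End.maxGenEigenspace (leftInvDer (s + ν) : Module.End F _) (ι m) := by
      intro m
      rw [weightHom_X, AddMonoidAlgebra.coeff_sum, Finsupp.finsetSum_apply]
      refine sum_mem fun l _ => ?_
      rw [AddMonoidAlgebra.coeff_single, Finsupp.single_apply]
      split_ifs with h
      · subst h
        rw [mul_comm, ← MvPolynomial.smul_eq_C_mul]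
        apply Submodule.smul_mem
        rw [Module.End.mem_maxGenEigenspace]
        obtain ⟨k, hk⟩ := hν
        refine ⟨k, ?_⟩
        have hpow : ∀ (k : ℕ), ((((leftInvDer (s + ν) : Derivation F _ _) :
            Module.End F (MvPolynomial (Fin n × Fin n) F)) - ι (d l) • 1) ^ k)
              ((Matrix.mvPolynomialX (Fin n) (Fin n) F * Q.map (C (σ := Fin n × Fin n))) ij.1 l) =
            (Matrix.mvPolynomialX (Fin n) (Fin n) F *
              (ν ^ k * Q).map (C (σ := Fin n × Fin n))) ij.1 l := by
          intro k
          induction k with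
          | zero => rw [pow_zero, pow_zero, one_mul]; rfl
          | succ k ih =>
            rw [pow_succ', Module.End.mul_apply, ih, LinearMap.sub_apply, Derivation.coeFn_coe,
              leftInvDer_mvPolynomialX_mul, LinearMap.smul_apply, Module.End.one_apply]
            have hc : Commute s (ν ^ k) := Commute.pow_right hcomm k
            have h2 : (s + ν) * (ν ^ k * Q) =
                ν ^ k * Q * Matrix.diagonal (fun l => ι (d l)) + ν ^ (k + 1) * Q := by
              rw [add_mul, ← mul_assoc, hc.eq, mul_assoc, hsQ, ← mul_assoc, ← mul_assoc, ← pow_succ']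
            rw [h2, Matrix.map_add C (map_add C), mul_add, Matrix.add_apply, sub_eq_iff_eq_add,
              add_comm]
            congr 1
            rw [Matrix.map_mul, ← mul_assoc, Matrix.diagonal_map (map_zero C), Matrix.mul_diagonal,
              smul_eq_C_mul, mul_comm]
        rw [hpow, hk]
        simp
      · exact zero_mem _
    rw [map_mul, AddMonoidAlgebra.coeff_mul]
    refine sum_mem fun a _ => sum_mem fun b _ => ?_
    dsimp only
    split_ifs with h
    · rw [← h, map_add]
      exact Derivation.mul_mem_maxGenEigenspace _ (hp a) (hX b)
    · exact zero_mem _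

/-- If `X = s + ν` is a Jordan decomposition and `s` has weights `d`, then every character of the
group of weights gives a zero of each polynomial whose derivatives along `X` vanish at `1`. -/
theorem evalAt_torus_eq_zero {M : Type*} [AddCommMonoid M]
    (ι : M →+ F) (hι : Function.Injective ι)
    {s ν Q Q' : Matrix (Fin n) (Fin n) F} {d : Fin n → M} (hQ : Q * Q' = 1)
    (hsQ : s * Q = Q * Matrix.diagonal fun l => ι (d l)) (hcomm : s * ν = ν * s)
    (hν : IsNilpotent ν) {f : MvPolynomial (Fin n × Fin n) F}
    (hf : ∀ k : ℕ, evalAt (1 : Matrix (Fin n) (Fin n) F)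
      (((leftInvDer (s + ν) : Module.End F (MvPolynomial (Fin n × Fin n) F)) ^ k) f) = 0)
    {R : Type*} [CommRing R] [Algebra F R] (θ : Multiplicative M →* R) :
    evalAt (Q.map (algebraMap F R) * Matrix.diagonal (fun l => θ (Multiplicative.ofAdd (d l))) *
      Q'.map (algebraMap F R)) f = 0 := by
  classical
  -- `E₁` forgets the grading, so `f` is the sum of its weight components. `E₂` evaluates the
  -- components at the identity and weights them by `θ`, which gives the value of `f` at the torus
  -- point.
  let E₁ : AddMonoidAlgebra (MvPolynomial (Fin n × Fin n) F) M →ₐ[F]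
      MvPolynomial (Fin n × Fin n) F :=
    AddMonoidAlgebra.liftNCAlgHom (AlgHom.id F _) 1 fun _ _ => Commute.all _ _
  let E₂ : AddMonoidAlgebra (MvPolynomial (Fin n × Fin n) F) M →ₐ[F] R :=
    AddMonoidAlgebra.liftNCAlgHom (((Algebra.ofId F R)).comp
      (evalAt (1 : Matrix (Fin n) (Fin n) F))) θ fun _ _ => Commute.all _ _
  have hE₁s : ∀ m p, E₁ (AddMonoidAlgebra.single m p) = p := fun m p => by
    simp [E₁]
  have hE₂s : ∀ m p, E₂ (AddMonoidAlgebra.single m p) =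
      algebraMap F R (evalAt (1 : Matrix (Fin n) (Fin n) F) p) * θ (Multiplicative.ofAdd m) :=
    fun m p => by
      simp only [E₂, AddMonoidAlgebra.coe_liftNCAlgHom]
      exact AddMonoidAlgebra.liftNC_single _ _ _ _
  have hE₁ : E₁.comp (weightHom Q Q' d) = AlgHom.id F _ := by
    apply MvPolynomial.algHom_ext
    rintro ⟨i, j⟩
    rw [AlgHom.comp_apply, weightHom_X, map_sum]
    simp only [hE₁s]
    have : (Matrix.mvPolynomialX (Fin n) (Fin n) F * Q.map (C (σ := Fin n × Fin n)) *
        Q'.map (C (σ := Fin n × Fin n))) i j = X (i, j) := by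
      rw [mul_assoc, ← Matrix.map_mul, hQ, Matrix.map_one C (map_zero C) (map_one C), mul_one]
      rfl
    rw [AlgHom.id_apply, ← this, Matrix.mul_apply]
    rfl
  have hE₂ : E₂.comp (weightHom Q Q' d) = evalAt (Q.map (algebraMap F R) *
      Matrix.diagonal (fun l => θ (Multiplicative.ofAdd (d l))) * Q'.map (algebraMap F R)) := by
    apply MvPolynomial.algHom_ext
    rintro ⟨i, j⟩
    rw [AlgHom.comp_apply, weightHom_X, map_sum, evalAt_X, Matrix.mul_apply]
    refine Finset.sum_congr rfl fun l _ => ?_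
    have h1 : evalAt (1 : Matrix (Fin n) (Fin n) F)
        ((Matrix.mvPolynomialX (Fin n) (Fin n) F * Q.map (C (σ := Fin n × Fin n))) i l) = Q i l := by
      rw [Matrix.mul_apply, map_sum]
      simp [evalAt_X, Matrix.one_apply]
    rw [hE₂s, map_mul, h1, evalAt_C, map_mul, Matrix.mul_diagonal]
    simp only [Matrix.map_apply, Algebra.algebraMap_self, RingHom.id_apply]
    ring
  obtain ⟨Ψ, hΨ⟩ : ∃ Ψ, Ψ = weightHom Q Q' d f := ⟨_, rfl⟩
  have hdec : ∑ m ∈ Ψ.coeff.support, AddMonoidAlgebra.single m (Ψ.coeff m) = Ψ := by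
    apply AddMonoidAlgebra.coeff_injective
    rw [AddMonoidAlgebra.coeff_sum]
    simp only [AddMonoidAlgebra.coeff_single]
    exact Finsupp.sum_single Ψ.coeff
  have hfsum : ∑ m ∈ Ψ.coeff.support, Ψ.coeff m = f := by
    have h1 : E₁ Ψ = f := by
      rw [hΨ]
      exact DFunLike.congr_fun hE₁ f
    rw [← hdec, map_sum] at h1
    simpa only [hE₁s, hdec] using h1
  -- The polynomials whose derivatives along `X` all vanish at `1` form a stable subspace. Hence it
  -- contains the weight components of `f` along with `f`, and each component vanishes at `1`.
  let p : Submodule F (MvPolynomial (Fin n × Fin n) F) :=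
    ⨅ k : ℕ, LinearMap.ker ((evalAt (1 : Matrix (Fin n) (Fin n) F)).toLinearMap ∘ₗ
      ((leftInvDer (s + ν) : Module.End F (MvPolynomial (Fin n × Fin n) F)) ^ k))
  have hp : ∀ v, v ∈ p ↔ ∀ k : ℕ, evalAt (1 : Matrix (Fin n) (Fin n) F)
      (((leftInvDer (s + ν) : Module.End F (MvPolynomial (Fin n × Fin n) F)) ^ k) v) = 0 :=
    fun v => by simp [p]
  have hmem : ∀ m ∈ Ψ.coeff.support, Ψ.coeff m ∈ p := by
    intro m hm
    have hu : ∀ m, Ψ.coeff m ∈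
        Module.End.maxGenEigenspace (leftInvDer (s + ν) : Module.End F _) (ι m) := by
      rw [hΨ]
      exact coeff_weightHom_mem ι hsQ hcomm hν f
    have hstab : ∀ v ∈ p,
        (leftInvDer (s + ν) : Module.End F (MvPolynomial (Fin n × Fin n) F)) v ∈ p := by
      intro v hv
      rw [hp] at hv ⊢
      intro k
      rw [← Module.End.mul_apply, ← pow_succ]
      exact hv (k + 1)
    have hs : ∑ m ∈ Ψ.coeff.support, Ψ.coeff m ∈ p := by
      rw [hfsum, hp]
      exact hf
    exact mem_of_sum_mem_of_maxGenEigenspace _ _ hstab hι _ _ hu hs hm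
  rw [← hE₂, AlgHom.comp_apply, ← hΨ, ← hdec, map_sum]
  refine Finset.sum_eq_zero fun m hm => ?_
  have h1 : evalAt (1 : Matrix (Fin n) (Fin n) F) (Ψ.coeff m) = 0 := (hp _).1 (hmem m hm) 0
  rw [hE₂s, h1, map_zero, zero_mul]

theorem evalAt_one_leftInvDer_pow_eq_zero {Γ : Subgroup (GL (Fin n) F)}
    {X : Matrix (Fin n) (Fin n) F} (hX : X ∈ tangentSpace Γ)
    {f : MvPolynomial (Fin n × Fin n) F} (hf : f ∈ groupIdeal Γ) (k : ℕ) :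
    evalAt (1 : Matrix (Fin n) (Fin n) F)
      (((leftInvDer X : Module.End F (MvPolynomial (Fin n × Fin n) F)) ^ k) f) = 0 := by
  induction k generalizing f with
  | zero => exact evalAt_one_of_mem hf
  | succ k ih =>
    rw [pow_succ, Module.End.mul_apply]
    exact ih (leftInvDer_mem_groupIdeal hX hf)

theorem evalAt_dualNumber (X : Matrix (Fin n) (Fin n) F) (f : MvPolynomial (Fin n × Fin n) F) :
    (evalAt ((1 : Matrix (Fin n) (Fin n) F).map (algebraMap F (DualNumber F)) +
      X.map (TrivSqZeroExt.inr : F → DualNumber F)) f).snd = dirDeriv f 1 X := by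
  have hfst : ∀ f : MvPolynomial (Fin n × Fin n) F,
      (evalAt ((1 : Matrix (Fin n) (Fin n) F).map (algebraMap F (DualNumber F)) +
        X.map (TrivSqZeroExt.inr : F → DualNumber F)) f).fst =
          evalAt (1 : Matrix (Fin n) (Fin n) F) f := by
    intro f
    have h := algHom_evalAt (TrivSqZeroExt.fstHom F F F)
      ((1 : Matrix (Fin n) (Fin n) F).map (algebraMap F (DualNumber F)) +
        X.map (TrivSqZeroExt.inr : F → DualNumber F)) f
    rw [TrivSqZeroExt.fstHom_apply] at h
    rw [h]
    refine congrArg (fun M => evalAt M f) (Matrix.ext fun i j => ?_)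
    simp [Matrix.one_apply, TrivSqZeroExt.algebraMap_eq_inl, apply_ite]
  induction f using MvPolynomial.induction_on with
  | C c =>
    rw [evalAt_C, dirDeriv_C, TrivSqZeroExt.algebraMap_eq_inl]
    simp
  | add p q hp hq =>
    rw [map_add, TrivSqZeroExt.snd_add, hp, hq, ← dirDerivₗ_apply, ← dirDerivₗ_apply,
      ← dirDerivₗ_apply, map_add]
  | mul_X p ij hp =>
    rw [map_mul, TrivSqZeroExt.snd_mul, hp, dirDeriv_mul, hfst, hfst, evalAt_X]
    simp only [Matrix.add_apply, Matrix.map_apply, TrivSqZeroExt.snd_add, dirDeriv_X,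
      TrivSqZeroExt.algebraMap_eq_inl, TrivSqZeroExt.snd_inl, TrivSqZeroExt.snd_inr, zero_add,
      smul_eq_mul, MulOpposite.smul_eq_mul_unop, MulOpposite.unop_op, evalAt_X]
    ring

/-- Additive functions of the semisimple part of an element of the Lie algebra lie in the Lie
algebra. -/
theorem diagonal_mem_tangentSpace {Γ : Subgroup (GL (Fin n) F)}
    {s ν Q Q' : Matrix (Fin n) (Fin n) F} {d : Fin n → F} (hQ : Q * Q' = 1)
    (hsQ : s * Q = Q * Matrix.diagonal d) (hcomm : s * ν = ν * s)
    (hν : IsNilpotent ν) (hX : s + ν ∈ tangentSpace Γ) (θ : F →+ F) :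
    Q * Matrix.diagonal (fun l => θ (d l)) * Q' ∈ tangentSpace Γ := by
  intro f hf
  -- An additive map `θ` is the same as a character `1 + εθ`. Its torus point is `1 + εY`, where `Y`
  -- is the matrix in question, so vanishing of `f` there says that its derivative in direction `Y`
  -- is zero.
  let ψ : Multiplicative F →* DualNumber F :=
    { toFun := fun x => 1 + TrivSqZeroExt.inr (θ x.toAdd)
      map_one' := by simp
      map_mul' := fun x y => by
        ext <;> simp [add_comm] }
  have h := evalAt_torus_eq_zero (AddMonoidHom.id F) Function.injective_id hQ hsQ hcomm hν
    (evalAt_one_leftInvDer_pow_eq_zero hX hf) ψ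
  rw [← evalAt_dualNumber]
  rw [show (1 : Matrix (Fin n) (Fin n) F).map (algebraMap F (DualNumber F)) +
      (Q * Matrix.diagonal (fun l => θ (d l)) * Q').map (TrivSqZeroExt.inr : F → DualNumber F) =
      Q.map (algebraMap F (DualNumber F)) *
        Matrix.diagonal (fun l => ψ (Multiplicative.ofAdd (d l))) *
        Q'.map (algebraMap F (DualNumber F)) from ?_, h, TrivSqZeroExt.snd_zero]
  rw [← hQ]
  ext i j
  · simp [Matrix.mul_apply, TrivSqZeroExt.fst_sum, Matrix.diagonal_apply, ψ,
      TrivSqZeroExt.algebraMap_eq_inl]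
  · simp [Matrix.mul_apply, TrivSqZeroExt.snd_sum, Matrix.diagonal_apply, ψ,
      TrivSqZeroExt.algebraMap_eq_inl, apply_ite, mul_comm]

end Tori

end

noncomputable section

/-! ## Nilpotent matrices and Jordan decompositions -/

section NilpotentMatrices

variable {F : Type*} [Field F]

/-- Let `e` be the projection onto the Fitting component on which `b` is invertible. It is a
polynomial in `b` without constant term, hence of trace zero, and in characteristic zero an
idempotent of trace zero is zero. -/
theorem isNilpotent_of_trace_pow_eq_zero [CharZero F] {m : Type*} [Fintype m] [DecidableEq m]
    {b : Matrix m m F} (hb : ∀ k, 0 < k → (b ^ k).trace = 0) : IsNilpotent b := by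
  obtain ⟨q, hq, hq0⟩ := Polynomial.exists_eq_pow_rootMultiplicity_mul_and_not_dvd b.charpoly
    b.charpoly_monic.ne_zero (0 : F)
  set k := b.charpoly.rootMultiplicity 0
  rw [Polynomial.C_0, sub_zero] at hq hq0
  -- The exponent is `k + 1` instead of `k` so that only positive powers of `b` occur in `e` even
  -- when `k = 0`.
  have hcop : IsCoprime ((Polynomial.X : Polynomial F) ^ (k + 1)) q :=
    ((Polynomial.irreducible_X.coprime_iff_not_dvd).2 hq0).pow_left
  obtain ⟨u, v, huv⟩ := hcop
  have hzero : Polynomial.aeval b (Polynomial.X ^ (k + 1) * q) = 0 := by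
    rw [pow_succ', mul_assoc, ← hq, map_mul, Matrix.aeval_self_charpoly, mul_zero]
  set e := Polynomial.aeval b (u * Polynomial.X ^ (k + 1)) with he
  have hidem : e * e = e := by
    have : e * (Polynomial.aeval b (v * q)) = 0 := by
      rw [he, ← map_mul, show u * Polynomial.X ^ (k + 1) * (v * q) =
        (u * v) * (Polynomial.X ^ (k + 1) * q) by ring, map_mul, hzero, mul_zero]
    have h1 : Polynomial.aeval b (v * q) = 1 - e := by
      rw [eq_sub_iff_add_eq, he, ← map_add, add_comm, huv, map_one]
    rw [h1, mul_sub, mul_one, sub_eq_zero] at this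
    exact this.symm
  have htr : e.trace = 0 := by
    rw [he, map_mul, map_pow, Polynomial.aeval_X, Polynomial.aeval_eq_sum_range, Finset.sum_mul,
      Matrix.trace_sum]
    refine Finset.sum_eq_zero fun i _ => ?_
    rw [smul_mul_assoc, ← pow_add, Matrix.trace_smul, hb _ (by omega), smul_zero]
  have he0 : e = 0 := by
    have h1 : IsIdempotentElem (Matrix.toLin' e) := by
      rw [IsIdempotentElem, Module.End.mul_eq_comp, ← Matrix.toLin'_mul, hidem]
    have h2 := LinearMap.IsIdempotentElem.eq_zero_of_trace_eq_zero h1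
      (by rw [Matrix.trace_toLin'_eq, htr])
    simpa using h2
  refine ⟨k + 1, ?_⟩
  have h1 : Polynomial.aeval b (v * q) = 1 := by
    rw [← add_zero (Polynomial.aeval b (v * q)), ← he0, he, ← map_add, add_comm, huv, map_one]
  calc b ^ (k + 1) = b ^ (k + 1) * Polynomial.aeval b (v * q) := by rw [h1, mul_one]
    _ = Polynomial.aeval b (v * (Polynomial.X ^ (k + 1) * q)) := by
      rw [mul_left_comm, map_mul _ (_ ^ _), map_pow, Polynomial.aeval_X]
    _ = 0 := by rw [map_mul, hzero, mul_zero]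

/-- Engel's theorem: the lower central series of the module of column vectors reaches zero, and its
`k`-th term contains the image of every product of `k` elements of `p`. -/
theorem exists_pow_eq_bot_of_isNilpotent {m : Type*} [Fintype m] [DecidableEq m]
    (p : Submodule F (Matrix m m F)) (hlie : ∀ x ∈ p, ∀ y ∈ p, x * y - y * x ∈ p)
    (hnil : ∀ x ∈ p, IsNilpotent x) : ∃ k : ℕ, p ^ k = ⊥ := by
  let _ : LieRing (Module.End F (m → F)) := LieRing.ofAssociativeRing
  let L : LieSubalgebra F (Module.End F (m → F)) :=
    { p.map (Matrix.toLin' : Matrix m m F ≃ₗ[F] _).toLinearMap with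
      lie_mem' := by
        rintro _ _ ⟨x, hx, rfl⟩ ⟨y, hy, rfl⟩
        refine ⟨x * y - y * x, hlie x hx y hy, ?_⟩
        simp [Matrix.toLin'_mul, LieRing.of_associative_ring_bracket, Module.End.mul_eq_comp] }
  have hL : LieModule.IsNilpotent L (m → F) := by
    rw [LieModule.isNilpotent_iff_forall' (R := F)]
    rintro ⟨_, ⟨x, hx, rfl⟩⟩
    obtain ⟨k, hk⟩ := hnil x hx
    refine ⟨k, ?_⟩
    change (Matrix.toLin' x) ^ k = 0
    rw [← Matrix.toLin'_pow, hk, map_zero]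
  obtain ⟨k, hk⟩ := (LieModule.isNilpotent_iff F L (m → F)).1 hL
  refine ⟨k, ?_⟩
  have key : ∀ (k : ℕ), ∀ y ∈ p ^ k, ∀ v : m → F,
      Matrix.toLin' y v ∈ LieModule.lowerCentralSeries F L (m → F) k := by
    intro k
    induction k with
    | zero =>
      intro y _ v
      rw [LieModule.lowerCentralSeries_zero]
      trivial
    | succ k ih =>
      intro y hy v
      rw [pow_succ'] at hy
      induction hy using Submodule.mul_induction_on' with
      | mem_mul_mem x hx z hz =>
        rw [Matrix.toLin'_mul_apply, LieModule.lowerCentralSeries_succ]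
        exact LieSubmodule.lie_mem_lie (LieSubmodule.mem_top (⟨_, ⟨x, hx, rfl⟩⟩ : L)) (ih z hz v)
      | add x hx z hz h1 h2 =>
        rw [map_add, LinearMap.add_apply]
        exact add_mem h1 h2
  rw [eq_bot_iff]
  intro y hy
  have h1 : Matrix.toLin' y = 0 := by
    refine LinearMap.ext fun v => ?_
    have := key k y hy v
    rw [hk] at this
    simpa using this
  simpa using h1

/-- Collecting the factors `h` on the right, `(xh)^i` becomes a product of `i` conjugates of `x`,
all in `p`, times `h^i`. -/
theorem isNilpotent_mul_of_conj_mem {m : Type*} [Fintype m] [DecidableEq m]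
    (p : Submodule F (Matrix m m F)) {k : ℕ} (hk : p ^ k = ⊥) {h h' : Matrix m m F}
    (hh : h' * h = 1) (hp : ∀ x ∈ p, h * x * h' ∈ p) {x : Matrix m m F} (hx : x ∈ p) :
    IsNilpotent (x * h) := by
  have hconj : ∀ i : ℕ, ∀ x ∈ p, h ^ i * x * h' ^ i ∈ p := by
    intro i
    induction i with
    | zero => simp
    | succ i ih =>
      intro x hx
      rw [pow_succ, pow_succ', show h ^ i * h * x * (h' * h' ^ i) =
        h ^ i * (h * x * h') * h' ^ i by simp only [mul_assoc]]
      exact ih _ (hp x hx)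
  have hh' : ∀ i : ℕ, h' ^ i * h ^ i = 1 := by
    intro i
    induction i with
    | zero => simp
    | succ i ih =>
      rw [pow_succ, pow_succ', mul_assoc, ← mul_assoc h', hh, one_mul, ih]
  have key : ∀ i : ℕ, ∃ y ∈ p ^ i, (x * h) ^ i = y * h ^ i := by
    intro i
    induction i with
    | zero => exact ⟨1, by rw [pow_zero]; exact Submodule.one_le.1 le_rfl, by simp⟩
    | succ i ih =>
      obtain ⟨y, hy, he⟩ := ih
      refine ⟨y * (h ^ i * x * h' ^ i), ?_, ?_⟩
      · rw [pow_succ]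
        exact Submodule.mul_mem_mul hy (hconj i x hx)
      · rw [pow_succ, he, pow_succ h]
        calc y * h ^ i * (x * h) = y * (h ^ i * x * 1) * h := by simp only [mul_assoc, one_mul]
          _ = _ := by
            rw [← hh' i]
            simp only [mul_assoc]
  obtain ⟨y, hy, he⟩ := key k
  rw [hk, Submodule.mem_bot] at hy
  exact ⟨k, by rw [he, hy, zero_mul]⟩

theorem Module.End.IsSemisimple.exists_basis [IsAlgClosed F] {m : Type*} [Fintype m]
    {s : Module.End F (m → F)} (hs : s.IsSemisimple) :
    ∃ (w : Module.Basis m F (m → F)) (d : m → F), ∀ i, s (w i) = d i • w i := by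
  classical
  have dec := DirectSum.isInternal_submodule_of_iSupIndep_of_iSup_eq_top
    s.eigenspaces_iSupIndep hs.iSup_eigenspace_eq_top
  obtain ⟨κ, v, c, hv⟩ : ∃ (κ : Type _) (v : Module.Basis κ F (m → F)) (c : κ → F),
      ∀ i, s (v i) = c i • v i :=
    ⟨_, dec.collectedBasis fun μ => Module.finBasis F (s.eigenspace μ), Sigma.fst, fun i =>
      Module.End.mem_eigenspace_iff.1 (dec.collectedBasis_mem _ i)⟩
  let e := (Pi.basisFun F m).indexEquiv v
  refine ⟨v.reindex e.symm, fun i => c (e i), fun i => ?_⟩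
  rw [Module.Basis.reindex_apply, Equiv.symm_symm, hv]

theorem Matrix.exists_jordan_decomposition [CharZero F] [IsAlgClosed F] {m : Type*} [Fintype m]
    [DecidableEq m] (X : Matrix m m F) :
    ∃ (Q Q' ν : Matrix m m F) (d : m → F), Q * Q' = 1 ∧
      X = Q * Matrix.diagonal d * Q' + ν ∧
      Q * Matrix.diagonal d * Q' * ν = ν * (Q * Matrix.diagonal d * Q') ∧ IsNilpotent ν := by
  obtain ⟨ν, hν_adj, s, hs_adj, hν_nil, hs_ss, hX⟩ :=
    Module.End.exists_isNilpotent_isSemisimple (f := Matrix.toLin' X)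
  have hcomm : Commute ν s :=
    Algebra.commute_of_mem_adjoin_singleton_of_commute hs_adj
      (Algebra.commute_of_mem_adjoin_self hν_adj).symm
  obtain ⟨w, d, hw⟩ := hs_ss.exists_basis
  have hs : LinearMap.toMatrix w w s = Matrix.diagonal d := by
    ext i j
    rw [LinearMap.toMatrix_apply, hw, map_smul, Module.Basis.repr_self, Finsupp.smul_single,
      Matrix.diagonal_apply, Finsupp.single_apply, smul_eq_mul, mul_one]
    split_ifs with h1 h2 h2
    · rw [h1]
    · exact (h2 h1.symm).elim
    · exact (h1 h2.symm).elim
    · rfl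
  have hQs : (Pi.basisFun F m).toMatrix w * Matrix.diagonal d *
      w.toMatrix (Pi.basisFun F m) = LinearMap.toMatrix' s := by
    rw [← hs, basis_toMatrix_mul_linearMap_toMatrix_mul_basis_toMatrix]
    rfl
  refine ⟨(Pi.basisFun F m).toMatrix w, w.toMatrix (Pi.basisFun F m), LinearMap.toMatrix' ν,
    d, Module.Basis.toMatrix_mul_toMatrix_flip _ _, ?_, ?_, ?_⟩
  · rw [hQs, ← map_add, add_comm, ← hX, LinearMap.toMatrix'_toLin']
  · rw [hQs, ← LinearMap.toMatrix'_mul, ← LinearMap.toMatrix'_mul, hcomm.eq]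
  · obtain ⟨k, hk⟩ := hν_nil
    refine ⟨k, ?_⟩
    have h1 := map_pow (LinearMap.toMatrixAlgEquiv' : _ ≃ₐ[F] Matrix m m F) ν k
    rw [hk, map_zero] at h1
    exact h1.symm

end NilpotentMatrices

end

noncomputable section

open MvPolynomial

/-! ## The linear span of a group of matrices and its trace radical -/

section TraceRadical

open LinearAlgebraicGroup

variable {F : Type*} [Field F] {n : ℕ} (Γ : Subgroup (GL (Fin n) F))

/-- The algebra spanned by a group of matrices. -/
def matrixSpan : Subalgebra F (Matrix (Fin n) (Fin n) F) :=
  Algebra.adjoin F (Γ.toSubmonoid.map (Units.coeHom (Matrix (Fin n) (Fin n) F)) : Set _)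

variable {Γ}

theorem coe_mem_matrixSpan {g : GL (Fin n) F} (hg : g ∈ Γ) :
    (g : Matrix (Fin n) (Fin n) F) ∈ matrixSpan Γ :=
  Algebra.subset_adjoin ⟨g, hg, rfl⟩

theorem matrixSpan_le {p : Submodule F (Matrix (Fin n) (Fin n) F)}
    (hp : ∀ g ∈ Γ, (g : Matrix (Fin n) (Fin n) F) ∈ p) {x : Matrix (Fin n) (Fin n) F}
    (hx : x ∈ matrixSpan Γ) : x ∈ p := by
  rw [← Subalgebra.mem_toSubmodule, matrixSpan, Algebra.adjoin_eq_span,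
    Submonoid.closure_eq] at hx
  refine Submodule.span_le.2 ?_ hx
  rintro _ ⟨g, hg, rfl⟩
  exact hp g hg

variable (Γ)

/-- The radical of the trace form on the algebra spanned by a group of matrices. -/
def traceRadical : Submodule F (Matrix (Fin n) (Fin n) F) where
  carrier := {b | b ∈ matrixSpan Γ ∧ ∀ x ∈ matrixSpan Γ, (b * x).trace = 0}
  zero_mem' := ⟨zero_mem _, by simp⟩
  add_mem' := fun ha hb => ⟨add_mem ha.1 hb.1, fun x hx => by
    rw [add_mul, Matrix.trace_add, ha.2 x hx, hb.2 x hx, add_zero]⟩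
  smul_mem' := fun c b hb => ⟨Subalgebra.smul_mem _ hb.1 c, fun x hx => by
    rw [smul_mul_assoc, Matrix.trace_smul, hb.2 x hx, smul_zero]⟩

variable {Γ}

theorem mem_traceRadical {b : Matrix (Fin n) (Fin n) F} (hb : b ∈ matrixSpan Γ)
    (h : ∀ g ∈ Γ, (b * (g : Matrix (Fin n) (Fin n) F)).trace = 0) : b ∈ traceRadical Γ := by
  refine ⟨hb, fun x hx => ?_⟩
  exact matrixSpan_le (p := LinearMap.ker (Matrix.traceLinearMap (Fin n) F F ∘ₗ
    LinearMap.mulLeft F b)) (fun g hg => h g hg) hx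

theorem mul_mem_traceRadical {b x : Matrix (Fin n) (Fin n) F} (hb : b ∈ traceRadical Γ)
    (hx : x ∈ matrixSpan Γ) : b * x ∈ traceRadical Γ :=
  ⟨mul_mem hb.1 hx, fun y hy => by rw [mul_assoc]; exact hb.2 _ (mul_mem hx hy)⟩

theorem mul_mem_traceRadical' {b x : Matrix (Fin n) (Fin n) F} (hb : b ∈ traceRadical Γ)
    (hx : x ∈ matrixSpan Γ) : x * b ∈ traceRadical Γ :=
  ⟨mul_mem hx hb.1, fun y hy => by
    rw [mul_assoc, Matrix.trace_mul_comm, mul_assoc]; exact hb.2 _ (mul_mem hy hx)⟩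

theorem isNilpotent_of_mem_traceRadical [CharZero F] {b : Matrix (Fin n) (Fin n) F}
    (hb : b ∈ traceRadical Γ) : IsNilpotent b := by
  refine isNilpotent_of_trace_pow_eq_zero fun k hk => ?_
  obtain ⟨k, rfl⟩ := Nat.exists_eq_succ_of_ne_zero hk.ne'
  rw [Nat.succ_eq_add_one, pow_succ']
  exact hb.2 _ (pow_mem hb.1 k)

theorem exists_traceRadical_pow_eq_bot [CharZero F] (Γ : Subgroup (GL (Fin n) F)) :
    ∃ k : ℕ, traceRadical Γ ^ k = ⊥ :=
  exists_pow_eq_bot_of_isNilpotent _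
    (fun _ hx _ hy => sub_mem (mul_mem_traceRadical hx hy.1) (mul_mem_traceRadical hy hx.1))
    fun _ hx => isNilpotent_of_mem_traceRadical hx

theorem traceRadical_pow_succ_le (k : ℕ) : traceRadical Γ ^ (k + 1) ≤ traceRadical Γ := by
  induction k with
  | zero => rw [zero_add, pow_one]
  | succ k ih =>
    rw [pow_succ]
    exact Submodule.mul_le.2 fun x hx y hy => mul_mem_traceRadical (ih hx) hy.1

theorem mul_mem_traceRadical_pow {k : ℕ} {b x : Matrix (Fin n) (Fin n) F}
    (hb : b ∈ traceRadical Γ ^ (k + 1)) (hx : x ∈ matrixSpan Γ) :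
    b * x ∈ traceRadical Γ ^ (k + 1) := by
  rw [pow_succ] at hb ⊢
  induction hb using Submodule.mul_induction_on' with
  | mem_mul_mem y hy z hz =>
    rw [mul_assoc]
    exact Submodule.mul_mem_mul hy (mul_mem_traceRadical hz hx)
  | add y _ z _ h1 h2 =>
    rw [add_mul]
    exact add_mem h1 h2

theorem mul_mem_traceRadical_pow' {k : ℕ} {b x : Matrix (Fin n) (Fin n) F}
    (hb : b ∈ traceRadical Γ ^ (k + 1)) (hx : x ∈ matrixSpan Γ) :
    x * b ∈ traceRadical Γ ^ (k + 1) := by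
  rw [pow_succ'] at hb ⊢
  induction hb using Submodule.mul_induction_on' with
  | mem_mul_mem y hy z hz =>
    rw [← mul_assoc]
    exact Submodule.mul_mem_mul (mul_mem_traceRadical' hy hx) hz
  | add y _ z _ h1 h2 =>
    rw [mul_add]
    exact add_mem h1 h2

variable (Γ)

/-- The elements of `Γ` congruent to `1` modulo the `(k+1)`-st power of the trace radical. -/
def congruenceSubgroup (k : ℕ) : Subgroup (GL (Fin n) F) where
  carrier := {g | g ∈ Γ ∧ (g : Matrix (Fin n) (Fin n) F) - 1 ∈ traceRadical Γ ^ (k + 1)}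
  one_mem' := ⟨one_mem Γ, by simp⟩
  mul_mem' := fun {g h} hg hh => ⟨mul_mem hg.1 hh.1, by
    have : ((g * h : GL (Fin n) F) : Matrix (Fin n) (Fin n) F) - 1 =
        (g : Matrix (Fin n) (Fin n) F) * ((h : Matrix (Fin n) (Fin n) F) - 1) +
          ((g : Matrix (Fin n) (Fin n) F) - 1) := by
      rw [Units.val_mul, mul_sub, mul_one, sub_add_sub_cancel]
    rw [this]
    exact add_mem (mul_mem_traceRadical_pow' hh.2 (coe_mem_matrixSpan hg.1)) hg.2⟩
  inv_mem' := fun {g} hg => ⟨inv_mem hg.1, by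
    have : ((g⁻¹ : GL (Fin n) F) : Matrix (Fin n) (Fin n) F) - 1 =
        -(((g⁻¹ : GL (Fin n) F) : Matrix (Fin n) (Fin n) F) *
          ((g : Matrix (Fin n) (Fin n) F) - 1)) := by
      rw [mul_sub, mul_one, neg_sub, ← Units.val_mul, inv_mul_cancel, Units.val_one]
    rw [this]
    exact neg_mem (mul_mem_traceRadical_pow' hg.2 (coe_mem_matrixSpan (inv_mem hg.1)))⟩

/-- The elements of `Γ` that are central modulo the trace radical. -/
def centralModRadical : Subgroup (GL (Fin n) F) where
  carrier := {g | g ∈ Γ ∧ ∀ x ∈ matrixSpan Γ,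
    (g : Matrix (Fin n) (Fin n) F) * x - x * (g : Matrix (Fin n) (Fin n) F) ∈ traceRadical Γ}
  one_mem' := ⟨one_mem Γ, by simp⟩
  mul_mem' := fun {g h} hg hh => ⟨mul_mem hg.1 hh.1, fun x hx => by
    have : ((g * h : GL (Fin n) F) : Matrix (Fin n) (Fin n) F) * x -
        x * ((g * h : GL (Fin n) F) : Matrix (Fin n) (Fin n) F) =
        (g : Matrix (Fin n) (Fin n) F) *
          ((h : Matrix (Fin n) (Fin n) F) * x - x * (h : Matrix (Fin n) (Fin n) F)) +
        ((g : Matrix (Fin n) (Fin n) F) * x - x * (g : Matrix (Fin n) (Fin n) F)) *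
          (h : Matrix (Fin n) (Fin n) F) := by
      rw [Units.val_mul]
      noncomm_ring
    rw [this]
    exact add_mem (mul_mem_traceRadical' (hh.2 x hx) (coe_mem_matrixSpan hg.1))
      (mul_mem_traceRadical (hg.2 x hx) (coe_mem_matrixSpan hh.1))⟩
  inv_mem' := fun {g} hg => ⟨inv_mem hg.1, fun x hx => by
    have : ((g⁻¹ : GL (Fin n) F) : Matrix (Fin n) (Fin n) F) * x -
        x * ((g⁻¹ : GL (Fin n) F) : Matrix (Fin n) (Fin n) F) =
        -(((g⁻¹ : GL (Fin n) F) : Matrix (Fin n) (Fin n) F) *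
          ((g : Matrix (Fin n) (Fin n) F) * x - x * (g : Matrix (Fin n) (Fin n) F)) *
          ((g⁻¹ : GL (Fin n) F) : Matrix (Fin n) (Fin n) F)) := by
      have h1 : ((g⁻¹ : GL (Fin n) F) : Matrix (Fin n) (Fin n) F) *
        (g : Matrix (Fin n) (Fin n) F) = 1 := by
          rw [← Units.val_mul, inv_mul_cancel, Units.val_one]
      have h2 : (g : Matrix (Fin n) (Fin n) F) *
        ((g⁻¹ : GL (Fin n) F) : Matrix (Fin n) (Fin n) F) = 1 := by
          rw [← Units.val_mul, mul_inv_cancel, Units.val_one]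
      rw [mul_sub, ← mul_assoc, h1, one_mul, sub_mul, mul_assoc, mul_assoc, h2, mul_one, neg_sub]
    rw [this]
    have hi := coe_mem_matrixSpan (inv_mem hg.1)
    exact neg_mem (mul_mem_traceRadical (mul_mem_traceRadical' (hg.2 x hx) hi) hi)⟩

variable {Γ}

theorem val_commutator_sub_one (g h : GL (Fin n) F) :
    ((g * h * g⁻¹ * h⁻¹ : GL (Fin n) F) : Matrix (Fin n) (Fin n) F) - 1 =
      ((g : Matrix (Fin n) (Fin n) F) * (h : Matrix (Fin n) (Fin n) F) -
        (h : Matrix (Fin n) (Fin n) F) * (g : Matrix (Fin n) (Fin n) F)) *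
        ((g⁻¹ * h⁻¹ : GL (Fin n) F) : Matrix (Fin n) (Fin n) F) := by
  rw [sub_mul, ← Units.val_mul, ← Units.val_mul, ← Units.val_mul, ← Units.val_mul,
    ← Units.val_one]
  congr 2 <;> group

/-- Let `J` be the trace radical. Commutators of elements central modulo `J` lie in `1 + J`, and `gh
- hg = (g-1)(h-1) - (h-1)(g-1)` then pushes each further derived subgroup one power of `J` deeper.
Since `J` is nilpotent, the series ends. -/
theorem isSolvable_of_le_centralModRadical [CharZero F] {H : Subgroup (GL (Fin n) F)}
    (hH : H ≤ centralModRadical Γ) : Group.IsSolvable H := by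
  have key : ∀ k, (derivedSeries H (k + 1)).map H.subtype ≤ congruenceSubgroup Γ k := by
    intro k
    induction k with
    | zero =>
      rw [derivedSeries_succ, Subgroup.map_commutator, Subgroup.commutator_le]
      rintro _ ⟨g, -, rfl⟩ _ ⟨h, -, rfl⟩
      have hg := hH g.2
      have hh := hH h.2
      rw [commutatorElement_def]
      refine ⟨mul_mem (mul_mem (mul_mem hg.1 hh.1) (inv_mem hg.1)) (inv_mem hh.1), ?_⟩
      rw [zero_add, pow_one]
      refine (val_commutator_sub_one (g : GL (Fin n) F) h).symm ▸ ?_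
      exact mul_mem_traceRadical (hg.2 _ (coe_mem_matrixSpan hh.1))
        (coe_mem_matrixSpan (mul_mem (inv_mem hg.1) (inv_mem hh.1)))
    | succ k ih =>
      rw [derivedSeries_succ, Subgroup.map_commutator]
      refine (Subgroup.commutator_mono ih ih).trans (Subgroup.commutator_le.2 ?_)
      intro g hg h hh
      rw [commutatorElement_def]
      refine ⟨mul_mem (mul_mem (mul_mem hg.1 hh.1) (inv_mem hg.1)) (inv_mem hh.1), ?_⟩
      rw [val_commutator_sub_one]
      refine mul_mem_traceRadical_pow ?_
        (coe_mem_matrixSpan (mul_mem (inv_mem hg.1) (inv_mem hh.1)))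
      have : (g : Matrix (Fin n) (Fin n) F) * (h : Matrix (Fin n) (Fin n) F) -
          (h : Matrix (Fin n) (Fin n) F) * (g : Matrix (Fin n) (Fin n) F) =
          ((g : Matrix (Fin n) (Fin n) F) - 1) * ((h : Matrix (Fin n) (Fin n) F) - 1) -
          ((h : Matrix (Fin n) (Fin n) F) - 1) * ((g : Matrix (Fin n) (Fin n) F) - 1) := by
        noncomm_ring
      rw [this, pow_succ]
      exact sub_mem (Submodule.mul_mem_mul hg.2 (traceRadical_pow_succ_le k hh.2))
        (Submodule.mul_mem_mul hh.2 (traceRadical_pow_succ_le k hg.2))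
  obtain ⟨k, hk⟩ := exists_traceRadical_pow_eq_bot Γ
  rw [Group.isSolvable_def]
  refine ⟨k + 1, (Subgroup.eq_bot_iff_forall _).2 fun x hx => ?_⟩
  have h1 := (key k ⟨x, hx, rfl⟩).2
  rw [pow_succ, hk, Submodule.bot_mul, Submodule.mem_bot, sub_eq_zero] at h1
  exact Subtype.ext (Units.ext h1)

/-- Normal unipotent subgroups are congruent to `1` modulo the trace radical. -/
theorem le_congruenceSubgroup_of_unipotent [CharZero F] {H : Subgroup (GL (Fin n) F)} (hH : H ≤ Γ)
    (hnorm : ∀ g ∈ Γ, ∀ h ∈ H, g * h * g⁻¹ ∈ H)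
    (huni : ∀ h ∈ H, IsNilpotent ((h : Matrix (Fin n) (Fin n) F) - 1)) :
    H ≤ congruenceSubgroup Γ 0 := by
  -- The span of the `h - 1` is closed under products, and the trace vanishes on it. Powers of its
  -- elements therefore have trace zero, so it is a nil algebra and Engel's theorem applies.
  let p : Submodule F (Matrix (Fin n) (Fin n) F) :=
    Submodule.span F {x | ∃ h ∈ H, (h : Matrix (Fin n) (Fin n) F) - 1 = x}
  have hsub : ∀ h ∈ H, (h : Matrix (Fin n) (Fin n) F) - 1 ∈ p :=
    fun h hh => Submodule.subset_span ⟨h, hh, rfl⟩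
  have hmul : p * p ≤ p := by
    rw [Submodule.span_mul_span, Submodule.span_le]
    rintro _ ⟨_, ⟨g, hg, rfl⟩, _, ⟨h, hh, rfl⟩, rfl⟩
    have : ((g : Matrix (Fin n) (Fin n) F) - 1) * ((h : Matrix (Fin n) (Fin n) F) - 1) =
        (((g * h : GL (Fin n) F) : Matrix (Fin n) (Fin n) F) - 1) -
          ((g : Matrix (Fin n) (Fin n) F) - 1) - ((h : Matrix (Fin n) (Fin n) F) - 1) := by
      rw [Units.val_mul]
      noncomm_ring
    change _ * _ ∈ p
    rw [this]
    exact sub_mem (sub_mem (hsub _ (mul_mem hg hh)) (hsub _ hg)) (hsub _ hh)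
  have htr : ∀ x ∈ p, x.trace = 0 := by
    intro x hx
    have : p ≤ LinearMap.ker (Matrix.traceLinearMap (Fin n) F F) := by
      rw [Submodule.span_le]
      rintro _ ⟨h, hh, rfl⟩
      exact (Matrix.isNilpotent_trace_of_isNilpotent (huni h hh)).eq_zero
    exact this hx
  have hpow : ∀ x ∈ p, ∀ k, x ^ (k + 1) ∈ p := by
    intro x hx k
    induction k with
    | zero => simpa using hx
    | succ k ih =>
      rw [pow_succ]
      exact hmul (Submodule.mul_mem_mul ih hx)
  have hnil : ∀ x ∈ p, IsNilpotent x := by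
    intro x hx
    refine isNilpotent_of_trace_pow_eq_zero fun k hk => ?_
    obtain ⟨k, rfl⟩ := Nat.exists_eq_succ_of_ne_zero hk.ne'
    exact htr _ (hpow x hx k)
  obtain ⟨k, hk⟩ := exists_pow_eq_bot_of_isNilpotent p (fun x hx y hy =>
    sub_mem (hmul (Submodule.mul_mem_mul hx hy)) (hmul (Submodule.mul_mem_mul hy hx))) hnil
  intro h hh
  refine ⟨hH hh, ?_⟩
  rw [zero_add, pow_one]
  -- Normality makes `p` stable under conjugation by `g`, so `(h - 1)g` is nilpotent and has trace
  -- zero.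
  refine mem_traceRadical (sub_mem (coe_mem_matrixSpan (hH hh)) (one_mem _)) fun g hg => ?_
  refine (Matrix.isNilpotent_trace_of_isNilpotent (isNilpotent_mul_of_conj_mem p hk
    (h := (g : Matrix (Fin n) (Fin n) F)) (h' := ((g⁻¹ : GL (Fin n) F) : Matrix (Fin n) (Fin n) F))
    (by rw [← Units.val_mul, inv_mul_cancel, Units.val_one]) ?_ (hsub h hh))).eq_zero
  intro x hx
  induction hx using Submodule.span_induction with
  | mem x hx =>
    obtain ⟨h, hh, rfl⟩ := hx
    have : (g : Matrix (Fin n) (Fin n) F) * ((h : Matrix (Fin n) (Fin n) F) - 1) *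
        ((g⁻¹ : GL (Fin n) F) : Matrix (Fin n) (Fin n) F) =
          ((g * h * g⁻¹ : GL (Fin n) F) : Matrix (Fin n) (Fin n) F) - 1 := by
      rw [mul_sub, mul_one, sub_mul, ← Units.val_mul, ← Units.val_mul, ← Units.val_mul,
        mul_inv_cancel, Units.val_one]
    rw [this]
    exact hsub _ (hnorm g hg h hh)
  | zero => simp
  | add x y _ _ h1 h2 =>
    rw [mul_add, add_mul]
    exact add_mem h1 h2
  | smul c x _ h1 =>
    rw [mul_smul_comm, smul_mul_assoc]
    exact Submodule.smul_mem _ c h1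

/-! ### The tangent space and the span -/

/-- The linear form `x ↦ tr (x c)` as a polynomial. -/
def traceForm (c : Matrix (Fin n) (Fin n) F) : MvPolynomial (Fin n × Fin n) F :=
  ∑ i, ∑ j, c j i • X (i, j)

theorem evalAt_traceForm (c M : Matrix (Fin n) (Fin n) F) :
    evalAt M (traceForm c) = (M * c).trace := by
  simp only [traceForm, map_sum, map_smul, evalAt_X, Matrix.trace, Matrix.diag_apply,
    Matrix.mul_apply, smul_eq_mul, mul_comm]

theorem leftInvDer_traceForm (c X : Matrix (Fin n) (Fin n) F) :
    leftInvDer X (traceForm c) = traceForm (X * c) := by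
  simp only [traceForm, map_sum, Derivation.map_smul, leftInvDer_X, Matrix.mul_apply,
    Finset.smul_sum, Matrix.mvPolynomialX_apply, Matrix.map_apply, Finset.sum_smul]
  refine Finset.sum_congr rfl fun i _ => ?_
  rw [Finset.sum_comm]
  refine Finset.sum_congr rfl fun k _ => Finset.sum_congr rfl fun j _ => ?_
  rw [mul_comm, ← smul_eq_C_mul, smul_smul, mul_comm]

theorem dirDeriv_traceForm (c X : Matrix (Fin n) (Fin n) F) :
    dirDeriv (traceForm c) 1 X = (X * c).trace := by
  rw [← evalAt_one_leftInvDer, leftInvDer_traceForm, evalAt_traceForm, one_mul]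

theorem exists_trace_mul_eq {m : Type*} [Fintype m] [DecidableEq m]
    (φ : Matrix m m F →ₗ[F] F) : ∃ c, ∀ x, φ x = (x * c).trace := by
  refine ⟨Matrix.of fun j i => φ (Matrix.single i j 1), fun x => ?_⟩
  conv_lhs => rw [Matrix.matrix_eq_sum_single x]
  simp only [map_sum, Matrix.trace, Matrix.diag_apply, Matrix.mul_apply, Matrix.of_apply]
  refine Finset.sum_congr rfl fun i _ => Finset.sum_congr rfl fun j _ => ?_
  rw [← smul_eq_mul, ← map_smul, Matrix.smul_single, smul_eq_mul, mul_one]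

/-- A linear form that vanishes on `Γ` is a polynomial in the ideal and equals its own derivative,
so it vanishes on the tangent space too. -/
theorem tangentSpace_le_matrixSpan {X : Matrix (Fin n) (Fin n) F} (hX : X ∈ tangentSpace Γ) :
    X ∈ matrixSpan Γ := by
  rw [← Subalgebra.mem_toSubmodule]
  by_contra h
  obtain ⟨φ, hφX, hφ⟩ := Submodule.exists_le_ker_of_notMem h
  obtain ⟨c, hc⟩ := exists_trace_mul_eq φ
  apply hφX
  rw [hc, ← dirDeriv_traceForm]
  refine hX _ fun g hg => ?_
  rw [evalAt_traceForm, ← hc]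
  exact hφ (coe_mem_matrixSpan hg)

/-- Multiplication from the left as a polynomial representation. -/
def leftMulRep (F : Type*) [Field F] (n : ℕ) :
    Matrix (Fin n × Fin n) (Fin n × Fin n) (MvPolynomial (Fin n × Fin n) F) :=
  Matrix.of fun a b => if a.2 = b.2 then X (a.1, b.1) else 0

theorem map_leftMulRep_apply (M : Matrix (Fin n) (Fin n) F) (a b : Fin n × Fin n) :
    (leftMulRep F n).map (evalAt M) a b = if a.2 = b.2 then M a.1 b.1 else 0 := by
  rw [leftMulRep, Matrix.map_apply, Matrix.of_apply]
  split_ifs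
  · rw [evalAt_X]
  · rw [map_zero]

theorem leftMulRep_mulVec (M x : Matrix (Fin n) (Fin n) F) :
    ((leftMulRep F n).map (evalAt M)).mulVec (fun b => x b.1 b.2) = fun a => (M * x) a.1 a.2 := by
  ext a
  simp only [Matrix.mulVec, dotProduct, map_leftMulRep_apply, ite_mul, zero_mul, Matrix.mul_apply,
    Fintype.sum_prod_type]
  simp

theorem diffOne_leftMulRep_mulVec (Y x : Matrix (Fin n) (Fin n) F) :
    (diffOne (leftMulRep F n) Y).mulVec (fun b => x b.1 b.2) = fun a => (Y * x) a.1 a.2 := by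
  ext a
  have h0 : dirDeriv (0 : MvPolynomial (Fin n × Fin n) F) 1 Y = 0 := by
    rw [← dirDerivₗ_apply, map_zero]
  have h1 : ∀ a b, diffOne (leftMulRep F n) Y a b = if a.2 = b.2 then Y a.1 b.1 else 0 := by
    intro a b
    rw [diffOne_apply, leftMulRep, Matrix.of_apply]
    split_ifs
    · rw [dirDeriv_X]
    · exact h0
  simp only [Matrix.mulVec, dotProduct, h1, ite_mul, zero_mul, Matrix.mul_apply,
    Fintype.sum_prod_type]
  simp

theorem isPolyRep_leftMulRep : IsPolyRep Γ (leftMulRep F n) := by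
  have key : ∀ M N : Matrix (Fin n) (Fin n) F, (leftMulRep F n).map (evalAt (M * N)) =
      (leftMulRep F n).map (evalAt M) * (leftMulRep F n).map (evalAt N) := by
    intro M N
    ext a b
    simp only [Matrix.mul_apply (M := (leftMulRep F n).map _), map_leftMulRep_apply, ite_mul,
      zero_mul, Fintype.sum_prod_type, Finset.sum_ite_eq, Finset.mem_univ, if_true]
    split_ifs
    · rw [Matrix.mul_apply]
    · simp
  refine ⟨?_, fun g _ h _ => key _ _⟩
  ext ⟨a, b⟩ ⟨c, d⟩
  rw [map_leftMulRep_apply, Matrix.one_apply, Matrix.one_apply]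
  by_cases h2 : b = d <;> simp [h2]

/-- The algebra generated by the tangent space is stable under left multiplication by the tangent
space, hence by the group, and it contains `1`. -/
theorem coe_mem_adjoin_tangentSpace [CharZero F] [IsAlgClosed F] [(groupIdeal Γ).IsPrime]
    {g : GL (Fin n) F} (hg : g ∈ Γ) :
    (g : Matrix (Fin n) (Fin n) F) ∈
      Algebra.adjoin F (tangentSpace Γ : Set (Matrix (Fin n) (Fin n) F)) := by
  set B := Algebra.adjoin F (tangentSpace Γ : Set (Matrix (Fin n) (Fin n) F)) with hB
  let e : Matrix (Fin n) (Fin n) F →ₗ[F] (Fin n × Fin n → F) :=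
    { toFun := fun x b => x b.1 b.2
      map_add' := fun _ _ => rfl
      map_smul' := fun _ _ => rfl }
  have he : Function.Injective e := fun x y h => by
    ext i j
    exact congrFun h (i, j)
  have h := isPolyRep_leftMulRep.mulVec_mem (Γ := Γ) (B.toSubmodule.map e) (by
    rintro Y hY _ ⟨x, hx, rfl⟩
    refine ⟨Y * x, B.mul_mem (Algebra.subset_adjoin hY) hx, ?_⟩
    exact (diffOne_leftMulRep_mulVec Y x).symm) hg (w := e 1) ⟨1, one_mem B, rfl⟩
  obtain ⟨x, hx, hxe⟩ := h
  have h1 : e x = e (g : Matrix (Fin n) (Fin n) F) := by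
    rw [hxe]
    refine (leftMulRep_mulVec (g : Matrix (Fin n) (Fin n) F) 1).trans ?_
    rw [mul_one]
    rfl
  rw [← he h1]
  exact hx

end TraceRadical

/-! ## The radical of the trace form on the Lie algebra -/

section FormRadical

open LinearAlgebraicGroup

variable {F : Type*} [Field F] {n : ℕ} (Γ : Subgroup (GL (Fin n) F))

/-- The radical of the trace form on the tangent space at the identity. -/
def formRadical : Submodule F (Matrix (Fin n) (Fin n) F) where
  carrier := {X | X ∈ tangentSpace Γ ∧ ∀ Y ∈ tangentSpace Γ, (X * Y).trace = 0}
  zero_mem' := ⟨zero_mem _, by simp⟩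
  add_mem' := fun ha hb => ⟨add_mem ha.1 hb.1, fun x hx => by
    rw [add_mul, Matrix.trace_add, ha.2 x hx, hb.2 x hx, add_zero]⟩
  smul_mem' := fun c b hb => ⟨Submodule.smul_mem _ c hb.1, fun x hx => by
    rw [smul_mul_assoc, Matrix.trace_smul, hb.2 x hx, smul_zero]⟩

variable {Γ}

theorem trace_lie_mul {m : Type*} [Fintype m] (X Y Z : Matrix m m F) :
    ((X * Y - Y * X) * Z).trace = (X * (Y * Z - Z * Y)).trace := by
  rw [sub_mul, mul_sub, Matrix.trace_sub, Matrix.trace_sub, mul_assoc, mul_assoc,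
    Matrix.trace_mul_comm Y, mul_assoc]

/-- The entry `N i j` can be nonzero only if `d i = d j`, and then `θ` takes equal values too. -/
theorem Matrix.diagonal_comp_mul_comm {m : Type*} [Fintype m] [DecidableEq m] {d : m → F}
    {N : Matrix m m F} (h : Matrix.diagonal d * N = N * Matrix.diagonal d) (θ : F → F) :
    (Matrix.diagonal fun i => θ (d i)) * N = N * Matrix.diagonal fun i => θ (d i) := by
  ext i j
  have h1 := congrFun (congrFun h i) j
  rw [Matrix.diagonal_mul, Matrix.mul_diagonal, mul_comm] at h1 ⊢
  rcases eq_or_ne (N i j) 0 with h0 | h0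
  · rw [h0, zero_mul, zero_mul]
  · rw [mul_left_cancel₀ h0 h1]

theorem eq_zero_of_forall_rat_linear [CharZero F] {x : F} (h : ∀ θ : F →ₗ[ℚ] ℚ, θ x = 0) :
    x = 0 :=
  (Module.forall_dual_apply_eq_zero_iff ℚ x).1 h

variable [CharZero F] [IsAlgClosed F]

/-- As in Cartan's criterion: for `ℚ`-linear `θ : F → ℚ` the replica of the semisimple part with
eigenvalues `θ(d i)` lies in the tangent space. It commutes with `ν`, so pairing it with `X` gives
`∑ d i θ(d i) = 0`. Applying `θ` gives `∑ θ(d i)² = 0` in `ℚ`, so each `θ(d i)` is zero. -/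
theorem isNilpotent_of_mem_formRadical {X : Matrix (Fin n) (Fin n) F} (hX : X ∈ formRadical Γ) :
    IsNilpotent X := by
  obtain ⟨Q, Q', ν, d, hQ, hXd, hcomm, hν⟩ := X.exists_jordan_decomposition
  have hQ' : Q' * Q = 1 := mul_eq_one_comm.1 hQ
  suffices h : ∀ i, d i = 0 by
    have hd : d = 0 := funext h
    rw [hXd, hd]
    simpa using hν
  suffices h : ∀ θ : F →ₗ[ℚ] ℚ, ∀ i, θ (d i) = 0 from
    fun i => eq_zero_of_forall_rat_linear fun θ => h θ i
  intro θ
  let θ' : F →+ F := (algebraMap ℚ F).toAddMonoidHom.comp θ.toAddMonoidHom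
  have hsQ : Q * Matrix.diagonal d * Q' * Q = Q * Matrix.diagonal d := by
    rw [mul_assoc, hQ', mul_one]
  have hmem : Q * Matrix.diagonal (fun l => θ' (d l)) * Q' ∈ tangentSpace Γ :=
    diagonal_mem_tangentSpace hQ hsQ hcomm hν (hXd ▸ hX.1) θ'
  have htr := hX.2 _ hmem
  have hN : Matrix.diagonal d * (Q' * ν * Q) = Q' * ν * Q * Matrix.diagonal d := by
    calc Matrix.diagonal d * (Q' * ν * Q) = (Q' * Q) * Matrix.diagonal d * (Q' * ν * Q) := by
          rw [hQ', one_mul]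
      _ = Q' * (Q * Matrix.diagonal d * Q' * ν) * Q := by simp only [mul_assoc]
      _ = Q' * ν * Q * Matrix.diagonal d * (Q' * Q) := by rw [hcomm]; simp only [mul_assoc]
      _ = _ := by rw [hQ', mul_one]
  have hθN := Matrix.diagonal_comp_mul_comm hN θ'
  have hc : Commute ν (Q * Matrix.diagonal (fun l => θ' (d l)) * Q') := by
    change ν * _ = _ * ν
    calc ν * (Q * Matrix.diagonal (fun l => θ' (d l)) * Q')
        = (Q * Q') * ν * (Q * Matrix.diagonal (fun l => θ' (d l)) * Q') := by rw [hQ, one_mul]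
      _ = Q * (Q' * ν * Q * Matrix.diagonal (fun l => θ' (d l))) * Q' := by simp only [mul_assoc]
      _ = Q * Matrix.diagonal (fun l => θ' (d l)) * Q' * ν * (Q * Q') := by
        rw [← hθN]; simp only [mul_assoc]
      _ = _ := by rw [hQ, mul_one]
  have htrν : (ν * (Q * Matrix.diagonal (fun l => θ' (d l)) * Q')).trace = 0 :=
    (Matrix.isNilpotent_trace_of_isNilpotent (hc.isNilpotent_mul_right hν)).eq_zero
  have htrs : (Q * Matrix.diagonal d * Q' * (Q * Matrix.diagonal (fun l => θ' (d l)) * Q')).trace =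
      ∑ i, d i * θ' (d i) := by
    rw [show Q * Matrix.diagonal d * Q' * (Q * Matrix.diagonal (fun l => θ' (d l)) * Q') =
      Q * (Matrix.diagonal d * (Q' * Q) * Matrix.diagonal (fun l => θ' (d l)) * Q') by
        simp only [mul_assoc], Matrix.trace_mul_comm, hQ', mul_one, mul_assoc, hQ', mul_one,
      Matrix.diagonal_mul_diagonal, Matrix.trace_diagonal]
  rw [hXd, add_mul, Matrix.trace_add, htrν, htrs, add_zero] at htr
  have hsq : ∑ i, θ (d i) ^ 2 = 0 := by
    have h1 := congrArg θ htr
    rw [map_sum, map_zero] at h1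
    rw [← h1]
    refine Finset.sum_congr rfl fun i _ => ?_
    have : d i * θ' (d i) = θ (d i) • d i := by
      rw [Algebra.smul_def, mul_comm]
      rfl
    rw [this, map_smul, smul_eq_mul, sq]
  intro i
  exact pow_eq_zero_iff two_ne_zero |>.1
    ((Finset.sum_eq_zero_iff_of_nonneg fun _ _ => sq_nonneg _).1 hsq i (Finset.mem_univ i))

/-- By invariance of the trace, the form radical is a Lie algebra of nilpotent matrices stable under
conjugation by `Γ`. Hence its products with elements of `Γ` are nilpotent and have trace zero, and
`Γ` spans the matrix algebra. -/
theorem formRadical_le_traceRadical : formRadical Γ ≤ traceRadical Γ := by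
  intro X hX
  obtain ⟨k, hk⟩ := exists_pow_eq_bot_of_isNilpotent (formRadical Γ) (fun x hx y hy =>
    ⟨lie_mem_tangentSpace hx.1 hy.1, fun Z hZ => by
      rw [trace_lie_mul]
      exact hx.2 _ (lie_mem_tangentSpace hy.1 hZ)⟩) fun x hx => isNilpotent_of_mem_formRadical hx
  refine mem_traceRadical (tangentSpace_le_matrixSpan hX.1) fun g hg => ?_
  refine (Matrix.isNilpotent_trace_of_isNilpotent (isNilpotent_mul_of_conj_mem _ hk
    (h := (g : Matrix (Fin n) (Fin n) F)) (h' := ((g⁻¹ : GL (Fin n) F) : Matrix (Fin n) (Fin n) F))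
    (by rw [← Units.val_mul, inv_mul_cancel, Units.val_one]) ?_ hX)).eq_zero
  intro x hx
  refine ⟨conj_mem_tangentSpace hg hx.1, fun Y hY => ?_⟩
  rw [mul_assoc, mul_assoc, Matrix.trace_mul_comm, mul_assoc]
  have := conj_mem_tangentSpace (inv_mem hg) hY
  rw [inv_inv] at this
  exact hx.2 _ this

end FormRadical

/-! ## Identity components and one-parameter tori -/

section IdentityComponent

variable {F : Type*} [Field F] {n : ℕ}

/-- The image of the component under `x ↦ gxh` is connected and contains `1`. Only continuity of
such translations is used, so joint continuity of multiplication is not needed. -/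
theorem mul_mem_connectedComponentIn (S : Subgroup (GL (Fin n) F)) {g h : GL (Fin n) F}
    (hgh : ∀ x ∈ S, g * x * h ∈ S) {c : GL (Fin n) F}
    (hc : c ∈ @connectedComponentIn _ (zariskiTopology n F) (S : Set (GL (Fin n) F)) 1)
    (h1 : g * c * h = 1) {x : GL (Fin n) F}
    (hx : x ∈ @connectedComponentIn _ (zariskiTopology n F) (S : Set (GL (Fin n) F)) 1) :
    g * x * h ∈ @connectedComponentIn _ (zariskiTopology n F) (S : Set (GL (Fin n) F)) 1 := by
  let _ := zariskiTopology n F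
  have hpre : IsPreconnected ((fun x => g * x * h) ''
      connectedComponentIn (S : Set (GL (Fin n) F)) 1) :=
    isPreconnected_connectedComponentIn.image _ (continuous_zariski_mul_mul g h).continuousOn
  refine hpre.subset_connectedComponentIn ⟨c, hc, h1⟩ ?_ ⟨x, hx, rfl⟩
  rintro _ ⟨y, hy, rfl⟩
  exact hgh y (connectedComponentIn_subset _ _ hy)

/-- The identity component of a group of matrices in the Zariski topology. -/
def identityComponent (S : Subgroup (GL (Fin n) F)) : Subgroup (GL (Fin n) F) where
  carrier := @connectedComponentIn _ (zariskiTopology n F) (S : Set (GL (Fin n) F)) 1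
  one_mem' := @mem_connectedComponentIn _ (zariskiTopology n F) _ _ (one_mem S)
  inv_mem' := by
    let _ := zariskiTopology n F
    intro c hc
    have hcS : c ∈ S := connectedComponentIn_subset _ _ hc
    have := mul_mem_connectedComponentIn S (g := c⁻¹) (h := 1)
      (fun x hx => mul_mem (mul_mem (inv_mem hcS) hx) (one_mem S)) hc (by group)
      (mem_connectedComponentIn (one_mem S))
    simpa using this
  mul_mem' := by
    let _ := zariskiTopology n F
    intro a b ha hb
    have haS : a ∈ S := connectedComponentIn_subset _ _ ha
    have hinv := mul_mem_connectedComponentIn S (g := a⁻¹) (h := 1)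
      (fun x hx => mul_mem (mul_mem (inv_mem haS) hx) (one_mem S)) ha (by group)
      (mem_connectedComponentIn (one_mem S))
    have := mul_mem_connectedComponentIn S (g := a) (h := 1)
      (fun x hx => mul_mem (mul_mem haS hx) (one_mem S)) (by simpa using hinv) (by group) hb
    simpa using this

theorem identityComponent_le (S : Subgroup (GL (Fin n) F)) : identityComponent S ≤ S := by
  let _ := zariskiTopology n F
  exact connectedComponentIn_subset _ _

theorem isConnected_identityComponent (S : Subgroup (GL (Fin n) F)) :
    @IsConnected _ (zariskiTopology n F) (identityComponent S : Set (GL (Fin n) F)) := by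
  let _ := zariskiTopology n F
  exact isConnected_connectedComponentIn_iff.2 (one_mem S)

theorem isClosed_identityComponent {S : Subgroup (GL (Fin n) F)}
    (hS : @IsClosed _ (zariskiTopology n F) (S : Set (GL (Fin n) F))) :
    @IsClosed _ (zariskiTopology n F) (identityComponent S : Set (GL (Fin n) F)) := by
  let _ := zariskiTopology n F
  refine closure_subset_iff_isClosed.1 ?_
  refine (isConnected_identityComponent S).isPreconnected.closure.subset_connectedComponentIn
    (subset_closure (one_mem (identityComponent S))) ?_
  exact closure_minimal (identityComponent_le S) hS

theorem conj_mem_identityComponent {S : Subgroup (GL (Fin n) F)} {g : GL (Fin n) F}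
    (hg : ∀ x ∈ S, g * x * g⁻¹ ∈ S) {c : GL (Fin n) F} (hc : c ∈ identityComponent S) :
    g * c * g⁻¹ ∈ identityComponent S :=
  mul_mem_connectedComponentIn S hg (one_mem (identityComponent S)) (by group) hc

/-- The points of a one-parameter torus. -/
def torusPoint {Q Q' : Matrix (Fin n) (Fin n) F} (hQ : Q * Q' = 1) (k : Fin n → ℤ) (t : Fˣ) :
    GL (Fin n) F where
  val := Q * Matrix.diagonal (fun i => ((t ^ k i : Fˣ) : F)) * Q'
  inv := Q * Matrix.diagonal (fun i => ((t ^ (-k i) : Fˣ) : F)) * Q'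
  val_inv := by
    rw [show ∀ A B : Matrix (Fin n) (Fin n) F, Q * A * Q' * (Q * B * Q') =
      Q * (A * (Q' * Q) * B) * Q' by intro A B; simp only [mul_assoc],
      mul_eq_one_comm.1 hQ, mul_one, Matrix.diagonal_mul_diagonal]
    simp only [← Units.val_mul, ← zpow_add, add_neg_cancel, zpow_zero, Units.val_one,
      Matrix.diagonal_one, mul_one, hQ]
  inv_val := by
    rw [show ∀ A B : Matrix (Fin n) (Fin n) F, Q * A * Q' * (Q * B * Q') =
      Q * (A * (Q' * Q) * B) * Q' by intro A B; simp only [mul_assoc],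
      mul_eq_one_comm.1 hQ, mul_one, Matrix.diagonal_mul_diagonal]
    simp only [← Units.val_mul, ← zpow_add, neg_add_cancel, zpow_zero, Units.val_one,
      Matrix.diagonal_one, mul_one, hQ]

variable {Q Q' : Matrix (Fin n) (Fin n) F} (hQ : Q * Q' = 1) (k : Fin n → ℤ)

theorem exists_polynomial_torusPoint (f : MvPolynomial (Fin n × Fin n) F) :
    ∃ (N : ℕ) (p : Polynomial F), ∀ t : Fˣ, (t : F) ^ N *
      evalAt (torusPoint hQ k t : Matrix (Fin n) (Fin n) F) f = p.eval (t : F) := by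
  induction f using MvPolynomial.induction_on with
  | C c => exact ⟨0, Polynomial.C c, fun t => by simp⟩
  | add f g hf hg =>
    obtain ⟨N, p, hp⟩ := hf
    obtain ⟨M, q, hq⟩ := hg
    refine ⟨N + M, Polynomial.X ^ M * p + Polynomial.X ^ N * q, fun t => ?_⟩
    simp only [map_add, Polynomial.eval_add, Polynomial.eval_mul, Polynomial.eval_pow,
      Polynomial.eval_X, ← hp, ← hq]
    ring
  | mul_X f ij hf =>
    obtain ⟨N, p, hp⟩ := hf
    -- Multiplication by `t ^ M` clears the negative powers of `t` in a matrix entry; the sum of all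
    -- absolute values is a crude bound.
    obtain ⟨M, hM⟩ : ∃ M : ℕ, ∀ l, 0 ≤ (M : ℤ) + k l :=
      ⟨∑ l, (k l).natAbs, fun l => by
        have : (k l).natAbs ≤ ∑ l, (k l).natAbs :=
          Finset.single_le_sum (f := fun l => (k l).natAbs) (fun _ _ => Nat.zero_le _)
            (Finset.mem_univ l)
        omega⟩
    refine ⟨N + M, p * ∑ l, Polynomial.C (Q ij.1 l * Q' l ij.2) *
      Polynomial.X ^ ((M : ℤ) + k l).toNat, fun t => ?_⟩
    rw [map_mul, Polynomial.eval_mul, ← hp, pow_add, mul_mul_mul_comm]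
    congr 1
    rw [evalAt_X, Polynomial.eval_finsetSum]
    change _ * (Q * Matrix.diagonal (fun i => ((t ^ k i : Fˣ) : F)) * Q') ij.1 ij.2 = _
    rw [Matrix.mul_apply, Finset.mul_sum]
    refine Finset.sum_congr rfl fun l _ => ?_
    have : (t : F) ^ ((M : ℤ) + k l).toNat = (t : F) ^ M * ((t ^ k l : Fˣ) : F) := by
      rw [← zpow_natCast, Int.toNat_of_nonneg (hM l), zpow_add₀ t.ne_zero, zpow_natCast,
        Units.val_zpow_eq_zpow_val]
    simp only [Polynomial.eval_mul, Polynomial.eval_C, Polynomial.eval_pow, Polynomial.eval_X,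
      Matrix.mul_diagonal, this]
    ring

/-- An open set that meets the torus contains all its points off the zeros of a nonzero polynomial
in `t`. Over an infinite field two such sets intersect, so the range is even irreducible. -/
theorem isPreconnected_range_torusPoint [Infinite F] :
    @IsPreconnected _ (zariskiTopology n F) (Set.range (torusPoint hQ k)) := by
  let _ := zariskiTopology n F
  have hopen : ∀ u : Set (GL (Fin n) F), IsOpen u → ∀ t : Fˣ, torusPoint hQ k t ∈ u →
      ∃ p : Polynomial F, p ≠ 0 ∧ ∀ t : Fˣ, p.eval (t : F) ≠ 0 → torusPoint hQ k t ∈ u := by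
    intro u hu t ht
    obtain ⟨S, hS⟩ := (isClosed_zariskiTopology_iff _).1 hu.isClosed_compl
    have h1 : torusPoint hQ k t ∉ uᶜ := fun h => h ht
    rw [hS, Set.mem_ofPred_eq] at h1
    push Not at h1
    obtain ⟨f, hf, hft⟩ := h1
    obtain ⟨N, p, hp⟩ := exists_polynomial_torusPoint hQ k f
    refine ⟨p, ?_, fun t' ht' => ?_⟩
    · rintro rfl
      have := hp t
      rw [Polynomial.eval_zero, mul_eq_zero] at this
      refine hft ((eval_eq_evalAt _ _).trans (this.resolve_left ?_))
      exact pow_ne_zero _ t.ne_zero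
    · by_contra hcon
      have h2 : torusPoint hQ k t' ∈ uᶜ := hcon
      rw [hS] at h2
      apply ht'
      rw [← hp, ← eval_eq_evalAt, mul_eq_zero]
      exact Or.inr (h2 f hf)
  refine IsPreirreducible.isPreconnected ?_
  rintro u v hu hv ⟨_, ⟨t, rfl⟩, ht⟩ ⟨_, ⟨t', rfl⟩, ht'⟩
  obtain ⟨p, hp0, hp⟩ := hopen u hu t ht
  obtain ⟨q, hq0, hq⟩ := hopen v hv t' ht'
  -- The factor `X` ensures that the parameter found is a unit.
  obtain ⟨x, hx⟩ : ∃ x, (Polynomial.X * p * q).eval x ≠ 0 := by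
    by_contra hcon
    push Not at hcon
    have : Polynomial.X * p * q = 0 := Polynomial.funext fun x => by
      rw [hcon, Polynomial.eval_zero]
    simp [hp0, hq0] at this
  simp only [Polynomial.eval_mul, Polynomial.eval_X, mul_ne_zero_iff] at hx
  exact ⟨_, ⟨Units.mk0 x hx.1.1, rfl⟩, hp _ hx.1.2, hq _ hx.2⟩

end IdentityComponent

/-! ## Characters of groups whose radical is unipotent -/

section Characters

open LinearAlgebraicGroup

variable {F : Type*} [Field F] {n : ℕ} {Γ : Subgroup (GL (Fin n) F)}

/-- In finite dimension, a functional killing the radical of a symmetric form is represented by a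
vector: the annihilator of the kernel of `B` is the range of its dual map. -/
theorem exists_trace_mul_eq_of_formRadical (φ : Matrix (Fin n) (Fin n) F →ₗ[F] F)
    (hφ : ∀ X ∈ formRadical Γ, φ X = 0) :
    ∃ z ∈ tangentSpace Γ, ∀ Y ∈ tangentSpace Γ, φ Y = (z * Y).trace := by
  let B : tangentSpace Γ →ₗ[F] Module.Dual F (tangentSpace Γ) :=
    LinearMap.mk₂ F (fun X Y : tangentSpace Γ =>
        ((X : Matrix (Fin n) (Fin n) F) * (Y : Matrix (Fin n) (Fin n) F)).trace)
      (fun a b c => by simp [add_mul]) (fun a b c => by simp)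
      (fun a b c => by simp [mul_add]) (fun a b c => by simp)
  have h1 : φ ∘ₗ (tangentSpace Γ).subtype ∈ (LinearMap.ker B).dualAnnihilator := by
    rw [Submodule.mem_dualAnnihilator]
    intro X hX
    refine hφ X ⟨X.2, fun Y hY => ?_⟩
    exact LinearMap.congr_fun (LinearMap.mem_ker.1 hX) (⟨Y, hY⟩ : tangentSpace Γ)
  rw [← LinearMap.range_dualMap_eq_dualAnnihilator_ker] at h1
  obtain ⟨ψ, hψ⟩ := h1
  obtain ⟨z, rfl⟩ := (Module.evalEquiv F (tangentSpace Γ)).surjective ψ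
  refine ⟨z, z.2, fun Y hY => ?_⟩
  have h2 := LinearMap.congr_fun hψ ⟨Y, hY⟩
  change B ⟨Y, hY⟩ z = φ Y at h2
  rw [← h2, Matrix.trace_mul_comm]
  rfl

/-- Membership says `tr((gx - xg)y) = tr(g(xy - yx)) = 0` for all `x` and `y` in the span, which are
linear equations in `g`. -/
theorem isClosed_centralModRadical
    (hΓ : @IsClosed _ (zariskiTopology n F) (Γ : Set (GL (Fin n) F))) :
    @IsClosed _ (zariskiTopology n F) (centralModRadical Γ : Set (GL (Fin n) F)) := by
  let _ := zariskiTopology n F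
  have : (centralModRadical Γ : Set (GL (Fin n) F)) = (Γ : Set (GL (Fin n) F)) ∩
      ⋂ x ∈ matrixSpan Γ, ⋂ y ∈ matrixSpan Γ, {g : GL (Fin n) F | evalAt (g : Matrix (Fin n) (Fin n) F)
        (traceForm (x * y - y * x)) = 0} := by
    ext g
    simp only [Set.mem_inter_iff, SetLike.mem_coe, Set.mem_iInter, Set.mem_ofPred_eq,
      evalAt_traceForm, ← trace_lie_mul]
    refine and_congr_right fun hg => forall₂_congr fun x hx => ?_
    have hgA := coe_mem_matrixSpan hg
    exact ⟨fun h => h.2, fun h => ⟨sub_mem (mul_mem hgA hx) (mul_mem hx hgA), h⟩⟩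
  rw [this]
  exact hΓ.inter (isClosed_biInter fun x _ => isClosed_biInter fun y _ => isClosed_zariski_setOf _)

theorem mem_of_isClosed (hΓ : @IsClosed _ (zariskiTopology n F) (Γ : Set (GL (Fin n) F)))
    {g : GL (Fin n) F} (hg : ∀ f ∈ groupIdeal Γ, evalAt (g : Matrix (Fin n) (Fin n) F) f = 0) :
    g ∈ Γ := by
  obtain ⟨S, hS⟩ := (isClosed_zariskiTopology_iff _).1 hΓ
  have h1 : ∀ x : GL (Fin n) F, x ∈ Γ ↔ ∀ f ∈ S, MvPolynomial.eval x.entries f = 0 := by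
    intro x
    rw [← SetLike.mem_coe, hS]
    rfl
  rw [h1]
  intro f hf
  refine (eval_eq_evalAt _ _).trans (hg f fun x hx => ?_)
  exact (eval_eq_evalAt _ _).symm.trans ((h1 x).1 hx f hf)

theorem conj_mem_centralModRadical {g c : GL (Fin n) F} (hg : g ∈ Γ)
    (hc : c ∈ centralModRadical Γ) : g * c * g⁻¹ ∈ centralModRadical Γ := by
  refine ⟨mul_mem (mul_mem hg hc.1) (inv_mem hg), fun x hx => ?_⟩
  have hgA := coe_mem_matrixSpan hg
  have hgA' := coe_mem_matrixSpan (inv_mem hg)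
  have h1 : ((g⁻¹ : GL (Fin n) F) : Matrix (Fin n) (Fin n) F) *
      (g : Matrix (Fin n) (Fin n) F) = 1 := by
    rw [← Units.val_mul, inv_mul_cancel, Units.val_one]
  have h2 : (g : Matrix (Fin n) (Fin n) F) *
      ((g⁻¹ : GL (Fin n) F) : Matrix (Fin n) (Fin n) F) = 1 := by
    rw [← Units.val_mul, mul_inv_cancel, Units.val_one]
  have h3 := mul_mem_traceRadical' (mul_mem_traceRadical (hc.2 _ (mul_mem (mul_mem hgA' hx) hgA))
    hgA') hgA
  rw [Units.val_mul, Units.val_mul]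
  convert h3 using 1
  simp only [mul_sub, sub_mul, mul_assoc, h2, mul_one]
  simp only [← mul_assoc, h2, one_mul]

variable [CharZero F] [IsAlgClosed F]

omit [IsAlgClosed F] in
-- At `t = 2` the point is diagonalizable and unipotent, so its eigenvalues `2 ^ k l` are `1`; in
-- characteristic zero `2` has infinite order.
theorem eq_zero_of_torusPoint_mem {Q Q' : Matrix (Fin n) (Fin n) F} (hQ : Q * Q' = 1)
    {k : Fin n → ℤ} (hk : ∀ t : Fˣ, torusPoint hQ k t ∈ congruenceSubgroup Γ 0) (l : Fin n) :
    k l = 0 := by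
  let t : Fˣ := Units.mk0 2 two_ne_zero
  have h1 := (hk t).2
  rw [zero_add, pow_one] at h1
  obtain ⟨N, hN⟩ := isNilpotent_of_mem_traceRadical h1
  have h2 : (torusPoint hQ k t : Matrix (Fin n) (Fin n) F) - 1 =
      Q * Matrix.diagonal (fun i => ((t ^ k i : Fˣ) : F) - 1) * Q' := by
    rw [← Matrix.diagonal_sub, mul_sub, sub_mul, Matrix.diagonal_one, mul_one, hQ]
    rfl
  have hQ' : Q' * Q = 1 := mul_eq_one_comm.1 hQ
  have h3 : ∀ (D : Matrix (Fin n) (Fin n) F) (N : ℕ), Q' * (Q * D * Q') ^ N * Q = D ^ N := by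
    intro D N
    induction N with
    | zero => rw [pow_zero, mul_one, hQ', pow_zero]
    | succ N ih =>
      rw [pow_succ, pow_succ, ← ih]
      simp only [mul_assoc, hQ', mul_one]
  have h4 := h3 (Matrix.diagonal (fun i => ((t ^ k i : Fˣ) : F) - 1)) N
  rw [← h2, hN, mul_zero, zero_mul, Matrix.diagonal_pow] at h4
  have h5 := congrFun (congrFun h4 l) l
  rw [Matrix.zero_apply, Matrix.diagonal_apply_eq, Pi.pow_apply] at h5
  have h6 : (2 : F) ^ k l = 1 := by
    have h7 := sub_eq_zero.1 (eq_zero_of_pow_eq_zero h5.symm)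
    rwa [Units.val_zpow_eq_zpow_val, Units.val_mk0] at h7
  have h7 : (2 : ℚ) ^ k l = 1 := Rat.cast_injective (α := F) (by push_cast; exact h6)
  exact (zpow_eq_one_iff_right₀ (by norm_num) (by norm_num)).1 h7

/-- If the trace radical contains `[z, x]` for all `x` in the span of `Γ`, with `z` in the Lie
algebra, and each solvable closed connected normal subgroup is congruent to `1` modulo the trace
radical, then `z` is nilpotent. -/
theorem isNilpotent_of_central
    (hclosed : @IsClosed _ (zariskiTopology n F) (Γ : Set (GL (Fin n) F)))
    (hrad : ∀ H : Subgroup (GL (Fin n) F), H ≤ Γ → (∀ g ∈ Γ, ∀ h ∈ H, g * h * g⁻¹ ∈ H) →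
      @IsClosed _ (zariskiTopology n F) (H : Set (GL (Fin n) F)) →
      @IsConnected _ (zariskiTopology n F) (H : Set (GL (Fin n) F)) → Group.IsSolvable H →
      H ≤ congruenceSubgroup Γ 0)
    {z : Matrix (Fin n) (Fin n) F} (hz : z ∈ tangentSpace Γ)
    (hcentral : ∀ x ∈ matrixSpan Γ, z * x - x * z ∈ traceRadical Γ) : IsNilpotent z := by
  let _ := zariskiTopology n F
  have hzA := tangentSpace_le_matrixSpan hz
  -- This component is closed, connected, normal and solvable, so `hrad` applies to it.
  have hS : identityComponent (centralModRadical Γ) ≤ congruenceSubgroup Γ 0 := by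
    refine hrad _ ((identityComponent_le _).trans fun g hg => hg.1) (fun g hg h hh => ?_)
      (isClosed_identityComponent (isClosed_centralModRadical hclosed))
      (isConnected_identityComponent _)
      (isSolvable_of_le_centralModRadical (identityComponent_le _))
    exact conj_mem_identityComponent (fun x hx => conj_mem_centralModRadical hg hx) hh
  have hpow : ∀ k : ℕ, ∀ x ∈ matrixSpan Γ, z ^ k * x - x * z ^ k ∈ traceRadical Γ := by
    intro k
    induction k with
    | zero => simp
    | succ k ih =>
      intro x hx
      have : z ^ (k + 1) * x - x * z ^ (k + 1) =
          z * (z ^ k * x - x * z ^ k) + (z * x - x * z) * z ^ k := by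
        rw [pow_succ']
        noncomm_ring
      rw [this]
      exact add_mem (mul_mem_traceRadical' (ih x hx) hzA)
        (mul_mem_traceRadical (hcentral x hx) (pow_mem hzA k))
  obtain ⟨Q, Q', ν, d, hQ, hzd, hcomm, hν⟩ := z.exists_jordan_decomposition
  have hQ' : Q' * Q = 1 := mul_eq_one_comm.1 hQ
  have hsQ : Q * Matrix.diagonal d * Q' * Q = Q * Matrix.diagonal d := by
    rw [mul_assoc, hQ', mul_one]
  suffices h : ∀ i, d i = 0 by
    have hd : d = 0 := funext h
    rw [hzd, hd]
    simpa using hν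
  suffices h : ∀ θ : F →ₗ[ℚ] ℚ, ∀ i, θ (d i) = 0 from
    fun i => eq_zero_of_forall_rat_linear fun θ => h θ i
  intro θ
  -- A common denominator turns the rational numbers `θ(d i)` into the integral weights `k i` of a
  -- one-parameter torus.
  obtain ⟨N, hN, hint⟩ : ∃ N : ℚ, N ≠ 0 ∧ ∀ i, ∃ m : ℤ, (m : ℚ) = N * θ (d i) := by
    obtain ⟨b, hb⟩ := IsLocalization.exist_integer_multiples_of_finite (nonZeroDivisors ℤ)
      fun i => θ (d i)
    refine ⟨((b : ℤ) : ℚ), Int.cast_ne_zero.2 (nonZeroDivisors.coe_ne_zero b), fun i => ?_⟩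
    obtain ⟨m, hm⟩ := hb i
    exact ⟨m, hm.trans (by rw [zsmul_eq_mul])⟩
  -- On the group of `x` with `N θ(x)` integral, which contains all `d i`, the maps `x ↦ t ^ (N
  -- θ(x))` are characters as required by `evalAt_torus_eq_zero`.
  let M : AddSubgroup F :=
    { carrier := {x | ∃ m : ℤ, (m : ℚ) = N * θ x}
      zero_mem' := ⟨0, by simp⟩
      add_mem' := by
        rintro x y ⟨a, ha⟩ ⟨b, hb⟩
        exact ⟨a + b, by rw [map_add, mul_add, ← ha, ← hb, Int.cast_add]⟩
      neg_mem' := by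
        rintro x ⟨a, ha⟩
        exact ⟨-a, by rw [map_neg, mul_neg, ← ha, Int.cast_neg]⟩ }
  have hM : ∀ x : M, ∃ m : ℤ, (m : ℚ) = N * θ x := fun x => x.2
  choose κ hκ using hM
  have hκ0 : κ 0 = 0 := Int.cast_injective (α := ℚ) (by rw [hκ]; simp)
  have hκadd : ∀ x y, κ (x + y) = κ x + κ y := fun x y => Int.cast_injective (α := ℚ) (by
    rw [hκ, Int.cast_add, hκ, hκ, AddSubgroup.coe_add, map_add, mul_add])
  let d' : Fin n → M := fun i => ⟨d i, hint i⟩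
  let k : Fin n → ℤ := fun i => κ (d' i)
  have htorus : ∀ (t : Fˣ) {f : MvPolynomial (Fin n × Fin n) F},
      (∀ k : ℕ, evalAt (1 : Matrix (Fin n) (Fin n) F)
        (((leftInvDer z : Module.End F (MvPolynomial (Fin n × Fin n) F)) ^ k) f) = 0) →
      evalAt (torusPoint hQ k t : Matrix (Fin n) (Fin n) F) f = 0 := by
    intro t f hf
    let ψ : Multiplicative M →* F :=
      { toFun := fun x => ((t ^ κ x.toAdd : Fˣ) : F)
        map_one' := by
          rw [toAdd_one, hκ0]
          simp
        map_mul' := fun x y => by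
          rw [toAdd_mul, hκadd, zpow_add, Units.val_mul] }
    rw [hzd] at hf
    have := evalAt_torus_eq_zero (d := d') M.subtype Subtype.val_injective hQ hsQ hcomm hν hf ψ
    rw [Algebra.algebraMap_self, RingHom.coe_id, Matrix.map_id, Matrix.map_id] at this
    exact this
  have hmemS : ∀ t, torusPoint hQ k t ∈ centralModRadical Γ := by
    intro t
    have hΓ : torusPoint hQ k t ∈ Γ := mem_of_isClosed hclosed fun f hf =>
      htorus t (evalAt_one_leftInvDer_pow_eq_zero hz hf)
    have hA := coe_mem_matrixSpan hΓ
    refine ⟨hΓ, fun x hx => ⟨sub_mem (mul_mem hA hx) (mul_mem hx hA), fun y hy => ?_⟩⟩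
    -- Being central modulo the trace radical is expressed by linear forms. Their derivatives along
    -- `z` at `1` are `tr((zᵏx - xzᵏ)y) = 0`, so they vanish on the torus for the same reason as the
    -- ideal.
    rw [trace_lie_mul, ← evalAt_traceForm]
    refine htorus t fun k => ?_
    have h1 : ∀ (k : ℕ) (c : Matrix (Fin n) (Fin n) F),
        ((leftInvDer z : Module.End F (MvPolynomial (Fin n × Fin n) F)) ^ k) (traceForm c) =
          traceForm (z ^ k * c) := by
      intro k
      induction k with
      | zero => simp
      | succ k ih =>
        intro c
        rw [pow_succ, Module.End.mul_apply, Derivation.coeFn_coe, leftInvDer_traceForm, ih,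
          pow_succ, mul_assoc]
    rw [h1, evalAt_traceForm, one_mul, ← trace_lie_mul]
    exact (hpow k x hx).2 y hy
  have hcong : ∀ t, torusPoint hQ k t ∈ congruenceSubgroup Γ 0 := by
    intro t
    apply hS
    have h1 : (1 : GL (Fin n) F) ∈ Set.range (torusPoint hQ k) := by
      refine ⟨1, Units.ext ?_⟩
      change Q * Matrix.diagonal (fun i => (((1 : Fˣ) ^ k i : Fˣ) : F)) * Q' = 1
      simp [hQ]
    refine (isPreconnected_range_torusPoint hQ k).subset_connectedComponentIn h1 ?_ ⟨t, rfl⟩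
    rintro _ ⟨t, rfl⟩
    exact hmemS t
  intro i
  have h1 := eq_zero_of_torusPoint_mem hQ hcong i
  have h2 := hκ (d' i)
  rw [show κ (d' i) = 0 from h1, Int.cast_zero] at h2
  exact (mul_eq_zero.1 h2.symm).resolve_left hN

omit [IsAlgClosed F] in
-- Modulo the trace radical `z` commutes with `y`, so `(zy)ᵏ ≡ zᵏyᵏ`. Once `zᵏ = 0`, the power
-- `(zy)ᵏ` lies in the trace radical, and `zy` is nilpotent.
theorem trace_mul_eq_zero_of_central {z : Matrix (Fin n) (Fin n) F} (hzA : z ∈ matrixSpan Γ)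
    (hz : IsNilpotent z) (hcentral : ∀ x ∈ matrixSpan Γ, z * x - x * z ∈ traceRadical Γ)
    {y : Matrix (Fin n) (Fin n) F} (hy : y ∈ matrixSpan Γ) : (z * y).trace = 0 := by
  have key : ∀ k : ℕ, (z * y) ^ k - z ^ k * y ^ k ∈ traceRadical Γ := by
    intro k
    induction k with
    | zero => simp
    | succ k ih =>
      have : (z * y) ^ (k + 1) - z ^ (k + 1) * y ^ (k + 1) =
          ((z * y) ^ k - z ^ k * y ^ k) * (z * y) - z ^ k * (z * y ^ k - y ^ k * z) * y := by
        rw [pow_succ, pow_succ, pow_succ]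
        noncomm_ring
      rw [this]
      exact sub_mem (mul_mem_traceRadical ih (mul_mem hzA hy)) (mul_mem_traceRadical
        (mul_mem_traceRadical' (hcentral _ (pow_mem hy k)) (pow_mem hzA k)) hy)
  obtain ⟨k, hk⟩ := hz
  have h1 := key k
  rw [hk, zero_mul, sub_zero] at h1
  exact (Matrix.isNilpotent_trace_of_isNilpotent
    ((isNilpotent_of_mem_traceRadical h1).of_pow)).eq_zero

/-- Polynomial characters of a connected group with unipotent radical are trivial. -/
theorem IsPolyRep.character_eq_one [(groupIdeal Γ).IsPrime]
    (hclosed : @IsClosed _ (zariskiTopology n F) (Γ : Set (GL (Fin n) F)))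
    (hrad : ∀ H : Subgroup (GL (Fin n) F), H ≤ Γ → (∀ g ∈ Γ, ∀ h ∈ H, g * h * g⁻¹ ∈ H) →
      @IsClosed _ (zariskiTopology n F) (H : Set (GL (Fin n) F)) →
      @IsConnected _ (zariskiTopology n F) (H : Set (GL (Fin n) F)) → Group.IsSolvable H →
      H ≤ congruenceSubgroup Γ 0)
    {χ : MvPolynomial (Fin n × Fin n) F}
    (hχ : IsPolyRep Γ (Matrix.of fun _ _ : Unit => χ)) {g : GL (Fin n) F} (hg : g ∈ Γ) :
    evalAt (g : Matrix (Fin n) (Fin n) F) χ = 1 := by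
  let φ : Matrix (Fin n) (Fin n) F →ₗ[F] F := differential χ 1
  have hφ : ∀ X, diffOne (Matrix.of fun _ _ : Unit => χ) X = Matrix.of fun _ _ => φ X :=
    fun X => rfl
  -- Nilpotent elements have nilpotent differentials, and a nilpotent matrix of size one is zero.
  have hφnil : ∀ X ∈ formRadical Γ, φ X = 0 := by
    intro X hX
    have h1 := hχ.isNilpotent_diffOne (isNilpotent_of_mem_formRadical hX) hX.1
    have h2 := (Matrix.isNilpotent_trace_of_isNilpotent h1).eq_zero
    rw [hφ] at h2
    simpa [Matrix.trace] using h2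
  have hφlie : ∀ X ∈ tangentSpace Γ, ∀ Y ∈ tangentSpace Γ, φ (X * Y - Y * X) = 0 := by
    intro X hX Y hY
    have h1 := congrFun (congrFun (hχ.diffOne_lie hX hY) ()) ()
    rw [hφ, hφ, hφ] at h1
    simpa [Matrix.mul_apply, mul_comm] using h1
  obtain ⟨z, hz, hzφ⟩ := exists_trace_mul_eq_of_formRadical φ hφnil
  have hzA := tangentSpace_le_matrixSpan hz
  -- For `Y` in the Lie algebra, `tr([z,Y]W) = φ([Y,W]) = 0`, so `[z,Y]` is in the form radical. The
  -- Leibniz rule for `[z, ·]` extends this to the algebra generated by the Lie algebra, which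
  -- contains the group.
  have hcentral : ∀ x ∈ matrixSpan Γ, z * x - x * z ∈ traceRadical Γ := by
    intro x hx
    have hx' : x ∈ Subalgebra.toSubmodule
        (Algebra.adjoin F (tangentSpace Γ : Set (Matrix (Fin n) (Fin n) F))) :=
      matrixSpan_le (fun g hg => coe_mem_adjoin_tangentSpace hg) hx
    rw [Subalgebra.mem_toSubmodule] at hx'
    have : x ∈ matrixSpan Γ ∧ z * x - x * z ∈ traceRadical Γ := by
      clear hx
      induction hx' using Algebra.adjoin_induction with
      | mem Y hY =>
        refine ⟨tangentSpace_le_matrixSpan hY, formRadical_le_traceRadical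
          ⟨lie_mem_tangentSpace hz hY, fun W hW => ?_⟩⟩
        rw [trace_lie_mul, ← hzφ _ (lie_mem_tangentSpace hY hW)]
        exact hφlie Y hY W hW
      | algebraMap r =>
        refine ⟨Subalgebra.algebraMap_mem _ r, ?_⟩
        rw [Algebra.commutes, sub_self]
        exact zero_mem _
      | add x y _ _ h1 h2 =>
        refine ⟨add_mem h1.1 h2.1, ?_⟩
        rw [mul_add, add_mul, add_sub_add_comm]
        exact add_mem h1.2 h2.2
      | mul x y _ _ h1 h2 =>
        refine ⟨mul_mem h1.1 h2.1, ?_⟩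
        rw [show z * (x * y) - x * y * z = (z * x - x * z) * y + x * (z * y - y * z) by
          noncomm_ring]
        exact add_mem (mul_mem_traceRadical h1.2 h2.1) (mul_mem_traceRadical' h2.2 h1.1)
    exact this.2
  have hznil := isNilpotent_of_central hclosed hrad hz hcentral
  have hφ0 : ∀ Y ∈ tangentSpace Γ, φ Y = 0 := fun Y hY => by
    rw [hzφ Y hY]
    exact trace_mul_eq_zero_of_central hzA hznil hcentral (tangentSpace_le_matrixSpan hY)
  refine evalAt_eq_one_of_leftInvDer ?_ (fun A hA => ?_) hg
  · have := congrFun (congrFun hχ.map_one ()) ()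
    simpa using this
  · have h1 := hχ.leftInvDer_sub_mem hA () ()
    rw [hφ, hφ0 A hA] at h1
    simpa [Matrix.mul_apply] using h1

end Characters

end

noncomputable section

/-! ## Subspaces stable under a triangular decomposition -/

section StableSubspaces

variable {K V : Type*} [Field K] [AddCommGroup V] [Module K V]

/-- A functional that kills `p` turns the sum into a scalar polynomial in `s` with infinitely many
zeros, so it kills every coefficient. -/
theorem mem_of_forall_sum_smul_mem [Infinite K] (p : Submodule K V) (v : ℕ → V) (N : ℕ)
    (h : ∀ s : K, ∑ j ∈ Finset.range N, s ^ j • v j ∈ p) {j : ℕ} (hj : j < N) : v j ∈ p := by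
  by_contra hcon
  obtain ⟨φ, hφ, hp⟩ := Submodule.exists_le_ker_of_notMem hcon
  have h1 : (∑ j ∈ Finset.range N, Polynomial.monomial j (φ (v j)) : Polynomial K) = 0 := by
    refine Polynomial.funext fun s => ?_
    have h2 : φ (∑ j ∈ Finset.range N, s ^ j • v j) = 0 := hp (h s)
    rw [map_sum] at h2
    simpa [Polynomial.eval_finsetSum, mul_comm] using h2
  apply hφ
  have h3 := congrArg (fun q => Polynomial.coeff q j) h1
  simpa [Polynomial.finsetSum_coeff, Polynomial.coeff_monomial, hj] using h3

/-- The span of the results of applying at most `k` elements of `L` to `w`. -/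
def wordSpan (L : Submodule K (Module.End K V)) (w : V) : ℕ → Submodule K V
  | 0 => Submodule.span K {w}
  | k + 1 => wordSpan L w k ⊔
      Submodule.span K {v | ∃ x ∈ L, ∃ u ∈ wordSpan L w k, x u = v}

theorem wordSpan_mono (L : Submodule K (Module.End K V)) (w : V) : Monotone (wordSpan L w) :=
  monotone_nat_of_le_succ fun _ => le_sup_left

theorem apply_mem_wordSpan {L : Submodule K (Module.End K V)} {w : V} {k : ℕ} {x : Module.End K V}
    (hx : x ∈ L) {u : V} (hu : u ∈ wordSpan L w k) : x u ∈ wordSpan L w (k + 1) :=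
  le_sup_right (a := wordSpan L w k) (Submodule.subset_span ⟨x, hx, u, hu, rfl⟩)

theorem pow_apply_mem_wordSpan {L : Submodule K (Module.End K V)} {w : V} {x : Module.End K V}
    (hx : x ∈ L) (k : ℕ) : (x ^ k) w ∈ wordSpan L w k := by
  induction k with
  | zero => exact Submodule.mem_span_singleton_self w
  | succ k ih =>
    rw [pow_succ', Module.End.mul_apply]
    exact apply_mem_wordSpan hx ih

/-- The first order term of `(Y + s X) ^ k`. -/
def firstOrder (X Y : Module.End K V) : ℕ → Module.End K V
  | 0 => 0
  | k + 1 => Y * firstOrder X Y k + X * Y ^ k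

theorem exists_pow_add_smul (X Y : Module.End K V) (k : ℕ) :
    ∃ (N : ℕ) (A : ℕ → Module.End K V), 1 < N ∧ A 1 = firstOrder X Y k ∧
      ∀ s : K, (Y + s • X) ^ k = ∑ j ∈ Finset.range N, s ^ j • A j := by
  -- The variable commutes with the noncommuting coefficients, and so does the scalar operator `s •
  -- 1` at which the polynomial is evaluated.
  let q : Polynomial (Module.End K V) := Polynomial.C Y + Polynomial.C X * Polynomial.X
  have h0 : ∀ k, (q ^ k).coeff 0 = Y ^ k := by
    intro k
    induction k with
    | zero => simp
    | succ k ih =>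
      rw [pow_succ', add_mul, Polynomial.coeff_add, Polynomial.coeff_C_mul, ih, mul_assoc,
        Polynomial.X_mul, ← mul_assoc, Polynomial.mul_coeff_zero, Polynomial.coeff_X_zero, mul_zero,
        add_zero, pow_succ']
  have h1 : ∀ k, (q ^ k).coeff 1 = firstOrder X Y k := by
    intro k
    induction k with
    | zero => simp [firstOrder, Polynomial.coeff_one]
    | succ k ih =>
      rw [pow_succ', add_mul, Polynomial.coeff_add, Polynomial.coeff_C_mul, ih, mul_assoc,
        Polynomial.X_mul, ← mul_assoc, Polynomial.coeff_mul_X, Polynomial.coeff_C_mul, h0]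
      rfl
  have h2 : ∀ (s : K) k, (q ^ k).eval (s • (1 : Module.End K V)) = (Y + s • X) ^ k := by
    intro s k
    induction k with
    | zero => simp
    | succ k ih =>
      rw [pow_succ', add_mul, Polynomial.eval_add, Polynomial.eval_C_mul, mul_assoc,
        Polynomial.X_mul, ← mul_assoc, Polynomial.eval_mul_X, Polynomial.eval_C_mul, ih, pow_succ',
        add_mul, mul_smul_comm, mul_one, smul_mul_assoc]
  refine ⟨(q ^ k).natDegree + 2, fun j => (q ^ k).coeff j, by omega, h1 k, fun s => ?_⟩
  rw [← h2, Polynomial.eval_eq_sum_range' (n := (q ^ k).natDegree + 2) (by omega)]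
  refine Finset.sum_congr rfl fun j _ => ?_
  rw [smul_pow, one_pow, mul_smul_comm, mul_one]

/-- The first order term of `(Y + sX)^(k+1)` has `k + 1` summands `Y^i X Y^(k-i)`. Moving `X` to the
front replaces two letters by their commutator in `L`, so the error consists of words of length at
most `k`. -/
theorem firstOrder_apply_sub_mem {L : Submodule K (Module.End K V)}
    (hL : ∀ x ∈ L, ∀ y ∈ L, x * y - y * x ∈ L) {X Y : Module.End K V} (hX : X ∈ L) (hY : Y ∈ L)
    (w : V) (k : ℕ) :
    firstOrder X Y (k + 1) w - ((k + 1 : ℕ) : K) • X ((Y ^ k) w) ∈ wordSpan L w k := by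
  induction k with
  | zero => simp [firstOrder]
  | succ k ih =>
    have h1 := apply_mem_wordSpan hY ih
    have h2 : (Y * X - X * Y) ((Y ^ k) w) ∈ wordSpan L w (k + 1) :=
      apply_mem_wordSpan (hL Y hY X hX) (pow_apply_mem_wordSpan hY k)
    have h3 : firstOrder X Y (k + 1 + 1) w - ((k + 1 + 1 : ℕ) : K) • X ((Y ^ (k + 1)) w) =
        Y (firstOrder X Y (k + 1) w - ((k + 1 : ℕ) : K) • X ((Y ^ k) w)) +
          ((k + 1 : ℕ) : K) • (Y * X - X * Y) ((Y ^ k) w) := by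
      rw [firstOrder, LinearMap.add_apply, Module.End.mul_apply, Module.End.mul_apply, map_sub,
        map_smul, LinearMap.sub_apply, Module.End.mul_apply, Module.End.mul_apply, smul_sub,
        ← Module.End.mul_apply Y (Y ^ k), ← pow_succ', Nat.cast_succ (k + 1), add_smul, one_smul]
      abel
    rw [h3]
    exact add_mem h1 (Submodule.smul_mem _ _ h2)

/-- Polarization: in characteristic zero every word is a combination of powers of single elements,
up to shorter words. The powers `(Y + sx)^(j+1)` yield their first order term, which is `(j+1) x
Y^j` modulo shorter words. -/
theorem wordSpan_le_of_pow_mem [CharZero K] {L : Submodule K (Module.End K V)}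
    (hL : ∀ x ∈ L, ∀ y ∈ L, x * y - y * x ∈ L) {w : V} {p : Submodule K V}
    (hp : ∀ Y ∈ L, ∀ k : ℕ, (Y ^ k) w ∈ p) (k : ℕ) : wordSpan L w k ≤ p := by
  let D : ℕ → Submodule K V := fun k => Submodule.span K {v | ∃ Y ∈ L, ∃ j ≤ k, (Y ^ j) w = v}
  have hDmono : Monotone D := fun a b hab => Submodule.span_mono
    (by rintro _ ⟨Y, hY, j, hj, rfl⟩; exact ⟨Y, hY, j, hj.trans hab, rfl⟩)
  have hD : ∀ k, wordSpan L w k ≤ D k := by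
    intro k
    induction k with
    | zero =>
      rw [wordSpan, Submodule.span_singleton_le_iff_mem]
      exact Submodule.subset_span ⟨0, zero_mem L, 0, le_rfl, rfl⟩
    | succ k ih =>
      refine sup_le (ih.trans (hDmono k.le_succ)) (Submodule.span_le.2 ?_)
      rintro _ ⟨x, hx, u, hu, rfl⟩
      have hu' := ih hu
      clear hu
      induction hu' using Submodule.span_induction with
      | mem u hu' =>
        obtain ⟨Y, hY, j, hj, rfl⟩ := hu'
        obtain ⟨N, A, hN, hA1, hA⟩ := exists_pow_add_smul x Y (j + 1)
        have hfirst : firstOrder x Y (j + 1) w ∈ D (j + 1) := by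
          rw [← hA1]
          refine mem_of_forall_sum_smul_mem (D (j + 1)) (fun i => A i w) N (fun s => ?_) hN
          have : ∑ i ∈ Finset.range N, s ^ i • A i w = ((Y + s • x) ^ (j + 1)) w := by
            rw [hA]
            simp [LinearMap.sum_apply]
          rw [this]
          exact Submodule.subset_span
            ⟨_, add_mem hY (Submodule.smul_mem _ s hx), j + 1, le_rfl, rfl⟩
        have hsub := ih (wordSpan_mono L w hj (firstOrder_apply_sub_mem hL hx hY w j))
        have h1 : ((j + 1 : ℕ) : K) • x ((Y ^ j) w) ∈ D (k + 1) := by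
          have := sub_mem (hDmono (Nat.succ_le_succ hj) hfirst) (hDmono k.le_succ hsub)
          rwa [sub_sub_cancel] at this
        have h2 : ((j + 1 : ℕ) : K) ≠ 0 := Nat.cast_ne_zero.2 j.succ_ne_zero
        exact (Submodule.smul_mem_iff _ h2).1 h1
      | zero => simp
      | add a b _ _ ha hb =>
        rw [map_add]
        exact add_mem ha hb
      | smul c a _ ha =>
        rw [map_smul]
        exact Submodule.smul_mem _ c ha
  refine (hD k).trans (Submodule.span_le.2 ?_)
  rintro _ ⟨Y, hY, j, -, rfl⟩
  exact hp Y hY j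

/-- A vector whose images under all powers of elements of `L₋` lie in a subspace stable under `L₀`
and `L₊` is contained in a subspace of it that is stable under all three. -/
theorem exists_stable_submodule [CharZero K] {Lm Lz Lp : Submodule K (Module.End K V)}
    (hmm : ∀ x ∈ Lm, ∀ y ∈ Lm, x * y - y * x ∈ Lm)
    (hmz : ∀ x ∈ Lm, ∀ y ∈ Lz, x * y - y * x ∈ Lm)
    (hp : ∀ x ∈ Lm ⊔ Lz, ∀ y ∈ Lp, x * y - y * x ∈ Lm ⊔ Lz ⊔ Lp) {p : Submodule K V}
    (hzp : ∀ x ∈ Lz, ∀ v ∈ p, x v ∈ p) (hpp : ∀ x ∈ Lp, ∀ v ∈ p, x v ∈ p) {w : V}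
    (hw : ∀ Y ∈ Lm, ∀ k : ℕ, (Y ^ k) w ∈ p) :
    ∃ W ≤ p, w ∈ W ∧ ∀ x ∈ Lm ⊔ Lz ⊔ Lp, ∀ v ∈ W, x v ∈ W := by
  -- The largest `Lm`-stable subspace of `p`; it contains all words in `Lm` applied to `w`.
  let B : Submodule K V := sSup {W | W ≤ p ∧ ∀ x ∈ Lm, ∀ v ∈ W, x v ∈ W}
  have hBp : B ≤ p := sSup_le fun W hW => hW.1
  have hBm : ∀ x ∈ Lm, ∀ v ∈ B, x v ∈ B := by
    intro x hx
    have : B ≤ B.comap x := sSup_le fun W hW v hv => le_sSup (a := W) hW (hW.2 x hx v hv)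
    exact this
  have hBw : w ∈ B := by
    let U : Submodule K V := ⨆ k, wordSpan Lm w k
    have hU : U ∈ {W : Submodule K V | W ≤ p ∧ ∀ x ∈ Lm, ∀ v ∈ W, x v ∈ W} := by
      refine ⟨iSup_le fun k => wordSpan_le_of_pow_mem hmm hw k, fun x hx => ?_⟩
      have : U ≤ U.comap x := iSup_le fun k v hv =>
        le_iSup (wordSpan Lm w) (k + 1) (apply_mem_wordSpan hx hv)
      exact this
    exact le_sSup hU (le_iSup (wordSpan Lm w) 0 (Submodule.mem_span_singleton_self w))
  have hBz : ∀ x ∈ Lz, ∀ v ∈ B, x v ∈ B := by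
    -- Since `[Lm, Lz] ⊆ Lm`, the sum `B + Lz B` is again an `Lm`-stable subspace of `p`, and by
    -- maximality it is `B`.
    let C : Submodule K V := Submodule.span K {u | ∃ x ∈ Lz, ∃ v ∈ B, x v = u}
    have hC : B ⊔ C ∈ {W : Submodule K V | W ≤ p ∧ ∀ x ∈ Lm, ∀ v ∈ W, x v ∈ W} := by
      refine ⟨sup_le hBp (Submodule.span_le.2 ?_), fun y hy => ?_⟩
      · rintro _ ⟨x, hx, v, hv, rfl⟩
        exact hzp x hx v (hBp hv)
      · have : B ⊔ C ≤ (B ⊔ C).comap y := by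
          refine sup_le (fun v hv => le_sup_left (b := C) (hBm y hy v hv)) (Submodule.span_le.2 ?_)
          rintro _ ⟨x, hx, v, hv, rfl⟩
          have h1 : y (x v) = (y * x - x * y) v + x (y v) := by
            simp
          change y (x v) ∈ B ⊔ C
          rw [h1]
          exact add_mem (le_sup_left (b := C) (hBm _ (hmz y hy x hx) v hv))
            (le_sup_right (a := B) (Submodule.subset_span ⟨x, hx, _, hBm y hy v hv, rfl⟩))
        exact this
    intro x hx v hv
    exact le_sSup hC (le_sup_right (a := B) (Submodule.subset_span ⟨x, hx, v, hv, rfl⟩))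
  have hBmz : ∀ x ∈ Lm ⊔ Lz, ∀ v ∈ B, x v ∈ B := by
    intro x hx v hv
    obtain ⟨y, hy, z, hz, rfl⟩ := Submodule.mem_sup.1 hx
    exact add_mem (hBm y hy v hv) (hBz z hz v hv)
  -- The `Lp`-submodule generated by `B`; it lies in `p` because `p` is `Lp`-stable.
  let W : Submodule K V := sInf {W | B ≤ W ∧ ∀ x ∈ Lp, ∀ v ∈ W, x v ∈ W}
  have hBW : B ≤ W := le_sInf fun W' hW' => hW'.1
  have hWp : W ≤ p := sInf_le ⟨hBp, hpp⟩
  have hWLp : ∀ x ∈ Lp, ∀ v ∈ W, x v ∈ W := by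
    intro x hx v hv
    refine Submodule.mem_sInf.2 fun W' hW' => hW'.2 x hx v (Submodule.mem_sInf.1 hv W' hW')
  have hWmz : ∀ x ∈ Lm ⊔ Lz, ∀ v ∈ W, x v ∈ W := by
    -- The vectors of `W` that `Lm + Lz` maps into `W`. This subspace contains `B` and, by the
    -- commutator hypothesis, is `Lp`-stable, so by minimality it is all of `W`.
    let W' : Submodule K V := W ⊓ ⨅ x : ↥(Lm ⊔ Lz), W.comap (x : Module.End K V)
    have hW' : W ≤ W' := by
      refine sInf_le ⟨le_inf hBW (le_iInf fun x v hv => hBW (hBmz x x.2 v hv)), ?_⟩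
      rintro x hx v ⟨hv, hv'⟩
      rw [SetLike.mem_coe, Submodule.mem_iInf] at hv'
      refine ⟨hWLp x hx v hv, ?_⟩
      rw [SetLike.mem_coe, Submodule.mem_iInf]
      rintro ⟨y, hy⟩
      change y (x v) ∈ W
      have h1 : y (x v) = (y * x - x * y) v + x (y v) := by
        simp
      rw [h1]
      refine add_mem ?_ (hWLp x hx _ (hv' ⟨y, hy⟩))
      obtain ⟨a, ha, b, hb, hab⟩ := Submodule.mem_sup.1 (hp y hy x hx)
      rw [← hab]
      exact add_mem (hv' ⟨a, ha⟩) (hWLp b hb v hv)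
    intro x hx v hv
    have h1 := (hW' hv).2
    rw [SetLike.mem_coe, Submodule.mem_iInf] at h1
    exact h1 ⟨x, hx⟩
  refine ⟨W, hWp, hBW hBw, fun x hx v hv => ?_⟩
  obtain ⟨a, ha, b, hb, rfl⟩ := Submodule.mem_sup.1 hx
  exact add_mem (hWmz a ha v hv) (hWLp b hb v hv)

end StableSubspaces

end

noncomputable section

open MvPolynomial

/-! ## Galois descent -/

section Descent

/-- A space of polynomials stable under the Galois group is spanned by its rational elements. -/
theorem MvPolynomial.mem_span_of_galois_stable {σ K L : Type*} [Field K] [Field L] [Algebra K L]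
    [IsGalois K L] (W : Submodule L (MvPolynomial σ L))
    (hW : ∀ τ : Gal(L/K), ∀ f ∈ W, MvPolynomial.map (τ : L →+* L) f ∈ W)
    {f : MvPolynomial σ L} (hf : f ∈ W) :
    f ∈ Submodule.span L {g | g ∈ W ∧ ∃ p : MvPolynomial σ K, map (algebraMap K L) p = g} := by
  obtain ⟨N, hN⟩ : ∃ N, N = f.support.card := ⟨_, rfl⟩
  induction N using Nat.strong_induction_on generalizing f with
  | _ N ih =>
  rcases eq_or_ne f 0 with rfl | hf0
  · exact zero_mem _
  -- Subtracting a multiple of `u` removes a monomial of `f`, so induction on the support leaves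
  -- only elements of minimal support.
  by_cases h : ∃ u ∈ W, u ≠ 0 ∧ u.support ⊂ f.support
  · obtain ⟨u, huW, hu0, hus⟩ := h
    obtain ⟨m, hm⟩ := MvPolynomial.support_nonempty.2 hu0
    have hum : coeff m u ≠ 0 := MvPolynomial.mem_support_iff.1 hm
    have hu : u ∈ Submodule.span L
        {g | g ∈ W ∧ ∃ p : MvPolynomial σ K, map (algebraMap K L) p = g} :=
      ih _ (hN ▸ Finset.card_lt_card hus) huW rfl
    have hv : f - (coeff m f / coeff m u) • u ∈ Submodule.span L
        {g | g ∈ W ∧ ∃ p : MvPolynomial σ K, map (algebraMap K L) p = g} := by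
      refine ih _ ?_ (sub_mem hf (Submodule.smul_mem _ _ huW)) rfl
      rw [hN]
      refine Finset.card_lt_card ⟨fun k hk => ?_, fun hcon => ?_⟩
      · by_contra hkf
        have h1 := MvPolynomial.mem_support_iff.1 hk
        have h2 : coeff k u = 0 := MvPolynomial.notMem_support_iff.1 fun h => hkf (hus.1 h)
        rw [coeff_sub, coeff_smul, MvPolynomial.notMem_support_iff.1 hkf, h2] at h1
        simp at h1
      · have h1 := MvPolynomial.mem_support_iff.1 (hcon (hus.1 hm))
        rw [coeff_sub, coeff_smul, smul_eq_mul, div_mul_cancel₀ _ hum, sub_self] at h1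
        exact h1 rfl
    have := add_mem hv (Submodule.smul_mem _ (coeff m f / coeff m u) hu)
    rwa [sub_add_cancel] at this
  · push Not at h
    obtain ⟨m, hm⟩ := MvPolynomial.support_nonempty.2 hf0
    have hfm : coeff m f ≠ 0 := MvPolynomial.mem_support_iff.1 hm
    -- With one coefficient normalized to `1`, the difference of `g` and a Galois conjugate has
    -- strictly smaller support, so it vanishes by minimality and `g` is rational.
    set g := (coeff m f)⁻¹ • f with hg
    have hgW : g ∈ W := Submodule.smul_mem _ _ hf
    have hgm : coeff m g = 1 := by rw [hg, coeff_smul, smul_eq_mul, inv_mul_cancel₀ hfm]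
    have hfix : ∀ τ : Gal(L/K), map (τ : L →+* L) g = g := by
      intro τ
      by_contra hcon
      refine h _ (sub_mem (hW τ g hgW) hgW) (sub_ne_zero.2 hcon) ⟨fun k hk => ?_, fun hcon => ?_⟩
      · by_contra hkf
        have h1 := MvPolynomial.mem_support_iff.1 hk
        have h2 : coeff k g = 0 := by
          rw [hg, coeff_smul, MvPolynomial.notMem_support_iff.1 hkf, smul_zero]
        rw [coeff_sub, coeff_map, h2] at h1
        simp at h1
      · have h1 := MvPolynomial.mem_support_iff.1 (hcon hm)
        rw [coeff_sub, coeff_map, hgm] at h1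
        simp at h1
    have hrat : ∃ p : MvPolynomial σ K, map (algebraMap K L) p = g := by
      have h1 : g ∈ Set.range (map (algebraMap K L)) := by
        rw [MvPolynomial.mem_range_map_iff_coeffs_subset]
        intro c hc
        obtain ⟨k, -, rfl⟩ := MvPolynomial.mem_coeffs_iff.1 hc
        rw [InfiniteGalois.mem_range_algebraMap_iff_fixed]
        intro τ
        have h2 := congrArg (coeff k) (hfix τ)
        rwa [coeff_map] at h2
      exact h1
    have : f = coeff m f • g := by rw [hg, smul_smul, mul_inv_cancel₀ hfm, one_smul]
    rw [this]
    exact Submodule.smul_mem _ _ (Submodule.subset_span ⟨hgW, hrat⟩)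

open LinearAlgebraicGroup

/-! ### Evaluation and differentials under extension of scalars -/

section FieldExtension

variable {K L : Type*} [Field K] [Field L] [Algebra K L] {n : ℕ}

theorem evalAt_map_algebraMap {R : Type*} [CommRing R] [Algebra K R] [Algebra L R]
    [IsScalarTower K L R] (M : Matrix (Fin n) (Fin n) R) (p : MvPolynomial (Fin n × Fin n) K) :
    evalAt M (map (algebraMap K L) p) = evalAt M p :=
  aeval_map_algebraMap L _ p

theorem evalAt_map_map (M : Matrix (Fin n) (Fin n) K) (p : MvPolynomial (Fin n × Fin n) K) :
    evalAt (M.map (algebraMap K L)) (map (algebraMap K L) p) = algebraMap K L (evalAt M p) := by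
  rw [evalAt_map_algebraMap]
  exact (algHom_evalAt (Algebra.ofId K L) M p).symm

theorem dirDeriv_map (p : MvPolynomial (Fin n × Fin n) K) (M : Matrix (Fin n) (Fin n) K)
    (X : Matrix (Fin n) (Fin n) L) :
    dirDeriv (map (algebraMap K L) p) (M.map (algebraMap K L)) X =
      ∑ ij : Fin n × Fin n, algebraMap K L (evalAt M (pderiv ij p)) * X ij.1 ij.2 := by
  rw [dirDeriv]
  refine Finset.sum_congr rfl fun ij _ => ?_
  rw [pderiv_map, ← evalAt_map_map]
  congr 1

theorem dirDeriv_map_map (p : MvPolynomial (Fin n × Fin n) K) (M X : Matrix (Fin n) (Fin n) K) :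
    dirDeriv (map (algebraMap K L) p) (M.map (algebraMap K L)) (X.map (algebraMap K L)) =
      algebraMap K L (dirDeriv p M X) := by
  rw [dirDeriv_map, dirDeriv, map_sum]
  refine Finset.sum_congr rfl fun ij _ => ?_
  rw [map_mul, Matrix.map_apply]
  congr 2

theorem Matrix.map_algebraMap_one {m : Type*} [DecidableEq m] :
    (1 : Matrix m m K).map (algebraMap K L) = 1 :=
  Matrix.map_one _ (map_zero _) (map_one _)

theorem Matrix.map_algebraMap_injective {m r : Type*} :
    Function.Injective fun X : Matrix m r K => X.map (algebraMap K L) :=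
  Matrix.map_injective (algebraMap K L).injective

theorem diffOne_map {m : Type*} (P : Matrix m m (MvPolynomial (Fin n × Fin n) K))
    (X : Matrix (Fin n) (Fin n) K) :
    diffOne (P.map (map (algebraMap K L))) (X.map (algebraMap K L)) =
      (diffOne P X).map (algebraMap K L) := by
  ext i j
  rw [diffOne_apply, Matrix.map_apply, Matrix.map_apply, diffOne_apply,
    ← dirDeriv_map_map (L := L), Matrix.map_algebraMap_one]

theorem map_evalAt_map {m : Type*} (P : Matrix m m (MvPolynomial (Fin n × Fin n) K))
    (M : Matrix (Fin n) (Fin n) K) :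
    (P.map (map (algebraMap K L))).map (evalAt (M.map (algebraMap K L))) =
      (P.map (evalAt M)).map (algebraMap K L) := by
  ext i j
  simp only [Matrix.map_apply, evalAt_map_map]

end FieldExtension

variable {K : Type*} [Field K] {n : ℕ} (G : LinearAlgebraicGroup K n)

theorem LinearAlgebraicGroup.isClosed_geomPoints :
    @IsClosed _ (zariskiTopology n (AlgebraicClosure K))
      (G.geomPoints : Set (GL (Fin n) (AlgebraicClosure K))) := by
  obtain ⟨S, hS⟩ := G.definedOver
  rw [isClosed_zariskiTopology_iff]
  refine ⟨map (algebraMap K (AlgebraicClosure K)) '' S, ?_⟩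
  ext g
  rw [SetLike.mem_coe, hS, Set.mem_ofPred_eq, Set.forall_mem_image]
  refine forall₂_congr fun f _ => ?_
  rw [eval_map, aeval_def]

theorem LinearAlgebraicGroup.map_mem_geomPoints
    (τ : AlgebraicClosure K ≃ₐ[K] AlgebraicClosure K) {g : GL (Fin n) (AlgebraicClosure K)}
    (hg : g ∈ G.geomPoints) :
    Matrix.GeneralLinearGroup.map (τ : AlgebraicClosure K →+* AlgebraicClosure K) g ∈
      G.geomPoints := by
  obtain ⟨S, hS⟩ := G.definedOver
  rw [hS] at hg ⊢
  intro f hf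
  have h := algHom_evalAt (F := K) (τ : AlgebraicClosure K →ₐ[K] AlgebraicClosure K)
    (g : Matrix (Fin n) (Fin n) (AlgebraicClosure K)) f
  have h0 : evalAt (g : Matrix (Fin n) (Fin n) (AlgebraicClosure K)) f = 0 := hg f hf
  rw [h0, map_zero] at h
  exact h.symm

theorem LinearAlgebraicGroup.map_mem_groupIdeal_iff (p : MvPolynomial (Fin n × Fin n) K) :
    map (algebraMap K (AlgebraicClosure K)) p ∈ groupIdeal G.geomPoints ↔
      ∀ g ∈ G.geomPoints, aeval g.entries p = 0 := by
  rw [mem_groupIdeal]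
  refine forall₂_congr fun g _ => ?_
  rw [evalAt_map_algebraMap]
  rfl

/-- The ideal over the closure is Galois stable, hence spanned by rational polynomials, so the
rational equations already define the tangent space. -/
theorem LinearAlgebraicGroup.mem_lieAlgebra_iff [CharZero K] {X : Matrix (Fin n) (Fin n) K} :
    X ∈ G.lieAlgebra ↔
      X.map (algebraMap K (AlgebraicClosure K)) ∈ tangentSpace G.geomPoints := by
  constructor
  · intro hX f hf
    have hspan := MvPolynomial.mem_span_of_galois_stable (K := K)
      ((groupIdeal G.geomPoints).restrictScalars (AlgebraicClosure K)) (by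
        intro τ f hf g hg
        have h1 := hf _ (G.map_mem_geomPoints τ.symm hg)
        have h2 : evalAt (g : Matrix (Fin n) (Fin n) (AlgebraicClosure K))
            (map (τ : AlgebraicClosure K →+* AlgebraicClosure K) f) =
            τ (evalAt ((Matrix.GeneralLinearGroup.map
              (τ.symm : AlgebraicClosure K →+* AlgebraicClosure K) g :
              GL (Fin n) (AlgebraicClosure K)) :
              Matrix (Fin n) (Fin n) (AlgebraicClosure K)) f) := by
          rw [← eval_eq_evalAt, ← eval_eq_evalAt, eval_map, eval]
          have h3 := hom_eval₂ f (RingHom.id (AlgebraicClosure K))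
            (τ : AlgebraicClosure K →+* AlgebraicClosure K)
            (fun kl => ((Matrix.GeneralLinearGroup.map
              (τ.symm : AlgebraicClosure K →+* AlgebraicClosure K) g :
              GL (Fin n) (AlgebraicClosure K)) :
              Matrix (Fin n) (Fin n) (AlgebraicClosure K)) kl.1 kl.2)
          refine Eq.trans ?_ h3.symm
          rw [RingHom.comp_id]
          congr 1
          ext kl
          simp
        rw [h2, h1, map_zero]) hf
    rw [← differential_apply]
    clear hf
    have h0 : ∀ Y, differential (n := n) (0 : MvPolynomial _ (AlgebraicClosure K)) 1 Y = 0 :=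
      fun Y => by rw [differential_apply, ← dirDerivₗ_apply, map_zero]
    induction hspan using Submodule.span_induction with
    | mem f hf =>
      obtain ⟨hf, p, rfl⟩ := hf
      rw [differential_apply, ← Matrix.map_algebraMap_one (K := K), dirDeriv_map_map,
        hX p ((G.map_mem_groupIdeal_iff p).1 hf), map_zero]
    | zero => exact h0 _
    | add f g _ _ hf hg =>
      rw [differential_apply, ← dirDerivₗ_apply] at hf hg ⊢
      rw [map_add, hf, hg, add_zero]
    | smul c f _ hf =>
      rw [differential_apply, ← dirDerivₗ_apply] at hf ⊢
      rw [map_smul, hf, smul_zero]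
  · intro hX p hp
    have := hX _ ((G.map_mem_groupIdeal_iff p).2 hp)
    rw [← Matrix.map_algebraMap_one (K := K), dirDeriv_map_map] at this
    exact (map_eq_zero_iff _ (algebraMap K (AlgebraicClosure K)).injective).1 this

/-- Applying a `K`-linear functional of the closure to the entries of `X` preserves the rational
tangent equations. Taking the coordinates in a `K`-basis of the closure decomposes `X`. -/
theorem LinearAlgebraicGroup.tangentSpace_le_span {X : Matrix (Fin n) (Fin n) (AlgebraicClosure K)}
    (hX : X ∈ tangentSpace G.geomPoints) :
    X ∈ Submodule.span (AlgebraicClosure K)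
      ((fun Y : Matrix (Fin n) (Fin n) K => Y.map (algebraMap K (AlgebraicClosure K))) ''
        (G.lieAlgebra : Set (Matrix (Fin n) (Fin n) K))) := by
  have hφ : ∀ φ : AlgebraicClosure K →ₗ[K] K, X.map φ ∈ G.lieAlgebra := by
    intro φ p hp
    have h1 := hX _ ((G.map_mem_groupIdeal_iff p).2 hp)
    rw [← Matrix.map_algebraMap_one (K := K), dirDeriv_map] at h1
    have h2 := congrArg φ h1
    rw [map_sum, map_zero] at h2
    rw [← h2, dirDeriv]
    refine Finset.sum_congr rfl fun ij _ => ?_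
    rw [← Algebra.smul_def, map_smul, smul_eq_mul, Matrix.map_apply]
    congr 1
  classical
  let b := Module.Basis.ofVectorSpace K (AlgebraicClosure K)
  let s := Finset.univ.biUnion fun ij : Fin n × Fin n => (b.repr (X ij.1 ij.2)).support
  have hsum : X = ∑ i ∈ s, b i • (X.map (b.coord i)).map (algebraMap K (AlgebraicClosure K)) := by
    ext k l
    rw [Matrix.sum_apply]
    conv_lhs => rw [← b.linearCombination_repr (X k l)]
    rw [Finsupp.linearCombination_apply, Finsupp.sum_of_support_subset (s := s)]
    · refine Finset.sum_congr rfl fun i _ => ?_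
      rw [Matrix.smul_apply, Matrix.map_apply, Matrix.map_apply, smul_eq_mul, mul_comm,
        ← Algebra.smul_def]
      rfl
    · exact Finset.subset_biUnion_of_mem
        (fun ij : Fin n × Fin n => (b.repr (X ij.1 ij.2)).support) (Finset.mem_univ (k, l))
    · simp
  rw [hsum]
  exact sum_mem fun i _ => Submodule.smul_mem _ _ (Submodule.subset_span ⟨_, hφ _, rfl⟩)

end Descent

/-! ## Rational representations -/

section RationalRepresentations

open LinearAlgebraicGroup

variable {K : Type*} [Field K] [CharZero K] {n : ℕ} {G : LinearAlgebraicGroup K n}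

/-- `H` lies in the radical, which is generated by normal unipotent subgroups. Each of these is
congruent to `1` modulo the trace radical, so their join is too. -/
theorem LinearAlgebraicGroup.le_congruenceSubgroup (hrad : G.radical = G.unipotentRadical)
    {H : Subgroup (GL (Fin n) (AlgebraicClosure K))} (hle : H ≤ G.geomPoints)
    (hnorm : ∀ g ∈ G.geomPoints, ∀ h ∈ H, g * h * g⁻¹ ∈ H)
    (hclosed : @IsClosed _ (zariskiTopology n (AlgebraicClosure K)) (H : Set _))
    (hconn : @IsConnected _ (zariskiTopology n (AlgebraicClosure K)) (H : Set _))
    (hsolv : Group.IsSolvable H) : H ≤ congruenceSubgroup G.geomPoints 0 := by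
  have h1 : H ≤ G.radical := le_sSup (a := H)
    ⟨⟨hle, ⟨fun h hh g => hnorm g g.2 h hh⟩, hclosed, hconn⟩, hsolv⟩
  rw [hrad] at h1
  refine h1.trans (sSup_le ?_)
  rintro U ⟨hU, huni⟩
  refine le_congruenceSubgroup_of_unipotent hU.le (fun g hg h hh => ?_) huni
  exact hU.normal.conj_mem ⟨h, hU.le hh⟩ hh ⟨g, hg⟩

theorem LinearAlgebraicGroup.character_eq_one (hconn : G.IsZariskiConnected)
    (hrad : G.radical = G.unipotentRadical)
    {χ : MvPolynomial (Fin n × Fin n) (AlgebraicClosure K)}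
    (h1 : evalAt (1 : Matrix (Fin n) (Fin n) (AlgebraicClosure K)) χ = 1)
    (hmul : ∀ g ∈ G.geomPoints, ∀ h ∈ G.geomPoints,
      evalAt ((g : Matrix (Fin n) (Fin n) (AlgebraicClosure K)) *
          (h : Matrix (Fin n) (Fin n) (AlgebraicClosure K))) χ =
        evalAt (g : Matrix (Fin n) (Fin n) (AlgebraicClosure K)) χ *
          evalAt (h : Matrix (Fin n) (Fin n) (AlgebraicClosure K)) χ)
    {g : GL (Fin n) (AlgebraicClosure K)} (hg : g ∈ G.geomPoints) :
    evalAt (g : Matrix (Fin n) (Fin n) (AlgebraicClosure K)) χ = 1 := by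
  have := groupIdeal_isPrime G.geomPoints hconn
  refine IsPolyRep.character_eq_one G.isClosed_geomPoints
    (fun H => G.le_congruenceSubgroup hrad) (χ := χ) ⟨?_, fun g hg h hh => ?_⟩ hg
  · ext
    simp [h1]
  · ext
    simp [Matrix.mul_apply, hmul g hg h hh]

/-- The determinant is a polynomial character. The result removes the denominators of regular
functions and makes the inverse polynomial. -/
theorem LinearAlgebraicGroup.det_eq_one (hconn : G.IsZariskiConnected)
    (hrad : G.radical = G.unipotentRadical) {g : GL (Fin n) (AlgebraicClosure K)}
    (hg : g ∈ G.geomPoints) :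
    (g : Matrix (Fin n) (Fin n) (AlgebraicClosure K)).det = 1 := by
  have hdet : ∀ M : Matrix (Fin n) (Fin n) (AlgebraicClosure K),
      evalAt M (Matrix.mvPolynomialX (Fin n) (Fin n) (AlgebraicClosure K)).det = M.det := by
    intro M
    rw [AlgHom.map_det]
    congr 1
    exact evalAt_mvPolynomialX M
  rw [← hdet]
  refine G.character_eq_one hconn hrad ?_ (fun g _ h _ => ?_) hg
  · rw [hdet, Matrix.det_one]
  · rw [hdet, hdet, hdet, Matrix.det_mul]

theorem LinearAlgebraicGroup.lie_mem_lieAlgebra {X Y : Matrix (Fin n) (Fin n) K}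
    (hX : X ∈ G.lieAlgebra) (hY : Y ∈ G.lieAlgebra) : X * Y - Y * X ∈ G.lieAlgebra := by
  rw [mem_lieAlgebra_iff] at hX hY ⊢
  rw [Matrix.map_sub _ (map_sub _), Matrix.map_mul, Matrix.map_mul]
  exact lie_mem_tangentSpace hX hY

variable {m : Type*} [Fintype m] [DecidableEq m] {P : Matrix m m (MvPolynomial (Fin n × Fin n) K)}

theorem LinearAlgebraicGroup.diffOne_lie
    (hP : IsPolyRep G.geomPoints (P.map (map (algebraMap K (AlgebraicClosure K)))))
    {X Y : Matrix (Fin n) (Fin n) K} (hX : X ∈ G.lieAlgebra) (hY : Y ∈ G.lieAlgebra) :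
    diffOne P (X * Y - Y * X) = diffOne P X * diffOne P Y - diffOne P Y * diffOne P X := by
  apply Matrix.map_algebraMap_injective (K := K) (L := AlgebraicClosure K)
  have h1 := hP.diffOne_lie (G.mem_lieAlgebra_iff.1 hX) (G.mem_lieAlgebra_iff.1 hY)
  rw [← Matrix.map_mul, ← Matrix.map_mul, ← Matrix.map_sub _ (map_sub _), diffOne_map, diffOne_map,
    diffOne_map, ← Matrix.map_mul, ← Matrix.map_mul, ← Matrix.map_sub _ (map_sub _)] at h1
  exact h1

omit [CharZero K] in
theorem LinearAlgebraicGroup.coe_toGeom (g : G.points) :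
    ((G.toGeom g : GL (Fin n) (AlgebraicClosure K)) :
      Matrix (Fin n) (Fin n) (AlgebraicClosure K)) =
      ((g : GL (Fin n) K) : Matrix (Fin n) (Fin n) K).map (algebraMap K (AlgebraicClosure K)) :=
  rfl

theorem LinearAlgebraicGroup.diffOne_conj
    (hP : IsPolyRep G.geomPoints (P.map (map (algebraMap K (AlgebraicClosure K)))))
    (g : G.points) {X : Matrix (Fin n) (Fin n) K} (hX : X ∈ G.lieAlgebra) :
    diffOne P (((g : GL (Fin n) K) : Matrix (Fin n) (Fin n) K) * X *
      ((g⁻¹ : G.points) : GL (Fin n) K)) =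
      P.map (evalAt ((g : GL (Fin n) K) : Matrix (Fin n) (Fin n) K)) * diffOne P X *
        P.map (evalAt (((g⁻¹ : G.points) : GL (Fin n) K) : Matrix (Fin n) (Fin n) K)) := by
  apply Matrix.map_algebraMap_injective (K := K) (L := AlgebraicClosure K)
  have h1 := hP.diffOne_conj (G.mem_lieAlgebra_iff.1 hX) (G.toGeom g).2
  rw [← Subgroup.coe_inv, ← map_inv, G.coe_toGeom, G.coe_toGeom, ← Matrix.map_mul,
    ← Matrix.map_mul, diffOne_map, diffOne_map, map_evalAt_map, map_evalAt_map, ← Matrix.map_mul,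
    ← Matrix.map_mul] at h1
  exact h1

omit [CharZero K] in
theorem LinearAlgebraicGroup.map_evalAt_mul
    (hP : IsPolyRep G.geomPoints (P.map (map (algebraMap K (AlgebraicClosure K)))))
    (g h : G.points) :
    P.map (evalAt (((g * h : G.points) : GL (Fin n) K) : Matrix (Fin n) (Fin n) K)) =
      P.map (evalAt ((g : GL (Fin n) K) : Matrix (Fin n) (Fin n) K)) *
        P.map (evalAt ((h : GL (Fin n) K) : Matrix (Fin n) (Fin n) K)) := by
  apply Matrix.map_algebraMap_injective (K := K) (L := AlgebraicClosure K)
  have h1 := hP.map_mul _ (G.toGeom g).2 _ (G.toGeom h).2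
  rw [← Units.val_mul, ← Subgroup.coe_mul, ← _root_.map_mul, G.coe_toGeom, G.coe_toGeom,
    G.coe_toGeom, map_evalAt_map, map_evalAt_map, map_evalAt_map, ← Matrix.map_mul] at h1
  exact h1

omit [CharZero K] in
theorem LinearAlgebraicGroup.map_evalAt_one
    (hP : IsPolyRep G.geomPoints (P.map (map (algebraMap K (AlgebraicClosure K))))) :
    P.map (evalAt (1 : Matrix (Fin n) (Fin n) K)) = 1 := by
  apply Matrix.map_algebraMap_injective (K := K) (L := AlgebraicClosure K)
  have h1 := hP.map_one
  rw [← Matrix.map_algebraMap_one (K := K), map_evalAt_map] at h1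
  exact h1.trans Matrix.map_algebraMap_one.symm

/-- Exponentials of nilpotent elements of the Lie algebra are rational points. -/
theorem LinearAlgebraicGroup.exists_points_eq_exp {X : Matrix (Fin n) (Fin n) K}
    (hX : X ∈ G.lieAlgebra) (hnil : IsNilpotent X) :
    ∃ u : G.points, ((u : GL (Fin n) K) : Matrix (Fin n) (Fin n) K) = IsNilpotent.exp X := by
  obtain ⟨u, hu⟩ := IsNilpotent.isUnit_exp hnil
  refine ⟨⟨u, ?_⟩, hu⟩
  refine mem_of_isClosed G.isClosed_geomPoints fun f hf => ?_
  have hnil' : IsNilpotent (X.map (algebraMap K (AlgebraicClosure K))) :=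
    hnil.map (algebraMap K (AlgebraicClosure K)).mapMatrix
  have h1 := evalAt_exp_eq_zero hnil' (G.mem_lieAlgebra_iff.1 hX) hf
  have h2 := hnil.map_exp (algebraMap K (AlgebraicClosure K)).mapMatrix
  rw [← hu] at h2
  rw [← h1]
  congr 2

theorem LinearAlgebraicGroup.isNilpotent_diffOne
    (hP : IsPolyRep G.geomPoints (P.map (map (algebraMap K (AlgebraicClosure K)))))
    {X : Matrix (Fin n) (Fin n) K} (hX : X ∈ G.lieAlgebra) (hnil : IsNilpotent X) :
    IsNilpotent (diffOne P X) := by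
  have hnil' : IsNilpotent (X.map (algebraMap K (AlgebraicClosure K))) :=
    hnil.map (algebraMap K (AlgebraicClosure K)).mapMatrix
  obtain ⟨k, hk⟩ := hP.isNilpotent_diffOne hnil' (G.mem_lieAlgebra_iff.1 hX)
  refine ⟨k, Matrix.map_algebraMap_injective (K := K) (L := AlgebraicClosure K) ?_⟩
  rw [diffOne_map] at hk
  have h1 := map_pow (algebraMap K (AlgebraicClosure K)).mapMatrix (diffOne P X) k
  change (diffOne P X ^ k).map (algebraMap K (AlgebraicClosure K)) = Matrix.map 0 _
  rw [Matrix.map_zero _ (map_zero _), ← hk]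
  exact h1

theorem LinearAlgebraicGroup.map_evalAt_exp
    (hP : IsPolyRep G.geomPoints (P.map (map (algebraMap K (AlgebraicClosure K)))))
    {X : Matrix (Fin n) (Fin n) K} (hX : X ∈ G.lieAlgebra) (hnil : IsNilpotent X) :
    P.map (evalAt (IsNilpotent.exp X)) = IsNilpotent.exp (diffOne P X) := by
  have hnil' : IsNilpotent (X.map (algebraMap K (AlgebraicClosure K))) :=
    hnil.map (algebraMap K (AlgebraicClosure K)).mapMatrix
  apply Matrix.map_algebraMap_injective (K := K) (L := AlgebraicClosure K)
  have h1 := hP.map_exp hnil' (G.mem_lieAlgebra_iff.1 hX)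
  have h2 : IsNilpotent.exp (X.map (algebraMap K (AlgebraicClosure K))) =
      (IsNilpotent.exp X).map (algebraMap K (AlgebraicClosure K)) :=
    (hnil.map_exp (algebraMap K (AlgebraicClosure K)).mapMatrix).symm
  rw [h2, map_evalAt_map, diffOne_map] at h1
  exact h1.trans ((G.isNilpotent_diffOne hP hX hnil).map_exp
    (algebraMap K (AlgebraicClosure K)).mapMatrix).symm

/-- Stability of the column space of `V` extends linearly from the rational Lie algebra to the
tangent space over the closure, which it spans, and then passes to the group. -/
theorem LinearAlgebraicGroup.map_evalAt_mul_eq_of_stable (hconn : G.IsZariskiConnected)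
    (hP : IsPolyRep G.geomPoints (P.map (map (algebraMap K (AlgebraicClosure K)))))
    {r : Type*} [Fintype r] [DecidableEq r] {U : Matrix r m K} {V : Matrix m r K} (hUV : U * V = 1)
    (hstab : ∀ X ∈ G.lieAlgebra, ∃ x : Matrix r r K, diffOne P X * V = V * x)
    {g : GL (Fin n) (AlgebraicClosure K)} (hg : g ∈ G.geomPoints) :
    (P.map (map (algebraMap K (AlgebraicClosure K)))).map
        (evalAt (g : Matrix (Fin n) (Fin n) (AlgebraicClosure K))) *
        V.map (algebraMap K (AlgebraicClosure K)) =
      V.map (algebraMap K (AlgebraicClosure K)) * (U.map (algebraMap K (AlgebraicClosure K)) *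
        (P.map (map (algebraMap K (AlgebraicClosure K)))).map
          (evalAt (g : Matrix (Fin n) (Fin n) (AlgebraicClosure K))) *
        V.map (algebraMap K (AlgebraicClosure K))) := by
  have := groupIdeal_isPrime G.geomPoints hconn
  set L := AlgebraicClosure K
  set PL := P.map (map (algebraMap K L)) with hPL
  set UL := U.map (algebraMap K L) with hUL
  set VL := V.map (algebraMap K L) with hVL
  have hUVL : UL * VL = 1 := by
    rw [hUL, hVL, ← Matrix.map_mul, hUV, Matrix.map_algebraMap_one]
  have hstabL : ∀ A ∈ tangentSpace G.geomPoints, ∃ x : Matrix r r L,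
      diffOne PL A * VL = VL * x := by
    intro A hA
    have hA' := G.tangentSpace_le_span hA
    clear hA
    induction hA' using Submodule.span_induction with
    | mem A hA =>
      obtain ⟨X, hX, rfl⟩ := hA
      obtain ⟨x, hx⟩ := hstab X hX
      refine ⟨x.map (algebraMap K L), ?_⟩
      rw [hPL, diffOne_map, hVL, ← Matrix.map_mul, hx, Matrix.map_mul]
    | zero => exact ⟨0, by simp⟩
    | add A B _ _ hA hB =>
      obtain ⟨x, hx⟩ := hA
      obtain ⟨y, hy⟩ := hB
      exact ⟨x + y, by rw [_root_.map_add, Matrix.add_mul, hx, hy, Matrix.mul_add]⟩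
    | smul c A _ hA =>
      obtain ⟨x, hx⟩ := hA
      exact ⟨c • x, by rw [map_smul, Matrix.smul_mul, hx, Matrix.mul_smul]⟩
  have h1 : ∀ j : r, ∃ y : r → L, VL.mulVec y =
      (PL.map (evalAt (g : Matrix (Fin n) (Fin n) L)) * VL).col j := by
    intro j
    have h2 := hP.mulVec_mem (LinearMap.range VL.mulVecLin) (by
      rintro A hA _ ⟨y, rfl⟩
      obtain ⟨x, hx⟩ := hstabL A hA
      refine ⟨x.mulVec y, ?_⟩
      rw [Matrix.mulVecLin_apply, Matrix.mulVecLin_apply, Matrix.mulVec_mulVec,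
        Matrix.mulVec_mulVec, ← hx]) hg (w := VL.mulVec (Pi.single j 1)) ⟨_, rfl⟩
    obtain ⟨y, hy⟩ := h2
    refine ⟨y, ?_⟩
    rw [Matrix.mulVecLin_apply, Matrix.mulVec_mulVec, Matrix.mulVec_single_one] at hy
    exact hy
  choose y hy using h1
  have h3 : PL.map (evalAt (g : Matrix (Fin n) (Fin n) L)) * VL = VL * (Matrix.of y).transpose := by
    ext i j
    have := congrFun (hy j) i
    rw [Matrix.col_apply] at this
    rw [← this]
    rfl
  rw [Matrix.mul_assoc UL, h3, ← Matrix.mul_assoc UL, hUVL, Matrix.one_mul]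

/-- The group preserves the subspaces stable under the Lie algebra. -/
theorem LinearAlgebraicGroup.mul_eq_of_stable (hconn : G.IsZariskiConnected)
    (hP : IsPolyRep G.geomPoints (P.map (map (algebraMap K (AlgebraicClosure K)))))
    {r : Type*} [Fintype r] [DecidableEq r] {U : Matrix r m K} {V : Matrix m r K} (hUV : U * V = 1)
    (hstab : ∀ X ∈ G.lieAlgebra, ∃ x : Matrix r r K, diffOne P X * V = V * x) (g : G.points) :
    P.map (evalAt ((g : GL (Fin n) K) : Matrix (Fin n) (Fin n) K)) * V =
      V * (U * P.map (evalAt ((g : GL (Fin n) K) : Matrix (Fin n) (Fin n) K)) * V) := by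
  have h := G.map_evalAt_mul_eq_of_stable hconn hP hUV hstab (G.toGeom g).2
  rw [G.coe_toGeom, map_evalAt_map, ← Matrix.map_mul, ← Matrix.map_mul, ← Matrix.map_mul,
    ← Matrix.map_mul] at h
  exact Matrix.map_algebraMap_injective h

/-- The group acts with determinant one on subspaces stable under the Lie algebra. -/
theorem LinearAlgebraicGroup.det_eq_one_of_stable (hconn : G.IsZariskiConnected)
    (hrad : G.radical = G.unipotentRadical)
    (hP : IsPolyRep G.geomPoints (P.map (map (algebraMap K (AlgebraicClosure K)))))
    {r : Type*} [Fintype r] [DecidableEq r] {U : Matrix r m K} {V : Matrix m r K} (hUV : U * V = 1)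
    (hstab : ∀ X ∈ G.lieAlgebra, ∃ x : Matrix r r K, diffOne P X * V = V * x) (g : G.points) :
    (U * P.map (evalAt ((g : GL (Fin n) K) : Matrix (Fin n) (Fin n) K)) * V).det = 1 := by
  set L := AlgebraicClosure K
  set PL := P.map (map (algebraMap K L)) with hPL
  set UL := U.map (algebraMap K L) with hUL
  set VL := V.map (algebraMap K L) with hVL
  have hUVL : UL * VL = 1 := by
    rw [hUL, hVL, ← Matrix.map_mul, hUV, Matrix.map_algebraMap_one]
  have hmem : ∀ g ∈ G.geomPoints, PL.map (evalAt (g : Matrix (Fin n) (Fin n) L)) * VL =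
      VL * (UL * PL.map (evalAt (g : Matrix (Fin n) (Fin n) L)) * VL) :=
    fun g hg => G.map_evalAt_mul_eq_of_stable hconn hP hUV hstab hg
  -- The determinant of the action on the column space of `V`, as a polynomial; stability of that
  -- space makes it multiplicative on the group.
  set χ := (sandwich UL PL VL).det with hχ
  have hχe : ∀ M : Matrix (Fin n) (Fin n) L,
      evalAt M χ = (UL * PL.map (evalAt M) * VL).det := by
    intro M
    rw [hχ, AlgHom.map_det, ← evalAt_sandwich]
    rfl
  have h1 : evalAt ((G.toGeom g : GL (Fin n) L) : Matrix (Fin n) (Fin n) L) χ = 1 := by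
    refine G.character_eq_one hconn hrad ?_ (fun g hg h hh => ?_) (G.toGeom g).2
    · rw [hχe, hP.map_one, Matrix.mul_one, hUVL, Matrix.det_one]
    · rw [hχe, hχe, hχe, hP.map_mul g hg h hh, ← Matrix.det_mul, Matrix.mul_assoc UL,
        Matrix.mul_assoc (PL.map _), hmem h hh, Matrix.mul_assoc UL, Matrix.mul_assoc UL,
        ← Matrix.mul_assoc (PL.map _) VL, ← Matrix.mul_assoc UL]
  rw [hχe, G.coe_toGeom, map_evalAt_map, hUL, hVL, ← Matrix.map_mul, ← Matrix.map_mul] at h1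
  apply (algebraMap K L).injective
  rw [RingHom.map_det, _root_.map_one, ← h1]
  rfl

end RationalRepresentations

/-! ## Sums of eigenspaces -/

section EigenspaceSums

variable {K : Type*} [Field K] {V V' V'' : Type*} [AddCommGroup V] [Module K V] [AddCommGroup V']
  [Module K V'] [AddCommGroup V''] [Module K V'']

/-- The sum of the eigenspaces for the eigenvalues with a given property. -/
def eigenspaceSum (T : Module.End K V) (E : K → Prop) : Submodule K V :=
  ⨆ μ : {μ : K // E μ}, Module.End.eigenspace T μ

theorem mem_eigenspaceSum {T : Module.End K V} {E : K → Prop} {μ : K} (hμ : E μ) {v : V}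
    (hv : T v = μ • v) : v ∈ eigenspaceSum T E :=
  le_iSup (fun μ : {μ : K // E μ} => Module.End.eigenspace T (μ : K)) ⟨μ, hμ⟩
    (Module.End.mem_eigenspace_iff.2 hv)

theorem eigenspaceSum_le {T : Module.End K V} {E : K → Prop} {p : Submodule K V}
    (h : ∀ μ, E μ → ∀ v, T v = μ • v → v ∈ p) : eigenspaceSum T E ≤ p :=
  iSup_le fun μ v hv => h μ μ.2 v (Module.End.mem_eigenspace_iff.1 hv)

theorem eigenspaceSum_mono {T : Module.End K V} {E E' : K → Prop} (h : ∀ μ, E μ → E' μ) :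
    eigenspaceSum T E ≤ eigenspaceSum T E' :=
  eigenspaceSum_le fun μ hμ _ hv => mem_eigenspaceSum (h μ hμ) hv

theorem eigenspaceSum_or (T : Module.End K V) (E E' : K → Prop) :
    eigenspaceSum T (fun μ => E μ ∨ E' μ) = eigenspaceSum T E ⊔ eigenspaceSum T E' := by
  refine le_antisymm (eigenspaceSum_le fun μ hμ v hv => ?_)
    (sup_le (eigenspaceSum_mono fun μ => Or.inl) (eigenspaceSum_mono fun μ => Or.inr))
  rcases hμ with h | h
  · exact le_sup_left (b := eigenspaceSum T E') (mem_eigenspaceSum h hv)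
  · exact le_sup_right (a := eigenspaceSum T E) (mem_eigenspaceSum h hv)

theorem eigenspaceSum_eq (T : Module.End K V) (c : K) :
    eigenspaceSum T (fun μ => μ = c) = Module.End.eigenspace T c :=
  le_antisymm (eigenspaceSum_le fun _ hμ _ hv => Module.End.mem_eigenspace_iff.2 (hμ ▸ hv))
    fun _ hv => mem_eigenspaceSum (E := fun μ => μ = c) (μ := c) rfl
      (Module.End.mem_eigenspace_iff.1 hv)

theorem map_mem_eigenspaceSum {T : Module.End K V} {T' : Module.End K V'} (e : V →ₗ[K] V')
    (he : ∀ v, e (T v) = T' (e v)) {E : K → Prop} {v : V} (hv : v ∈ eigenspaceSum T E) :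
    e v ∈ eigenspaceSum T' E := by
  have : eigenspaceSum T E ≤ (eigenspaceSum T' E).comap e := eigenspaceSum_le fun μ hμ v hv =>
    mem_eigenspaceSum hμ (by rw [← he, hv, map_smul])
  exact this hv

theorem map₂_mem_eigenspaceSum {T : Module.End K V} {T' : Module.End K V'} {T'' : Module.End K V''}
    (B : V →ₗ[K] V' →ₗ[K] V'') (hB : ∀ v v', T'' (B v v') = B (T v) (T' v')) {E E' E'' : K → Prop}
    (hE : ∀ μ ν, E μ → E' ν → E'' (μ * ν)) {v : V} (hv : v ∈ eigenspaceSum T E) {v' : V'}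
    (hv' : v' ∈ eigenspaceSum T' E') : B v v' ∈ eigenspaceSum T'' E'' := by
  have h1 : eigenspaceSum T E ≤ (eigenspaceSum T'' E'').comap (B.flip v') := by
    refine eigenspaceSum_le fun μ hμ v hv => ?_
    have h2 : eigenspaceSum T' E' ≤ (eigenspaceSum T'' E'').comap (B v) :=
      eigenspaceSum_le fun ν hν v' hv' => mem_eigenspaceSum (hE μ ν hμ hν) (by
        rw [hB, hv, hv', map_smul, map_smul, LinearMap.smul_apply, smul_smul, mul_comm])
    exact h2 hv'
  exact h1 hv

theorem disjoint_eigenspaceSum (T : Module.End K V) {E E' : K → Prop} (h : ∀ μ, E μ → ¬ E' μ) :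
    Disjoint (eigenspaceSum T E) (eigenspaceSum T E') := by
  have h1 := T.eigenspaces_iSupIndep.disjoint_biSup_biSup (s := {μ | E μ}) (t := {μ | E' μ})
    (Set.disjoint_left.2 h)
  rw [eigenspaceSum, eigenspaceSum, iSup_subtype, iSup_subtype]
  exact h1

theorem eigenvalue_of_mem_eigenspaceSum {T : Module.End K V} {E : K → Prop} {v : V} (hv0 : v ≠ 0)
    (hv : v ∈ eigenspaceSum T E) {μ : K} (hμ : T v = μ • v) : E μ := by
  by_contra hcon
  have h1 := disjoint_eigenspaceSum T (E := fun x => x = μ) (E' := E) (by rintro _ rfl; exact hcon)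
  exact hv0 (Submodule.disjoint_def.1 h1 v
    (mem_eigenspaceSum (E := fun x => x = μ) (μ := μ) rfl hμ) hv)

/-- The linear factors are pairwise coprime, so the kernel of the product is the sum of the
eigenspaces. -/
theorem eigenspaceSum_eq_top_of_aeval_eq_zero {T : Module.End K V} {s : Finset K}
    (hT : Polynomial.aeval T (∏ μ ∈ s, (Polynomial.X - Polynomial.C μ)) = 0) {E : K → Prop}
    (hE : ∀ μ ∈ s, E μ) : eigenspaceSum T E = ⊤ := by
  classical
  have key : ∀ s : Finset K, (∀ μ ∈ s, E μ) →
      LinearMap.ker (Polynomial.aeval T (∏ μ ∈ s, (Polynomial.X - Polynomial.C μ))) ≤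
        eigenspaceSum T E := by
    intro s
    induction s using Finset.induction_on with
    | empty =>
      intro _ v hv
      rw [Finset.prod_empty, map_one, LinearMap.mem_ker, Module.End.one_apply] at hv
      rw [hv]
      exact zero_mem _
    | insert a s ha ih =>
      intro hE
      rw [Finset.prod_insert ha, ← Polynomial.sup_ker_aeval_eq_ker_aeval_mul_of_coprime]
      · refine sup_le (fun v hv => ?_) (ih fun μ hμ => hE μ (Finset.mem_insert_of_mem hμ))
        refine mem_eigenspaceSum (hE a (Finset.mem_insert_self _ _)) ?_
        rw [LinearMap.mem_ker] at hv
        simpa [sub_eq_zero] using hv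
      · refine IsCoprime.prod_right fun μ hμ => Polynomial.isCoprime_X_sub_C_of_isUnit_sub ?_
        have hne : a ≠ μ := by
          rintro rfl
          exact ha hμ
        exact (sub_ne_zero.2 hne).isUnit
  have h1 := key s hE
  rw [hT, LinearMap.ker_zero] at h1
  exact top_le_iff.1 h1

theorem aeval_eq_zero_of_injective {T : Module.End K V} {T' : Module.End K V'} (e : V →ₗ[K] V')
    (hinj : Function.Injective e) (he : ∀ v, e (T v) = T' (e v)) {p : Polynomial K}
    (hp : Polynomial.aeval T' p = 0) : Polynomial.aeval T p = 0 := by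
  have hpow : ∀ (k : ℕ) v, e ((T ^ k) v) = (T' ^ k) (e v) := by
    intro k
    induction k with
    | zero => intro v; rfl
    | succ k ih => intro v; rw [pow_succ, pow_succ, Module.End.mul_apply, Module.End.mul_apply, ih, he]
  ext v
  apply hinj
  have h1 := LinearMap.congr_fun hp (e v)
  rw [Polynomial.aeval_eq_sum_range, LinearMap.sum_apply] at h1 ⊢
  rw [map_sum, LinearMap.zero_apply, map_zero]
  rw [LinearMap.zero_apply] at h1
  rw [← h1]
  refine Finset.sum_congr rfl fun k _ => ?_
  rw [LinearMap.smul_apply, map_smul, hpow, LinearMap.smul_apply]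

theorem exists_basis_of_eigenspaceSum_eq_top [FiniteDimensional K V] {T : Module.End K V}
    {E : K → Prop} (h : eigenspaceSum T E = ⊤) :
    ∃ (b : Module.Basis (Fin (Module.finrank K V)) K V) (d : Fin (Module.finrank K V) → K),
      ∀ i, T (b i) = d i • b i := by
  classical
  have htop : ⨆ μ : K, T.eigenspace μ = ⊤ := by
    rw [eq_top_iff, ← h]
    exact eigenspaceSum_le fun μ _ v hv =>
      le_iSup T.eigenspace μ (Module.End.mem_eigenspace_iff.2 hv)
  have dec := DirectSum.isInternal_submodule_of_iSupIndep_of_iSup_eq_top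
    T.eigenspaces_iSupIndep htop
  obtain ⟨κ, v, c, hv⟩ : ∃ (κ : Type _) (v : Module.Basis κ K V) (c : κ → K),
      ∀ i, T (v i) = c i • v i :=
    ⟨_, dec.collectedBasis fun μ => Module.finBasis K (T.eigenspace μ), Sigma.fst, fun i =>
      Module.End.mem_eigenspace_iff.1 (dec.collectedBasis_mem _ i)⟩
  let e := (Module.finBasis K V).indexEquiv v
  refine ⟨v.reindex e.symm, fun i => c (e i), fun i => ?_⟩
  rw [Module.Basis.reindex_apply, Equiv.symm_symm, hv]

end EigenspaceSums

/-! ## Diagonalizability of the action of a diagonalizable element -/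

section Diagonalizable

variable {K : Type*} [Field K] {n : ℕ}

/-- Pair a sequence with the coefficients of a polynomial. -/
def coeffPairing (p : Polynomial K) : (ℕ → K) →ₗ[K] K :=
  ∑ k ∈ Finset.range (p.natDegree + 1), p.coeff k • LinearMap.proj k

theorem coeffPairing_apply (p : Polynomial K) (x : ℕ → K) :
    coeffPairing p x = ∑ k ∈ Finset.range (p.natDegree + 1), p.coeff k * x k := by
  simp [coeffPairing]

/-- The sequences of powers of the elements of a group of scalars. -/
def powerSequences (Λ : Subgroup Kˣ) : Λ →* (ℕ → K) where
  toFun μ k := ((μ : Kˣ) : K) ^ k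
  map_one' := by
    ext
    simp
  map_mul' μ ν := by
    ext
    simp [mul_pow]

/-- Products of power sequences of elements of `Λ` are again such sequences, so the algebra is their
span; and pairing `p` with the powers of `μ` gives `p(μ)`. -/
theorem exists_finset_of_mem_adjoin {Λ : Subgroup Kˣ} {x : ℕ → K}
    (hx : x ∈ Algebra.adjoin K (MonoidHom.mrange (powerSequences Λ) : Set (ℕ → K))) :
    ∃ s : Finset K, (∀ μ ∈ s, ∃ l ∈ Λ, (l : K) = μ) ∧
      ∀ p : Polynomial K, (∀ μ ∈ s, p.eval μ = 0) → coeffPairing p x = 0 := by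
  classical
  rw [← Subalgebra.mem_toSubmodule, Algebra.adjoin_eq_span, Submonoid.closure_eq] at hx
  induction hx using Submodule.span_induction with
  | mem x hx =>
    obtain ⟨l, rfl⟩ := hx
    refine ⟨{((l : Kˣ) : K)}, fun μ hμ => ⟨l, l.2, (Finset.mem_singleton.1 hμ).symm⟩, fun p hp => ?_⟩
    rw [coeffPairing_apply, ← hp _ (Finset.mem_singleton_self _), Polynomial.eval_eq_sum_range]
    rfl
  | zero => exact ⟨∅, by simp, by simp⟩
  | add x y _ _ hx hy =>
    obtain ⟨s, hs, hxs⟩ := hx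
    obtain ⟨t, ht, hyt⟩ := hy
    refine ⟨s ∪ t, fun μ hμ => (Finset.mem_union.1 hμ).elim (hs μ) (ht μ), fun p hp => ?_⟩
    rw [map_add, hxs p fun μ hμ => hp μ (Finset.mem_union_left t hμ),
      hyt p fun μ hμ => hp μ (Finset.mem_union_right s hμ), add_zero]
  | smul c x _ hx =>
    obtain ⟨s, hs, hxs⟩ := hx
    exact ⟨s, hs, fun p hp => by rw [map_smul, hxs p hp, smul_zero]⟩

theorem evalAt_pow_mem_adjoin {Λ : Subgroup Kˣ} {A Q Q' : Matrix (Fin n) (Fin n) K}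
    {d : Fin n → Kˣ} (hQ : Q * Q' = 1) (hA : A = Q * Matrix.diagonal (fun i => (d i : K)) * Q')
    (hd : ∀ i, d i ∈ Λ) (f : MvPolynomial (Fin n × Fin n) K) :
    (fun k : ℕ => evalAt (A ^ k) f) ∈
      Algebra.adjoin K (MonoidHom.mrange (powerSequences Λ) : Set (ℕ → K)) := by
  have hQ' : Q' * Q = 1 := mul_eq_one_comm.1 hQ
  have hpow : ∀ k : ℕ, A ^ k = Q * Matrix.diagonal (fun i => (d i : K) ^ k) * Q' := by
    intro k
    induction k with
    | zero => simp [hQ]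
    | succ k ih =>
      rw [pow_succ, ih, hA, show ∀ B C : Matrix (Fin n) (Fin n) K, Q * B * Q' * (Q * C * Q') =
        Q * (B * (Q' * Q) * C) * Q' by intro B C; simp only [mul_assoc], hQ', mul_one,
        Matrix.diagonal_mul_diagonal]
      simp only [pow_succ]
  induction f using MvPolynomial.induction_on with
  | C c =>
    have : (fun k : ℕ => evalAt (A ^ k) (C c)) = algebraMap K (ℕ → K) c := by
      ext k
      rw [evalAt_C]
      rfl
    rw [this]
    exact Subalgebra.algebraMap_mem _ c
  | add f g hf hg =>
    simp only [map_add]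
    exact add_mem hf hg
  | mul_X f ij hf =>
    simp only [map_mul]
    refine mul_mem hf ?_
    have : (fun k : ℕ => evalAt (F := K) (A ^ k) (X ij)) =
        ∑ l, (Q ij.1 l * Q' l ij.2) • powerSequences Λ ⟨d l, hd l⟩ := by
      ext k
      rw [evalAt_X, hpow, Matrix.mul_apply, Finset.sum_apply]
      refine Finset.sum_congr rfl fun l _ => ?_
      rw [Matrix.mul_diagonal, Pi.smul_apply, smul_eq_mul]
      change _ = _ * (d l : K) ^ k
      ring
    rw [this]
    refine sum_mem fun l _ => Subalgebra.smul_mem _ ?_ _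
    exact Algebra.subset_adjoin (MonoidHom.mem_mrange.2 ⟨⟨d l, hd l⟩, rfl⟩)

/-- If all the powers of a matrix have entries that are polynomials in the powers of a
diagonalizable matrix, then it is diagonalizable. -/
theorem exists_aeval_eq_zero {Λ : Subgroup Kˣ} {A Q Q' : Matrix (Fin n) (Fin n) K}
    {d : Fin n → Kˣ} (hQ : Q * Q' = 1) (hA : A = Q * Matrix.diagonal (fun i => (d i : K)) * Q')
    (hd : ∀ i, d i ∈ Λ) {m : Type*} [Fintype m] [DecidableEq m]
    {P : Matrix m m (MvPolynomial (Fin n × Fin n) K)} {B : Matrix m m K}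
    (hB : ∀ k : ℕ, B ^ k = P.map (evalAt (A ^ k))) :
    ∃ s : Finset K, (∀ μ ∈ s, ∃ l ∈ Λ, (l : K) = μ) ∧
      Polynomial.aeval (Matrix.toLin' B) (∏ μ ∈ s, (Polynomial.X - Polynomial.C μ)) = 0 := by
  classical
  choose s hs hp using fun ij : m × m =>
    exists_finset_of_mem_adjoin (evalAt_pow_mem_adjoin hQ hA hd (P ij.1 ij.2))
  refine ⟨Finset.univ.biUnion s, fun μ hμ => ?_, ?_⟩
  · obtain ⟨ij, -, h⟩ := Finset.mem_biUnion.1 hμ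
    exact hs ij μ h
  -- An entry of `p(B)` is the pairing of `p` with the sequence of that entry of `P(A^k)`, which
  -- vanishes since `p` has all the relevant roots.
  set p := ∏ μ ∈ Finset.univ.biUnion s, (Polynomial.X - Polynomial.C μ) with hpdef
  have h1 : Polynomial.aeval B p = 0 := by
    ext i j
    have h2 := hp (i, j) p fun μ hμ => by
      rw [hpdef, Polynomial.eval_prod]
      exact Finset.prod_eq_zero (Finset.mem_biUnion.2 ⟨(i, j), Finset.mem_univ _, hμ⟩) (by simp)
    rw [coeffPairing_apply] at h2
    rw [Polynomial.aeval_eq_sum_range, Matrix.sum_apply, Matrix.zero_apply, ← h2]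
    refine Finset.sum_congr rfl fun k _ => ?_
    rw [Matrix.smul_apply, hB]
    rfl
  have h2 := Polynomial.aeval_algHom_apply
    (Matrix.toLinAlgEquiv' : Matrix m m K ≃ₐ[K] Module.End K (m → K)).toAlgHom B p
  rw [h1, map_zero] at h2
  exact h2

end Diagonalizable

/-! ## The conjugation representation -/

section Conjugation

variable {K : Type*} [Field K] {n : ℕ}

/-- The matrix of the conjugation action of matrices of determinant one on matrices. -/
def conjRep (K : Type*) [Field K] (n : ℕ) :
    Matrix (Fin n × Fin n) (Fin n × Fin n) (MvPolynomial (Fin n × Fin n) K) :=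
  Matrix.of fun ij kl =>
    X (ij.1, kl.1) * (Matrix.mvPolynomialX (Fin n) (Fin n) K).adjugate kl.2 ij.2

theorem evalAt_adjugate (M : Matrix (Fin n) (Fin n) K) (i j : Fin n) :
    evalAt M ((Matrix.mvPolynomialX (Fin n) (Fin n) K).adjugate i j) = M.adjugate i j := by
  have h := (evalAt (F := K) M).map_adjugate (Matrix.mvPolynomialX (Fin n) (Fin n) K)
  have h1 : (evalAt (F := K) M).mapMatrix (Matrix.mvPolynomialX (Fin n) (Fin n) K) = M :=
    evalAt_mvPolynomialX M
  rw [h1] at h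
  rw [← h]
  rfl

theorem conjRep_map_evalAt_apply (M : Matrix (Fin n) (Fin n) K) (ij kl : Fin n × Fin n) :
    (conjRep K n).map (evalAt M) ij kl = M ij.1 kl.1 * M.adjugate kl.2 ij.2 := by
  rw [Matrix.map_apply, conjRep, Matrix.of_apply, _root_.map_mul, evalAt_X, evalAt_adjugate]

theorem isPolyRep_conjRep (Γ : Subgroup (GL (Fin n) K)) : IsPolyRep Γ (conjRep K n) := by
  constructor
  · ext ij kl
    rw [conjRep_map_evalAt_apply, Matrix.adjugate_one, Matrix.one_apply, Matrix.one_apply,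
      Matrix.one_apply]
    rcases ij with ⟨i, j⟩
    rcases kl with ⟨k, l⟩
    by_cases h1 : i = k <;> by_cases h2 : j = l <;> simp [h1, h2, eq_comm]
  · intro g _ h _
    ext ij kl
    rw [Matrix.mul_apply, conjRep_map_evalAt_apply, Matrix.adjugate_mul_distrib, Matrix.mul_apply,
      Matrix.mul_apply, Finset.sum_mul_sum, Fintype.sum_prod_type]
    refine Finset.sum_congr rfl fun k _ => Finset.sum_congr rfl fun l _ => ?_
    rw [conjRep_map_evalAt_apply, conjRep_map_evalAt_apply]
    ring

theorem conjRep_map_map {L : Type*} [Field L] [Algebra K L] :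
    (conjRep K n).map (map (algebraMap K L)) = conjRep L n := by
  ext1 ij kl
  have h := (map (σ := Fin n × Fin n) (algebraMap K L)).map_adjugate
    (Matrix.mvPolynomialX (Fin n) (Fin n) K)
  have h1 : (map (σ := Fin n × Fin n) (algebraMap K L)).mapMatrix
      (Matrix.mvPolynomialX (Fin n) (Fin n) K) = Matrix.mvPolynomialX (Fin n) (Fin n) L := by
    ext1 i j
    exact map_X _ _
  rw [h1] at h
  rw [Matrix.map_apply, conjRep, conjRep, Matrix.of_apply, Matrix.of_apply, _root_.map_mul, map_X,
    ← h]
  rfl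

/-- The entries of a matrix, as a vector. -/
def matrixEntries (K : Type*) [Field K] (n : ℕ) :
    Matrix (Fin n) (Fin n) K →ₗ[K] (Fin n × Fin n → K) where
  toFun X ij := X ij.1 ij.2
  map_add' _ _ := rfl
  map_smul' _ _ := rfl

theorem matrixEntries_injective : Function.Injective (matrixEntries K n) := fun _ _ h =>
  Matrix.ext fun i j => congrFun h (i, j)

theorem conjRep_mulVec (M X : Matrix (Fin n) (Fin n) K) :
    ((conjRep K n).map (evalAt M)).mulVec (matrixEntries K n X) =
      matrixEntries K n (M * X * M.adjugate) := by
  ext ij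
  change ∑ kl, _ = (M * X * M.adjugate) ij.1 ij.2
  rw [Matrix.mul_apply, Fintype.sum_prod_type, Finset.sum_comm]
  refine Finset.sum_congr rfl fun l _ => ?_
  rw [Matrix.mul_apply, Finset.sum_mul]
  refine Finset.sum_congr rfl fun k _ => ?_
  have h := conjRep_map_evalAt_apply M ij (k, l)
  change (conjRep K n).map (evalAt M) ij (k, l) * X k l = _
  rw [h]
  ring

/-- Eigenvectors of a conjugation for eigenvalues no product of which is `1` are nilpotent. -/
theorem isNilpotent_of_mem_eigenspaceSum [CharZero K] {A A' : Matrix (Fin n) (Fin n) K}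
    (hA : A' * A = 1) {E : K → Prop} (hmul : ∀ μ ν, E μ → E ν → E (μ * ν)) (hone : ¬ E 1)
    {X : Matrix (Fin n) (Fin n) K}
    (hX : X ∈ eigenspaceSum (LinearMap.mulLeft K A ∘ₗ LinearMap.mulRight K A') E) :
    IsNilpotent X := by
  set T := LinearMap.mulLeft K A ∘ₗ LinearMap.mulRight K A' with hT
  have hTa : ∀ Y, T Y = A * (Y * A') := fun _ => rfl
  -- The trace is invariant under conjugation, so it kills eigenvectors for eigenvalues other than
  -- `1`. Powers of `X` stay in the eigenspace sum, and all have trace zero.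
  have htr : eigenspaceSum T E ≤ LinearMap.ker (Matrix.traceLinearMap (Fin n) K K) := by
    refine eigenspaceSum_le fun μ hμ Y hY => ?_
    rw [LinearMap.mem_ker, Matrix.traceLinearMap_apply]
    have h1 : (T Y).trace = Y.trace := by
      rw [hTa, Matrix.trace_mul_comm, mul_assoc, hA, mul_one]
    rw [hY, Matrix.trace_smul, smul_eq_mul] at h1
    by_contra hne
    have h2 : μ = 1 := mul_right_cancel₀ hne (h1.trans (one_mul _).symm)
    exact hone (h2 ▸ hμ)
  have hpow : ∀ k, X ^ (k + 1) ∈ eigenspaceSum T E := by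
    intro k
    induction k with
    | zero => rwa [zero_add, pow_one]
    | succ k ih =>
      rw [pow_succ]
      refine map₂_mem_eigenspaceSum (LinearMap.mul K (Matrix (Fin n) (Fin n) K)) ?_ hmul ih hX
      intro Y Z
      simp only [hTa, LinearMap.mul_apply']
      rw [mul_assoc Y Z, mul_assoc A, mul_assoc Y, ← mul_assoc A' A, hA, one_mul]
  refine isNilpotent_of_trace_pow_eq_zero fun k hk => ?_
  obtain ⟨j, rfl⟩ := Nat.exists_eq_succ_of_ne_zero hk.ne'
  exact htr (hpow j)

end Conjugation

/-! ### Rational points and the Lie algebra in polynomial representations -/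

section ClassElements

open LinearAlgebraicGroup

variable {K : Type*} [Field K] [CharZero K] {n : ℕ} {G : LinearAlgebraicGroup K n}

omit [CharZero K] in
theorem LinearAlgebraicGroup.coe_mul_coe_inv (g : G.points) :
    ((g : GL (Fin n) K) : Matrix (Fin n) (Fin n) K) * ((g⁻¹ : G.points) : GL (Fin n) K) = 1 := by
  rw [← Units.val_mul, ← Subgroup.coe_mul, mul_inv_cancel]
  rfl

omit [CharZero K] in
theorem LinearAlgebraicGroup.coe_inv_mul_coe (g : G.points) :
    (((g⁻¹ : G.points) : GL (Fin n) K) : Matrix (Fin n) (Fin n) K) * (g : GL (Fin n) K) = 1 :=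
  mul_eq_one_comm.1 (G.coe_mul_coe_inv g)

theorem LinearAlgebraicGroup.adjugate_eq (hconn : G.IsZariskiConnected)
    (hrad : G.radical = G.unipotentRadical) (g : G.points) :
    ((g : GL (Fin n) K) : Matrix (Fin n) (Fin n) K).adjugate =
      ((g⁻¹ : G.points) : GL (Fin n) K) := by
  have h1 := G.det_eq_one hconn hrad (G.toGeom g).2
  rw [G.coe_toGeom, ← RingHom.mapMatrix_apply, ← RingHom.map_det] at h1
  have h2 : ((g : GL (Fin n) K) : Matrix (Fin n) (Fin n) K).det = 1 :=
    (algebraMap K (AlgebraicClosure K)).injective (h1.trans (_root_.map_one _).symm)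
  have h3 := Matrix.mul_adjugate ((g : GL (Fin n) K) : Matrix (Fin n) (Fin n) K)
  rw [h2, one_smul] at h3
  rw [← mul_one (((g⁻¹ : G.points) : GL (Fin n) K) : Matrix (Fin n) (Fin n) K), ← h3, ← mul_assoc,
    G.coe_inv_mul_coe, one_mul]

omit [CharZero K] in
theorem LinearAlgebraicGroup.isPolyRep_conjRep :
    IsPolyRep G.geomPoints ((conjRep K n).map (map (algebraMap K (AlgebraicClosure K)))) := by
  rw [conjRep_map_map]
  exact _root_.isPolyRep_conjRep _

theorem LinearAlgebraicGroup.conjRep_mulVec_coe (hconn : G.IsZariskiConnected)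
    (hrad : G.radical = G.unipotentRadical) (g : G.points) (X : G.lieAlgebra) :
    ((conjRep K n).map (evalAt ((g : GL (Fin n) K) : Matrix (Fin n) (Fin n) K))).mulVec
        (matrixEntries K n X) = matrixEntries K n (G.Ad g X : G.lieAlgebra) := by
  rw [conjRep_mulVec, G.adjugate_eq hconn hrad]
  rfl

omit [CharZero K] in
/-- The action of a diagonalizable point is diagonalizable. -/
theorem LinearAlgebraicGroup.exists_aeval_eq_zero {m : Type*} [Fintype m] [DecidableEq m]
    {P : Matrix m m (MvPolynomial (Fin n × Fin n) K)}
    (hP : IsPolyRep G.geomPoints (P.map (map (algebraMap K (AlgebraicClosure K)))))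
    {a : G.points} {Q Q' : Matrix (Fin n) (Fin n) K} {d : Fin n → Kˣ} {Λ : Subgroup Kˣ}
    (hQ : Q * Q' = 1)
    (hA : ((a : GL (Fin n) K) : Matrix (Fin n) (Fin n) K) =
      Q * Matrix.diagonal (fun i => (d i : K)) * Q')
    (hd : ∀ i, d i ∈ Λ) :
    ∃ s : Finset K, (∀ μ ∈ s, ∃ l ∈ Λ, (l : K) = μ) ∧
      Polynomial.aeval
        (Matrix.toLin' (P.map (evalAt ((a : GL (Fin n) K) : Matrix (Fin n) (Fin n) K))))
        (∏ μ ∈ s, (Polynomial.X - Polynomial.C μ)) = 0 := by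
  refine _root_.exists_aeval_eq_zero hQ hA hd (P := P) fun k => ?_
  have h1 : ∀ k : ℕ, (((a ^ k : G.points) : GL (Fin n) K) : Matrix (Fin n) (Fin n) K) =
      ((a : GL (Fin n) K) : Matrix (Fin n) (Fin n) K) ^ k := fun k => rfl
  rw [← h1]
  induction k with
  | zero => exact (G.map_evalAt_one hP).symm
  | succ k ih => rw [pow_succ, pow_succ, ih, G.map_evalAt_mul hP]

/-- The adjoint action of a diagonalizable point is diagonalizable. -/
theorem LinearAlgebraicGroup.exists_aeval_Ad_eq_zero (hconn : G.IsZariskiConnected)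
    (hrad : G.radical = G.unipotentRadical) {a : G.points} {Q Q' : Matrix (Fin n) (Fin n) K}
    {d : Fin n → Kˣ} {Λ : Subgroup Kˣ} (hQ : Q * Q' = 1)
    (hA : ((a : GL (Fin n) K) : Matrix (Fin n) (Fin n) K) =
      Q * Matrix.diagonal (fun i => (d i : K)) * Q')
    (hd : ∀ i, d i ∈ Λ) :
    ∃ s : Finset K, (∀ μ ∈ s, ∃ l ∈ Λ, (l : K) = μ) ∧
      Polynomial.aeval (G.Ad a) (∏ μ ∈ s, (Polynomial.X - Polynomial.C μ)) = 0 := by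
  obtain ⟨s, hs, h⟩ := G.exists_aeval_eq_zero G.isPolyRep_conjRep hQ hA hd
  refine ⟨s, hs, aeval_eq_zero_of_injective (matrixEntries K n ∘ₗ G.lieAlgebra.subtype)
    (matrixEntries_injective.comp Subtype.val_injective) (fun X => ?_) h⟩
  rw [Matrix.toLin'_apply]
  exact (G.conjRep_mulVec_coe hconn hrad a X).symm

/-- Elements of the Lie algebra that are sums of eigenvectors for `Ad_a`, for eigenvalues no
product of which is `1`, are nilpotent. -/
theorem LinearAlgebraicGroup.isNilpotent_of_mem_eigenspaceSum {a : G.points} {E : K → Prop}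
    (hmul : ∀ μ ν, E μ → E ν → E (μ * ν)) (hone : ¬ E 1) {X : G.lieAlgebra}
    (hX : X ∈ eigenspaceSum (G.Ad a) E) : IsNilpotent (X : Matrix (Fin n) (Fin n) K) := by
  refine _root_.isNilpotent_of_mem_eigenspaceSum (G.coe_inv_mul_coe a) hmul hone ?_
  refine map_mem_eigenspaceSum G.lieAlgebra.subtype (fun Y => ?_) hX
  exact mul_assoc _ _ _

/-- The bracket of the Lie algebra. -/
def LinearAlgebraicGroup.bracket (G : LinearAlgebraicGroup K n) :
    G.lieAlgebra →ₗ[K] G.lieAlgebra →ₗ[K] G.lieAlgebra :=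
  LinearMap.mk₂ K (fun X Y => ⟨_, G.lie_mem_lieAlgebra X.2 Y.2⟩)
    (fun X X' Y => Subtype.ext (by simp only [Submodule.coe_add]; noncomm_ring))
    (fun c X Y => Subtype.ext (by simp [smul_sub]))
    (fun X Y Y' => Subtype.ext (by simp only [Submodule.coe_add]; noncomm_ring))
    (fun c X Y => Subtype.ext (by simp [smul_sub]))

theorem LinearAlgebraicGroup.Ad_bracket (g : G.points) (X Y : G.lieAlgebra) :
    G.Ad g (G.bracket X Y) = G.bracket (G.Ad g X) (G.Ad g Y) := by
  apply Subtype.ext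
  set A : Matrix (Fin n) (Fin n) K := ((g : GL (Fin n) K) : Matrix (Fin n) (Fin n) K) with hA
  set B : Matrix (Fin n) (Fin n) K :=
    (((g⁻¹ : G.points) : GL (Fin n) K) : Matrix (Fin n) (Fin n) K) with hB
  have hBA : B * A = 1 := G.coe_inv_mul_coe g
  have key : ∀ Y Z : Matrix (Fin n) (Fin n) K, A * Y * B * (A * Z * B) = A * (Y * Z) * B := by
    intro Y Z
    rw [mul_assoc A Z, mul_assoc (A * Y), ← mul_assoc B A, hBA, one_mul, ← mul_assoc, mul_assoc A]
  change A * ((X : Matrix (Fin n) (Fin n) K) * Y - Y * X) * B =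
    A * X * B * (A * Y * B) - A * Y * B * (A * X * B)
  rw [key, key, mul_sub, sub_mul]

variable {m : Type*} [Fintype m] [DecidableEq m] {P : Matrix m m (MvPolynomial (Fin n × Fin n) K)}

/-- The action of the Lie algebra of `G` defined by a polynomial representation. -/
def LinearAlgebraicGroup.lieAction (G : LinearAlgebraicGroup K n)
    (P : Matrix m m (MvPolynomial (Fin n × Fin n) K)) :
    G.lieAlgebra →ₗ[K] Module.End K (m → K) :=
  (Matrix.toLin' : Matrix m m K ≃ₗ[K] _).toLinearMap ∘ₗ diffOne P ∘ₗ G.lieAlgebra.subtype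

omit [CharZero K] in
theorem LinearAlgebraicGroup.lieAction_apply (X : G.lieAlgebra) (v : m → K) :
    G.lieAction P X v = (diffOne P X).mulVec v :=
  rfl

theorem LinearAlgebraicGroup.lieAction_bracket
    (hP : IsPolyRep G.geomPoints (P.map (map (algebraMap K (AlgebraicClosure K)))))
    (X Y : G.lieAlgebra) : G.lieAction P (G.bracket X Y) =
      G.lieAction P X * G.lieAction P Y - G.lieAction P Y * G.lieAction P X := by
  change Matrix.toLin' (diffOne P ((X : Matrix (Fin n) (Fin n) K) * Y - Y * X)) = _
  rw [G.diffOne_lie hP X.2 Y.2, map_sub, Matrix.toLin'_mul, Matrix.toLin'_mul]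
  rfl

theorem LinearAlgebraicGroup.mulVec_lieAction
    (hP : IsPolyRep G.geomPoints (P.map (map (algebraMap K (AlgebraicClosure K)))))
    (g : G.points) (X : G.lieAlgebra) (v : m → K) :
    (P.map (evalAt ((g : GL (Fin n) K) : Matrix (Fin n) (Fin n) K))).mulVec (G.lieAction P X v) =
      G.lieAction P (G.Ad g X)
        ((P.map (evalAt ((g : GL (Fin n) K) : Matrix (Fin n) (Fin n) K))).mulVec v) := by
  have h1 := G.map_evalAt_mul hP g⁻¹ g
  rw [inv_mul_cancel] at h1
  have h2 := G.diffOne_conj hP g X.2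
  rw [G.lieAction_apply, G.lieAction_apply, Matrix.mulVec_mulVec, Matrix.mulVec_mulVec]
  congr 1
  change _ = diffOne P (((g : GL (Fin n) K) : Matrix (Fin n) (Fin n) K) * X *
      ((g⁻¹ : G.points) : GL (Fin n) K)) * _
  rw [h2, mul_assoc, ← h1]
  have h3 : P.map (evalAt (((1 : G.points) : GL (Fin n) K) : Matrix (Fin n) (Fin n) K)) = 1 :=
    G.map_evalAt_one hP
  rw [h3, mul_one]

/-- The action of the group on a subspace stable under the Lie algebra: it is stable, and if a
point acts diagonally in some basis, then the product of the eigenvalues is one. -/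
theorem LinearAlgebraicGroup.mem_of_lieAction_mem (hconn : G.IsZariskiConnected)
    (hrad : G.radical = G.unipotentRadical)
    (hP : IsPolyRep G.geomPoints (P.map (map (algebraMap K (AlgebraicClosure K)))))
    {W : Submodule K (m → K)} (hW : ∀ X, ∀ v ∈ W, G.lieAction P X v ∈ W) {r : ℕ}
    (b : Module.Basis (Fin r) K W) (g : G.points) :
    (∀ v ∈ W,
      (P.map (evalAt ((g : GL (Fin n) K) : Matrix (Fin n) (Fin n) K))).mulVec v ∈ W) ∧
    ∀ d : Fin r → K, (∀ i,
      (P.map (evalAt ((g : GL (Fin n) K) : Matrix (Fin n) (Fin n) K))).mulVec (b i : m → K) =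
        d i • (b i : m → K)) → ∏ i, d i = 1 := by
  classical
  let e : (Fin r → K) →ₗ[K] (m → K) := W.subtype ∘ₗ b.equivFun.symm.toLinearMap
  have he : ∀ y, e y ∈ W := fun y => (b.equivFun.symm y).2
  have heb : ∀ i, e (Pi.single i 1) = b i := by
    intro i
    change ((b.equivFun.symm (Pi.single i 1) : W) : m → K) = b i
    rw [Module.Basis.equivFun_symm_apply, Finset.sum_eq_single i]
    · simp
    · intro j _ hj
      rw [Pi.single_eq_of_ne hj, zero_smul]
    · simp
  have hsurj : ∀ v ∈ W, ∃ y, e y = v := fun v hv =>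
    ⟨b.equivFun ⟨v, hv⟩, by simp [e]⟩
  have hinj : Function.Injective e := Subtype.val_injective.comp b.equivFun.symm.injective
  obtain ⟨f, hf⟩ := e.exists_leftInverse_of_injective (LinearMap.ker_eq_bot.2 hinj)
  have hfe : ∀ y, f (e y) = y := fun y => LinearMap.congr_fun hf y
  have hef : ∀ v ∈ W, e (f v) = v := by
    intro v hv
    obtain ⟨y, rfl⟩ := hsurj v hv
    rw [hfe]
  set V := LinearMap.toMatrix' e with hV
  set U := LinearMap.toMatrix' f with hU
  have hVa : ∀ y, V.mulVec y = e y := fun y => e.toMatrix'_mulVec y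
  have hUa : ∀ v, U.mulVec v = f v := fun y => f.toMatrix'_mulVec y
  have hUV : U * V = 1 := by
    rw [hU, hV, ← LinearMap.toMatrix'_comp, hf, LinearMap.toMatrix'_id]
  have hstab : ∀ X ∈ G.lieAlgebra, ∃ x : Matrix (Fin r) (Fin r) K, diffOne P X * V = V * x := by
    intro X hX
    refine ⟨U * diffOne P X * V, ?_⟩
    apply Matrix.toLin'.injective
    refine LinearMap.ext fun y => ?_
    rw [Matrix.toLin'_apply, Matrix.toLin'_apply, ← Matrix.mulVec_mulVec, ← Matrix.mulVec_mulVec,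
      ← Matrix.mulVec_mulVec, ← Matrix.mulVec_mulVec, hVa, hVa, hUa]
    exact (hef _ (hW ⟨X, hX⟩ _ (he y))).symm
  constructor
  · intro v hv
    obtain ⟨y, rfl⟩ := hsurj v hv
    rw [← hVa, Matrix.mulVec_mulVec, G.mul_eq_of_stable hconn hP hUV hstab g,
      ← Matrix.mulVec_mulVec, hVa]
    exact he _
  · intro d hd
    have h1 := G.det_eq_one_of_stable hconn hrad hP hUV hstab g
    have h2 : U * P.map (evalAt ((g : GL (Fin n) K) : Matrix (Fin n) (Fin n) K)) * V =
        Matrix.diagonal d := by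
      apply Matrix.toLin'.injective
      refine LinearMap.pi_ext' fun i => LinearMap.ext_ring ?_
      rw [LinearMap.comp_apply, LinearMap.comp_apply, LinearMap.single_apply, Matrix.toLin'_apply,
        Matrix.toLin'_apply, ← Matrix.mulVec_mulVec, ← Matrix.mulVec_mulVec, hVa, heb, hd, hUa,
        map_smul, ← heb, hfe, Matrix.diagonal_mulVec_single, ← Pi.single_smul, smul_eq_mul]
    rw [h2, Matrix.det_diagonal] at h1
    exact h1

end ClassElements

/-! ## Expanding vectors -/

section Expanding

variable {K : Type*} [NontriviallyNormedField K]

section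

variable {V : Type*} [AddCommGroup V] [Module K V]

theorem neutralSubspace_eq (T : Module.End K V) :
    neutralSubspace T = eigenspaceSum T fun μ => μ = 1 :=
  (eigenspaceSum_eq T 1).symm

theorem expandingSubspace_sup_neutralSubspace (T : Module.End K V) :
    expandingSubspace T ⊔ neutralSubspace T = eigenspaceSum T fun μ => 1 < ‖μ‖ ∨ μ = 1 := by
  rw [eigenspaceSum_or, neutralSubspace_eq]
  rfl

/-- The absence of nontrivial elements of absolute value one in `Λ` is what class `𝒜'` provides:
contracting, neutral and expanding eigenvalues exhaust all cases. -/
theorem eigenspaceSum_eq_top {Λ : Subgroup Kˣ} (hΛ : ∀ x ∈ Λ, ‖(x : K)‖ = 1 → x = 1)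
    {T : Module.End K V} {s : Finset K} (hs : ∀ μ ∈ s, ∃ l ∈ Λ, (l : K) = μ)
    (hT : Polynomial.aeval T (∏ μ ∈ s, (Polynomial.X - Polynomial.C μ)) = 0) :
    eigenspaceSum T (fun μ => (‖μ‖ < 1 ∨ μ = 1) ∨ 1 < ‖μ‖) = ⊤ := by
  refine eigenspaceSum_eq_top_of_aeval_eq_zero hT fun μ hμ => ?_
  obtain ⟨l, hl, rfl⟩ := hs μ hμ
  rcases lt_trichotomy ‖(l : K)‖ 1 with h | h | h
  · exact Or.inl (Or.inl h)
  · exact Or.inl (Or.inr (by rw [hΛ l hl h, Units.val_one]))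
  · exact Or.inr h

end

theorem eq_one_of_prod_eq_one {r : ℕ} {d : Fin r → K} (hd : ∀ i, 1 < ‖d i‖ ∨ d i = 1)
    (h : ∏ i, d i = 1) (i : Fin r) : d i = 1 := by
  have hle : ∀ i, 1 ≤ ‖d i‖ := fun i => (hd i).elim le_of_lt fun h => by rw [h, norm_one]
  rcases hd i with hi | hi
  · have h1 : ‖d i‖ * ∏ j ∈ Finset.univ.erase i, ‖d j‖ = 1 := by
      rw [Finset.mul_prod_erase _ (fun j => ‖d j‖) (Finset.mem_univ i), ← norm_prod, h, norm_one]
    have h2 : 1 ≤ ∏ j ∈ Finset.univ.erase i, ‖d j‖ := by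
      have := Finset.prod_le_prod (s := Finset.univ.erase i) (f := fun _ => (1 : ℝ))
        (g := fun j => ‖d j‖) (fun _ _ => zero_le_one) fun j _ => hle j
      simpa using this
    nlinarith
  · exact hi

open LinearAlgebraicGroup

variable [CharZero K] {n : ℕ} {G : LinearAlgebraicGroup K n} {m : Type*} [Fintype m]
  [DecidableEq m] {P : Matrix m m (MvPolynomial (Fin n × Fin n) K)}

/-- If the exponentials of an element `X` of the Lie algebra move a vector within a subspace, then
so do the powers of the action of `X`. -/
theorem LinearAlgebraicGroup.lieAction_pow_mem
    (hP : IsPolyRep G.geomPoints (P.map (map (algebraMap K (AlgebraicClosure K)))))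
    {X : G.lieAlgebra} (hnil : IsNilpotent (X : Matrix (Fin n) (Fin n) K))
    {p : Submodule K (m → K)} {w : m → K}
    (h : ∀ (s : K) (u : G.points), ((u : GL (Fin n) K) : Matrix (Fin n) (Fin n) K) =
      IsNilpotent.exp ((s • X : G.lieAlgebra) : Matrix (Fin n) (Fin n) K) →
        (P.map (evalAt ((u : GL (Fin n) K) : Matrix (Fin n) (Fin n) K))).mulVec w ∈ p)
    (k : ℕ) : (G.lieAction P X ^ k) w ∈ p := by
  have hnil' : ∀ s : K, IsNilpotent ((s • X : G.lieAlgebra) : Matrix (Fin n) (Fin n) K) := by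
    intro s
    rw [Submodule.coe_smul]
    exact hnil.smul s
  have hpow : ∀ j, (G.lieAction P X ^ j) w = (diffOne P X ^ j).mulVec w := by
    intro j
    rw [← Matrix.toLin'_apply, Matrix.toLin'_pow]
    rfl
  obtain ⟨N, hN⟩ := G.isNilpotent_diffOne hP X.2 hnil
  by_cases hk : k < N
  swap
  · rw [hpow, pow_eq_zero_of_le (not_lt.1 hk) hN, Matrix.zero_mulVec]
    exact zero_mem _
  -- The curve `exp(sX)w = ∑ sʲ Xʲw / j!` stays in `p`, hence so do its coefficients.
  have h1 := mem_of_forall_sum_smul_mem p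
    (fun j => ((j.factorial : K)⁻¹) • (G.lieAction P X ^ j) w) N (fun s => ?_) hk
  · have h2 := p.smul_mem (k.factorial : K) h1
    rwa [smul_smul, mul_inv_cancel₀ (Nat.cast_ne_zero.2 k.factorial_ne_zero), one_smul] at h2
  · obtain ⟨u, hu⟩ := G.exists_points_eq_exp (s • X).2 (hnil' s)
    have h3 := h s u hu
    rw [hu, G.map_evalAt_exp hP (s • X).2 (hnil' s)] at h3
    have h4 : (diffOne P ((s • X : G.lieAlgebra) : Matrix (Fin n) (Fin n) K)) ^ N = 0 := by
      rw [Submodule.coe_smul, map_smul, smul_pow, hN, smul_zero]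
    rw [IsNilpotent.exp_eq_sum h4, Matrix.sum_mulVec] at h3
    convert h3 using 1
    refine Finset.sum_congr rfl fun j _ => ?_
    have h5 : ∀ M : Matrix m m K, (j.factorial : ℚ)⁻¹ • M = (j.factorial : K)⁻¹ • M := by
      intro M
      ext
      simp [Rat.smul_def]
    rw [Submodule.coe_smul, map_smul, smul_pow, h5, hpow, Matrix.smul_mulVec, Matrix.smul_mulVec,
      smul_comm]

/-- A polynomial representation moves every nonzero expanding vector out of the sum of the
expanding and the neutral subspace by an element of the stable horospherical subgroup. Otherwise
the vector lies in a subrepresentation on which no eigenvalue of `a` is contracting; since `a` acts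
there with determinant one, it acts trivially. -/
theorem LinearAlgebraicGroup.exists_mulVec_notMem (hconn : G.IsZariskiConnected)
    (hrad : G.radical = G.unipotentRadical)
    (hP : IsPolyRep G.geomPoints (P.map (map (algebraMap K (AlgebraicClosure K)))))
    {a : G.points} {Q Q' : Matrix (Fin n) (Fin n) K} {d : Fin n → Kˣ} {Λ : Subgroup Kˣ}
    (hQ : Q * Q' = 1)
    (hA : ((a : GL (Fin n) K) : Matrix (Fin n) (Fin n) K) =
      Q * Matrix.diagonal (fun i => (d i : K)) * Q')
    (hd : ∀ i, d i ∈ Λ) (hΛ : ∀ x ∈ Λ, ‖(x : K)‖ = 1 → x = 1) {T : Module.End K (m → K)}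
    (hT : T = Matrix.toLin' (P.map (evalAt ((a : GL (Fin n) K) : Matrix (Fin n) (Fin n) K))))
    {w : m → K} (hw : w ∈ expandingSubspace T) (hw0 : w ≠ 0) :
    ∃ u ∈ G.stableHorospherical a,
      (P.map (evalAt ((u : GL (Fin n) K) : Matrix (Fin n) (Fin n) K))).mulVec w ∉
        expandingSubspace T ⊔ neutralSubspace T := by
  by_contra! hcon
  have hTa : ∀ v,
      T v = (P.map (evalAt ((a : GL (Fin n) K) : Matrix (Fin n) (Fin n) K))).mulVec v := by
    intro v
    rw [hT, Matrix.toLin'_apply]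
  obtain ⟨s, hs, hsT⟩ := G.exists_aeval_eq_zero hP hQ hA hd
  rw [← hT] at hsT
  obtain ⟨t, ht, htA⟩ := G.exists_aeval_Ad_eq_zero hconn hrad hQ hA hd
  have htop : contractingSubspace (G.Ad a) ⊔ neutralSubspace (G.Ad a) ⊔
      expandingSubspace (G.Ad a) = ⊤ := by
    have h1 := eigenspaceSum_eq_top hΛ ht htA
    rw [eigenspaceSum_or, eigenspaceSum_or, ← neutralSubspace_eq] at h1
    exact h1
  rw [expandingSubspace_sup_neutralSubspace] at hcon
  set p := eigenspaceSum T fun μ => 1 < ‖μ‖ ∨ μ = 1 with hp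
  have hmulm : ∀ μ ν : K, ‖μ‖ < 1 → ‖ν‖ < 1 → ‖μ * ν‖ < 1 := by
    intro μ ν h1 h2
    rw [norm_mul]
    exact mul_lt_one_of_nonneg_of_lt_one_left (norm_nonneg _) h1 h2.le
  have hact : ∀ X v, T (G.lieAction P X v) = G.lieAction P (G.Ad a X) (T v) := by
    intro X v
    rw [hTa, hTa]
    exact G.mulVec_lieAction hP a X v
  have hrange : ((contractingSubspace (G.Ad a)).map (G.lieAction P) ⊔
      (neutralSubspace (G.Ad a)).map (G.lieAction P) ⊔
      (expandingSubspace (G.Ad a)).map (G.lieAction P)) = LinearMap.range (G.lieAction P) := by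
    rw [← Submodule.map_sup, ← Submodule.map_sup, htop, Submodule.map_top]
  -- All the conditions are multiplicativity of eigenvalues: brackets and the action multiply them,
  -- so `𝔤⁰` and `𝔤⁺` preserve `V⁺ + V⁰`, while `𝔤⁻` is closed under brackets with itself and with
  -- `𝔤⁰`.
  obtain ⟨W, hWp, hwW, hW⟩ := exists_stable_submodule
    (Lm := (contractingSubspace (G.Ad a)).map (G.lieAction P))
    (Lz := (neutralSubspace (G.Ad a)).map (G.lieAction P))
    (Lp := (expandingSubspace (G.Ad a)).map (G.lieAction P)) (p := p) (w := w)
    (by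
      rintro _ ⟨X, hX, rfl⟩ _ ⟨Y, hY, rfl⟩
      rw [← G.lieAction_bracket hP]
      exact ⟨_, map₂_mem_eigenspaceSum G.bracket (G.Ad_bracket a) hmulm hX hY, rfl⟩)
    (by
      rintro _ ⟨X, hX, rfl⟩ _ ⟨Y, hY, rfl⟩
      rw [← G.lieAction_bracket hP]
      rw [neutralSubspace_eq] at hY
      refine ⟨_, map₂_mem_eigenspaceSum G.bracket (G.Ad_bracket a) ?_ hX hY, rfl⟩
      rintro μ _ hμ rfl
      rwa [mul_one])
    (by
      intro x hx y hy
      obtain ⟨Y, -, rfl⟩ := hy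
      have hx' := hrange.le (Submodule.mem_sup_left hx)
      obtain ⟨X, rfl⟩ := hx'
      rw [← G.lieAction_bracket hP, hrange]
      exact ⟨_, rfl⟩)
    (by
      rintro _ ⟨X, hX, rfl⟩ v hv
      rw [neutralSubspace_eq] at hX
      refine map₂_mem_eigenspaceSum (G.lieAction P) hact ?_ hX hv
      rintro _ ν rfl hν
      rwa [one_mul])
    (by
      rintro _ ⟨X, hX, rfl⟩ v hv
      refine map₂_mem_eigenspaceSum (G.lieAction P) hact ?_ hX hv
      intro μ ν hμ hν
      left
      rw [norm_mul]
      rcases hν with hν | rfl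
      · exact one_lt_mul_of_lt_of_le hμ hν.le
      · rwa [norm_one, mul_one])
    (by
      rintro _ ⟨X, hX, rfl⟩ k
      have hnil : IsNilpotent (X : Matrix (Fin n) (Fin n) K) :=
        G.isNilpotent_of_mem_eigenspaceSum hmulm (by simp) hX
      exact G.lieAction_pow_mem hP hnil (fun s u hu => hcon u ⟨s • X, Submodule.smul_mem _ s hX, hu⟩)
        k)
  rw [hrange] at hW
  have hW' : ∀ X, ∀ v ∈ W, G.lieAction P X v ∈ W := fun X v hv => hW _ ⟨X, rfl⟩ v hv
  have hWT : ∀ v ∈ W, T v ∈ W := by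
    intro v hv
    rw [hTa]
    exact (G.mem_of_lieAction_mem hconn hrad hP hW' (Module.finBasis K W) a).1 v hv
  obtain ⟨b, c, hb⟩ := exists_basis_of_eigenspaceSum_eq_top (eigenspaceSum_eq_top hΛ hs
    (aeval_eq_zero_of_injective (T := T.restrict hWT) W.subtype Subtype.val_injective
      (fun v => rfl) hsT))
  have hbT : ∀ i, T (b i) = c i • (b i : m → K) := fun i => congrArg Subtype.val (hb i)
  have hc : ∀ i, 1 < ‖c i‖ ∨ c i = 1 := fun i =>
    eigenvalue_of_mem_eigenspaceSum (fun h => b.ne_zero i (Subtype.ext h)) (hWp (b i).2) (hbT i)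
  -- The eigenvalues of `a` on `W` have absolute value at least one and product one, so those of
  -- absolute value `> 1` cannot occur.
  have hprod := (G.mem_of_lieAction_mem hconn hrad hP hW' b a).2 c fun i => by
    rw [← hTa, hbT]
  have hid : T.restrict hWT = LinearMap.id := by
    refine b.ext fun i => ?_
    rw [hb, eq_one_of_prod_eq_one hc hprod, one_smul, LinearMap.id_apply]
  have hTw : T w = (1 : K) • w := by
    rw [one_smul]
    exact congrArg Subtype.val (LinearMap.congr_fun hid ⟨w, hwW⟩)
  have h1 : 1 < ‖(1 : K)‖ :=
    eigenvalue_of_mem_eigenspaceSum (E := fun μ => 1 < ‖μ‖) hw0 hw hTw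
  rw [norm_one] at h1
  exact lt_irrefl _ h1

end Expanding

/-! ## Algebraic representations and the adjoint representation -/

section Representations

open LinearAlgebraicGroup

variable {K : Type*} [NontriviallyNormedField K] [CharZero K] {n : ℕ}
  {G : LinearAlgebraicGroup K n}

/-- An equivariant embedding preserves the eigenvalue conditions. This covers both a representation
in coordinates and the adjoint one inside the matrices. -/
theorem LinearAlgebraicGroup.exists_notMem_of_intertwining (hconn : G.IsZariskiConnected)
    (hrad : G.radical = G.unipotentRadical) {m : Type*} [Fintype m] [DecidableEq m]
    {P : Matrix m m (MvPolynomial (Fin n × Fin n) K)}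
    (hP : IsPolyRep G.geomPoints (P.map (map (algebraMap K (AlgebraicClosure K)))))
    {a : G.points} {Q Q' : Matrix (Fin n) (Fin n) K} {d : Fin n → Kˣ} {Λ : Subgroup Kˣ}
    (hQ : Q * Q' = 1)
    (hA : ((a : GL (Fin n) K) : Matrix (Fin n) (Fin n) K) =
      Q * Matrix.diagonal (fun i => (d i : K)) * Q')
    (hd : ∀ i, d i ∈ Λ) (hΛ : ∀ x ∈ Λ, ‖(x : K)‖ = 1 → x = 1)
    {V : Type*} [AddCommGroup V] [Module K V] {R : Representation K G.points V}
    (e : V →ₗ[K] (m → K)) (hinj : Function.Injective e)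
    (he : ∀ g v, e (R g v) =
      (P.map (evalAt ((g : GL (Fin n) K) : Matrix (Fin n) (Fin n) K))).mulVec (e v))
    {w : V} (hw : w ∈ expandingSubspace (R a)) (hw0 : w ≠ 0) :
    ∃ u ∈ G.stableHorospherical a, R u w ∉ expandingSubspace (R a) ⊔ neutralSubspace (R a) := by
  have heT : ∀ v, e (R a v) =
      Matrix.toLin' (P.map (evalAt ((a : GL (Fin n) K) : Matrix (Fin n) (Fin n) K))) (e v) := by
    intro v
    rw [he, Matrix.toLin'_apply]
  obtain ⟨u, hu, hnot⟩ := G.exists_mulVec_notMem hconn hrad hP hQ hA hd hΛ rfl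
    (map_mem_eigenspaceSum e heT hw) ((map_ne_zero_iff e hinj).2 hw0)
  refine ⟨u, hu, fun hmem => hnot ?_⟩
  rw [expandingSubspace_sup_neutralSubspace] at hmem ⊢
  rw [← he]
  exact map_mem_eigenspaceSum e heT hmem

omit [CharZero K] in
theorem baseChange_repr_apply {L V ι : Type*} [Field L] [Algebra K L] [AddCommGroup V] [Module K V]
    (b : Module.Basis ι K V) (i : ι) (x : L ⊗[K] V) :
    (b.baseChange L).repr x i = Module.Dual.baseChange L (b.coord i) x := by
  induction x using TensorProduct.induction_on with
  | zero => simp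
  | tmul l v => simp [Algebra.smul_def, mul_comm]
  | add x y hx hy => simp [hx, hy]

omit [CharZero K] in
/-- In a basis, an algebraic representation of a group of determinant one is given by polynomials
in the matrix entries. -/
theorem LinearAlgebraicGroup.AlgRep.exists_isPolyRep
    (hdet : ∀ g ∈ G.geomPoints, (g : Matrix (Fin n) (Fin n) (AlgebraicClosure K)).det = 1)
    {V : Type*} [AddCommGroup V] [Module K V] [FiniteDimensional K V] (ρ : G.AlgRep V) {r : ℕ}
    (b : Module.Basis (Fin r) K V) :
    ∃ P : Matrix (Fin r) (Fin r) (MvPolynomial (Fin n × Fin n) K),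
      IsPolyRep G.geomPoints (P.map (map (algebraMap K (AlgebraicClosure K)))) ∧
      ∀ (g : G.points) (v : V), b.equivFun (ρ.onPoints g v) =
        (P.map (evalAt ((g : GL (Fin n) K) : Matrix (Fin n) (Fin n) K))).mulVec (b.equivFun v) := by
  set L := AlgebraicClosure K
  choose P k hPk using fun ij : Fin r × Fin r => ρ.regular (b ij.2) (b.coord ij.1)
  let Pm : Matrix (Fin r) (Fin r) (MvPolynomial (Fin n × Fin n) K) := Matrix.of fun i j => P (i, j)
  have hev : ∀ g : G.geomPoints, (Pm.map (map (algebraMap K L))).map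
      (evalAt ((g : GL (Fin n) L) : Matrix (Fin n) (Fin n) L)) =
      LinearMap.toMatrix (b.baseChange L) (b.baseChange L) (ρ.geom g) := by
    intro g
    ext i j
    have h1 := hPk (i, j) g
    rw [hdet g g.2, one_pow, div_one] at h1
    rw [LinearMap.toMatrix_apply, baseChange_repr_apply, Module.Basis.baseChange_apply, h1]
    exact aeval_map_algebraMap _ _ _
  refine ⟨Pm, ⟨?_, fun g hg h hh => ?_⟩, fun g v => ?_⟩
  · have h1 := hev 1
    rw [_root_.map_one] at h1
    exact h1.trans (LinearMap.toMatrix_one _)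
  · have h1 := hev (⟨g, hg⟩ * ⟨h, hh⟩)
    rw [_root_.map_mul, LinearMap.toMatrix_mul, ← hev, ← hev] at h1
    exact h1
  · have h1 : Pm.map (evalAt ((g : GL (Fin n) K) : Matrix (Fin n) (Fin n) K)) =
        LinearMap.toMatrix b b (ρ.onPoints g) := by
      apply Matrix.map_algebraMap_injective (K := K) (L := L)
      have h2 := hev (G.toGeom g)
      rw [G.coe_toGeom, map_evalAt_map] at h2
      refine h2.trans ?_
      ext i j
      change _ = ((LinearMap.toMatrix b b (ρ.onPoints g)).map (algebraMap K L)) i j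
      rw [← ρ.baseChange_onPoints, Matrix.map_apply, LinearMap.toMatrix_apply,
        LinearMap.toMatrix_apply, baseChange_repr_apply, Module.Basis.baseChange_apply,
        LinearMap.baseChange_tmul, Module.Dual.baseChange_apply_tmul]
      simp [Algebra.smul_def]
    rw [h1]
    exact (LinearMap.toMatrix_mulVec_repr b b (ρ.onPoints g) v).symm

end Representations

/-! ## Elements of class `𝒜'` -/

section ClassA

theorem exists_subgroup_of_forall_pos {E : Set ℝ} (hE : ∀ x ∈ E, (0 : ℝ) < x) :
    ∃ Λ : Subgroup ℝˣ, (∀ x ∈ E, ∃ l ∈ Λ, (l : ℝ) = x) ∧ ∀ x ∈ Λ, ‖(x : ℝ)‖ = 1 → x = 1 := by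
  refine ⟨Units.posSubgroup ℝ, fun x hx => ⟨Units.mk0 x (hE x hx).ne', ?_, rfl⟩, fun x hx h => ?_⟩
  · exact (Units.mem_posSubgroup _).2 (hE x hx)
  · have h0 : (0 : ℝ) < x := (Units.mem_posSubgroup _).1 hx
    rw [Real.norm_of_nonneg h0.le] at h
    exact Units.ext h

/-- Take the powers of `l`: since `‖l‖ ≠ 1`, only the zeroth power has norm one. -/
theorem exists_subgroup_of_forall_zpow {K : Type*} [NormedField K] {E : Set K} {l : K} (hl : l ≠ 0)
    (hl1 : ‖l‖ ≠ 1) (hE : ∀ x ∈ E, ∃ k : ℤ, x = l ^ k) :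
    ∃ Λ : Subgroup Kˣ, (∀ x ∈ E, ∃ l ∈ Λ, (l : K) = x) ∧ ∀ x ∈ Λ, ‖(x : K)‖ = 1 → x = 1 := by
  refine ⟨Subgroup.zpowers (Units.mk0 l hl), fun x hx => ?_, ?_⟩
  · obtain ⟨k, rfl⟩ := hE x hx
    exact ⟨_, ⟨k, rfl⟩, by simp⟩
  · rintro _ ⟨k, rfl⟩ h
    have h1 : ‖l‖ ^ k = 1 := by simpa using h
    have h2 : k = 0 := by
      by_contra hk
      rcases (zpow_eq_one_iff_of_ne_zero₀ hk).1 h1 with h2 | ⟨h2, -⟩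
      · exact hl1 h2
      · linarith [norm_nonneg l]
    simp [h2]

theorem Place.exists_subgroup (σ : Place) {E : Set σ.Completion} (hE : σ.EigenvalueCondition E) :
    ∃ Λ : Subgroup σ.Completionˣ, (∀ x ∈ E, ∃ l ∈ Λ, (l : σ.Completion) = x) ∧
      ∀ x ∈ Λ, ‖(x : σ.Completion)‖ = 1 → x = 1 := by
  cases σ with
  | infinite => exact exists_subgroup_of_forall_pos hE
  | finite p =>
    obtain ⟨l, hl, hl1, h⟩ := hE
    exact exists_subgroup_of_forall_zpow (K := ℚ_[p]) hl hl1 h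

/-- An element of class `𝒜'` is diagonalizable with eigenvalues in a group that contains no
nontrivial scalar of absolute value one. -/
theorem LinearAlgebraicGroup.IsClassA'.exists_eq_diagonal {σ : Place} {n : ℕ}
    {G : LinearAlgebraicGroup σ.Completion n} {a : G.points} (ha : G.IsClassA' a) :
    ∃ (Q Q' : Matrix (Fin n) (Fin n) σ.Completion) (d : Fin n → σ.Completionˣ)
      (Λ : Subgroup σ.Completionˣ), Q * Q' = 1 ∧
      ((a : GL (Fin n) σ.Completion) : Matrix (Fin n) (Fin n) σ.Completion) =
        Q * Matrix.diagonal (fun i => (d i : σ.Completion)) * Q' ∧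
      (∀ i, d i ∈ Λ) ∧ ∀ x ∈ Λ, ‖(x : σ.Completion)‖ = 1 → x = 1 := by
  obtain ⟨-, ⟨P, hP⟩, hE⟩ := ha
  have hmem : (a : GL (Fin n) σ.Completion) ∈
      Subgroup.zpowers (a : GL (Fin n) σ.Completion) := Subgroup.mem_zpowers _
  obtain ⟨Λ, hEΛ, hΛ⟩ := σ.exists_subgroup hE
  set D : GL (Fin n) σ.Completion := P * (a : GL (Fin n) σ.Completion) * P⁻¹ with hD
  set c := Matrix.diag (D : Matrix (Fin n) (Fin n) σ.Completion) with hc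
  have hDc : (D : Matrix (Fin n) (Fin n) σ.Completion) = Matrix.diagonal c :=
    (hP _ hmem).diagonal_diag.symm
  have hPP : ((P⁻¹ : GL (Fin n) σ.Completion) : Matrix (Fin n) (Fin n) σ.Completion) * P = 1 := by
    rw [← Units.val_mul, inv_mul_cancel, Units.val_one]
  have haD : ((a : GL (Fin n) σ.Completion) : Matrix (Fin n) (Fin n) σ.Completion) =
      ((P⁻¹ : GL (Fin n) σ.Completion) : Matrix (Fin n) (Fin n) σ.Completion) *
        Matrix.diagonal c * P := by
    rw [← hDc, ← Units.val_mul, ← Units.val_mul, hD]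
    congr 1
    group
  have hcE : ∀ i, ∃ l ∈ Λ, (l : σ.Completion) = c i := by
    intro i
    -- The columns of `P⁻¹` are eigenvectors for the diagonal entries.
    refine hEΛ _ ⟨_, hmem, Module.End.hasEigenvalue_of_hasEigenvector (x :=
      ((P⁻¹ : GL (Fin n) σ.Completion) : Matrix (Fin n) (Fin n) σ.Completion).mulVec
        (Pi.single i 1)) ⟨Module.End.mem_eigenspace_iff.2 ?_, fun h0 => ?_⟩⟩
    · rw [Matrix.toLin'_apply, haD, Matrix.mulVec_mulVec, mul_assoc, mul_eq_one_comm.1 hPP, mul_one,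
        ← Matrix.mulVec_mulVec, Matrix.diagonal_mulVec_single, ← Matrix.mulVec_smul,
        ← Pi.single_smul, smul_eq_mul]
    · have h1 := congrArg (P : Matrix (Fin n) (Fin n) σ.Completion).mulVec h0
      rw [Matrix.mulVec_mulVec, mul_eq_one_comm.1 hPP, Matrix.one_mulVec, Matrix.mulVec_zero] at h1
      have h2 := congrFun h1 i
      rw [Pi.single_eq_same, Pi.zero_apply] at h2
      exact one_ne_zero h2
  choose d hd hdc using hcE
  refine ⟨_, _, d, Λ, hPP, ?_, hd, hΛ⟩
  rw [haD]
  congr 3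
  exact funext fun i => (hdc i).symm

end ClassA

end

theorem lemma6p2 (σ : Place) {n : ℕ} (G : LinearAlgebraicGroup σ.Completion n)
    (hconn : G.IsZariskiConnected) (hrad : G.radical = G.unipotentRadical)
    (a : G.points) (ha : G.IsClassA' a) :
    (∀ {V : Type*} [AddCommGroup V] [Module σ.Completion V] [FiniteDimensional σ.Completion V]
      (ρ : G.AlgRep V), ∀ w ∈ expandingSubspace (ρ.onPoints a), w ≠ 0 →
        ∃ u ∈ G.stableHorospherical a,
          ρ.onPoints u w ∉
            expandingSubspace (ρ.onPoints a) ⊔ neutralSubspace (ρ.onPoints a)) ∧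
    (∀ w ∈ expandingSubspace (G.Ad a), w ≠ 0 →
      ∃ u ∈ G.stableHorospherical a,
        G.Ad u w ∉ expandingSubspace (G.Ad a) ⊔ neutralSubspace (G.Ad a)) := by
  obtain ⟨Q, Q', d, Λ, hQ, hA, hd, hΛ⟩ := ha.exists_eq_diagonal
  constructor
  · intro V _ _ _ ρ w hw hw0
    let b := Module.finBasis σ.Completion V
    obtain ⟨P, hP, he⟩ := ρ.exists_isPolyRep (fun g hg => G.det_eq_one hconn hrad hg) b
    exact G.exists_notMem_of_intertwining hconn hrad hP hQ hA hd hΛ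
      b.equivFun.toLinearMap b.equivFun.injective he hw hw0
  · intro w hw hw0
    -- The Lie algebra sits in the space of all matrices, where conjugation is polynomial because
    -- the inverse is the adjugate.
    exact G.exists_notMem_of_intertwining hconn hrad G.isPolyRep_conjRep hQ hA hd hΛ
      (matrixEntries σ.Completion n ∘ₗ G.lieAlgebra.subtype)
      (matrixEntries_injective.comp Subtype.val_injective)
      (fun g X => (G.conjRep_mulVec_coe hconn hrad g X).symm) hw hw0
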